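/- A real variety $(C,\tau)$ is an integral scheme $C$ of finite type over $\mathbb{C}$ with an involution $\tau$ lifting the complex conjugation of $\mathrm{Spec}(\mathbb{C})$. The circle $\mathbb{S}^1$ is $\mathbb{G}_{m,\mathbb{C}}=\mathrm{Spec}(\mathbb{C}[t^{\pm1}])$ with the real structure $\sigma_0$, the composition of $t\mapsto t^{-1}$ with complex conjugation. An $\mathbb{S}^1$-torsor over $(C,\tau)$ is a real variety $(P,\sigma)$ with a real morphism $\rho:(P,\sigma)\to(C,\tau)$ over $\mathbb{C}$ and an action $\mu:\mathbb{G}_{m,\mathbb{C}}\times P\to P$ over $C$, such that $\sigma\circ\mu=\mu\circ(\sigma_0\times\sigma)$ and $P$ is, Zariski locally on $C$, equivariantly isomorphic over $C$ to $C\times\mathbb{G}_{m,\mathbb{C}}$ with the action by translations. An isomorphism of $\mathbb{S}^1$-torsors over $(C,\tau)$ is an equivariant isomorphism over $C$ commuting with the real structures. Let $\mathcal{K}_C$ be the sheaf of rational functions on $C$. Consider the pairs $(\mathcal{L},h)$ consisting of an invertible $\mathcal{O}_C$-submodule $\mathcal{L}\subset\mathcal{K}_C$ and a nonzero real rational function $h$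 on $(C,\tau)$ (that is, $\tau^*h=h$) such that $\mathcal{L}\otimes\tau^*\mathcal{L}=h^{-1}\mathcal{O}_C$ as $\mathcal{O}_C$-submodules of $\mathcal{K}_C$. An $\mathbb{S}^1$-torsor $\rho:(P,\sigma)\to(C,\tau)$ is said to be determined by $(\mathcal{L},h)$ if there is an isomorphism of $\mathbb{Z}$-graded $\mathcal{O}_C$-algebras $\rho_*\mathcal{O}_P\cong\bigoplus_{m\in\mathbb{Z}}\mathcal{L}^{\otimes m}$, where the piece of degree $m$ of $\rho_*\mathcal{O}_P$ consists of the $f$ with $\mu^*f=f\otimes t^m$, under which $\sigma^*$ becomes $\mathcal{L}^{\otimes m}\to\tau_*\mathcal{L}^{\otimes(-m)}$, $s\mapsto h^m\,\tau^*s$. (Here $\mathcal{L}^{\otimes m}=(\mathcal{L}^\vee)^{\otimes(-m)}$ for $m<0$.) **Lemma.** Every $\mathbb{S}^1$-torsor over $(C,\tau)$ is determined by such a pair, and every such pair determines an $\mathbb{S}^1$-torsor over $(C,\tau)$. Furthermore, two such pairs $(\mathcal{L}_1,h_1)$ and $(\mathcal{L}_2,h_2)$ determine isomorphic $\mathbb{S}^1$-torsors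 if and only if there exists a rational function $f\in\Gamma(C,\mathcal{K}_C^*)$ such that $\mathcal{L}_1^\vee\otimes\mathcal{L}_2=f^{-1}\mathcal{O}_C$ as $\mathcal{O}_C$-submodules of $\mathcal{K}_C$ and $h_2=(f\,\tau^*f)\,h_1$. -/

import Mathlib

open CategoryTheory AlgebraicGeometry Limits
open scoped LaurentPolynomial TensorProduct

noncomputable section

namespace CircleTorsors

/-! ### Complex varieties with a real structure -/

/-- The complex conjugation of `Spec ℂ`. -/
def specConj : Spec (.of ℂ) ⟶ Spec (.of ℂ) :=
  Spec.map (CommRingCat.ofHom (starRingEnd ℂ))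

/-- A real algebraic variety, seen as a pair: a complex variety (an integral scheme of finite type
over `ℂ`; over the algebraically closed field `ℂ`, integral and geometrically integral are the same)
together with a real structure, that is, an involution `conj` lifting the complex conjugation. -/
structure RealVariety where
  /-- the complex variety -/
  X : Scheme.{0}
  /-- the structure morphism -/
  str : X ⟶ Spec (.of ℂ)
  [isIntegral : IsIntegral X]
  [locallyOfFiniteType : LocallyOfFiniteType str]
  [quasiCompact : QuasiCompact str]
  /-- the real structure -/
  conj : X ⟶ X
  conj_conj : conj ≫ conj = 𝟙 X
  conj_str : conj ≫ str = str ≫ specConj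

attribute [instance] RealVariety.isIntegral RealVariety.locallyOfFiniteType
  RealVariety.quasiCompact

/-! ### The circle `(𝔾ₘ, σ₀)` and its actions -/

/-- The multiplicative group over `ℂ`, as a scheme: `Spec ℂ[t, t⁻¹]`. -/
abbrev Gm : Scheme.{0} := Spec (.of ℂ[T;T⁻¹])

/-- The structure morphism of `Gm`. -/
def Gm.str : Gm ⟶ Spec (.of ℂ) :=
  Spec.map (CommRingCat.ofHom (algebraMap ℂ ℂ[T;T⁻¹]))

/-- The unit section `t = 1` of `Gm` (comorphism: the counit `t ↦ 1`). -/
def Gm.one : Spec (.of ℂ) ⟶ Gm :=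
  Spec.map (CommRingCat.ofHom
    (Bialgebra.counitAlgHom ℂ ℂ[T;T⁻¹] : ℂ[T;T⁻¹] →+* ℂ))

/-- The multiplication of `Gm` (comorphism: the comultiplication `t ↦ t ⊗ t`). -/
def Gm.mul : pullback Gm.str Gm.str ⟶ Gm :=
  (pullbackSpecIso ℂ ℂ[T;T⁻¹] ℂ[T;T⁻¹]).hom ≫
    Spec.map (CommRingCat.ofHom
      (Bialgebra.comulAlgHom ℂ ℂ[T;T⁻¹] : ℂ[T;T⁻¹] →+* ℂ[T;T⁻¹] ⊗[ℂ] ℂ[T;T⁻¹]))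

/-- The comorphism `∑ aₘ tᵐ ↦ ∑ conj(aₘ) t⁻ᵐ` of the real structure of the circle. -/
def circleConjComorphism : ℂ[T;T⁻¹] →+* ℂ[T;T⁻¹] :=
  (LaurentPolynomial.invert (R := ℂ) : ℂ[T;T⁻¹] →+* ℂ[T;T⁻¹]).comp
    (AddMonoidAlgebra.mapRingHom ℤ (starRingEnd ℂ))

lemma circleConjComorphism_C_mul_T (a : ℂ) (m : ℤ) :
    circleConjComorphism (LaurentPolynomial.C a * LaurentPolynomial.T m) =
      LaurentPolynomial.C (starRingEnd ℂ a) * LaurentPolynomial.T (-m) := by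
  rw [circleConjComorphism, RingHom.comp_apply]
  have : AddMonoidAlgebra.mapRingHom ℤ (starRingEnd ℂ)
      (LaurentPolynomial.C a * LaurentPolynomial.T m) =
      LaurentPolynomial.C (starRingEnd ℂ a) * LaurentPolynomial.T m := by
    rw [← LaurentPolynomial.single_eq_C_mul_T, ← LaurentPolynomial.single_eq_C_mul_T]
    exact AddMonoidAlgebra.map_single _ _ _
  rw [this]
  simp

/-- The real structure `σ₀` on `Gm` that makes it the circle `𝕊¹`: the composition of the inversion
`t ↦ t⁻¹` with the complex conjugation. -/
def Gm.circleConj : Gm ⟶ Gm := Spec.map (CommRingCat.ofHom circleConjComorphism)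

lemma Gm.circleConj_str : Gm.circleConj ≫ Gm.str = Gm.str ≫ specConj := by
  unfold Gm.circleConj Gm.str specConj
  rw [← Spec.map_comp, ← Spec.map_comp, ← CommRingCat.ofHom_comp, ← CommRingCat.ofHom_comp]
  congr 2
  ext1 a
  have := circleConjComorphism_C_mul_T a 0
  rwa [LaurentPolynomial.T_zero, neg_zero, LaurentPolynomial.T_zero, mul_one, mul_one] at this

lemma Gm.one_str : Gm.one ≫ Gm.str = 𝟙 _ := by
  unfold Gm.one Gm.str
  rw [← Spec.map_comp, ← CommRingCat.ofHom_comp, ← Spec.map_id]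
  congr 1
  ext a
  exact AlgHom.commutes (Bialgebra.counitAlgHom ℂ ℂ[T;T⁻¹]) a

lemma Gm.mul_str : Gm.mul ≫ Gm.str = pullback.fst _ _ ≫ Gm.str := by
  have h := pullbackSpecIso_inv_fst ℂ ℂ[T;T⁻¹] ℂ[T;T⁻¹]
  rw [Iso.inv_comp_eq] at h
  unfold Gm.mul Gm.str
  erw [h]
  rw [Category.assoc, Category.assoc, ← Spec.map_comp, ← Spec.map_comp, ← CommRingCat.ofHom_comp,
    ← CommRingCat.ofHom_comp]
  congr 3
  ext a
  simp [Algebra.TensorProduct.algebraMap_apply]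

/-- For a scheme `q : Y ⟶ Spec ℂ`, the morphism `Gm × (Gm × Y) ⟶ Gm × Y`, `(s, (t, y)) ↦ (s t, y)`,
which is the action of `Gm` on `Gm × Y` by translations on the factor `Gm`. -/
def Gm.translate {Y : Scheme.{0}} (q : Y ⟶ Spec (.of ℂ)) :
    pullback Gm.str (pullback.snd Gm.str q ≫ q) ⟶ pullback Gm.str q :=
  pullback.lift
    (pullback.lift (pullback.fst _ _) (pullback.snd _ _ ≫ pullback.fst _ _)
      (by rw [pullback.condition, Category.assoc, pullback.condition]) ≫ Gm.mul)
    (pullback.snd _ _ ≫ pullback.snd _ _)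
    (by rw [Category.assoc, Gm.mul_str, pullback.lift_fst_assoc, pullback.condition,
      Category.assoc])

/-- An action of the circle `𝕊¹ = (Gm, σ₀)` on a real variety `(V, σ)`: an action
`act : Gm × V ⟶ V` of the complex group scheme `Gm` with `σ ∘ act = act ∘ (σ₀ × σ)`. -/
structure CircleAction (V : RealVariety) where
  /-- the action morphism -/
  act : pullback Gm.str V.str ⟶ V.X
  act_str : act ≫ V.str = pullback.snd _ _ ≫ V.str
  one_act : pullback.lift (V.str ≫ Gm.one) (𝟙 V.X)
    (by rw [Category.assoc, Gm.one_str, Category.comp_id, Category.id_comp]) ≫ act = 𝟙 V.X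
  mul_act : Gm.translate V.str ≫ act =
    pullback.map Gm.str (pullback.snd Gm.str V.str ≫ V.str) Gm.str V.str (𝟙 Gm) act (𝟙 _)
      (by simp) (by rw [act_str, Category.comp_id]) ≫ act
  real : act ≫ V.conj =
    pullback.map Gm.str V.str Gm.str V.str Gm.circleConj V.conj specConj
      Gm.circleConj_str.symm V.conj_str.symm ≫ act

/-- An `𝕊¹`-torsor `ρ : (P, σ) ⟶ (C, τ)` over a real variety: a real variety `(P, σ)` with an
`𝕊¹`-action and a real morphism `ρ`, such that `Gm` acts by automorphisms over `C` and such that,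
Zariski locally on `C`, the scheme `P` is `Gm`-equivariantly isomorphic over `C` to
`Gm × C` with the action by translations. -/
structure CircleTorsor (C : RealVariety) extends RealVariety where
  /-- the action of the circle -/
  action : CircleAction toRealVariety
  /-- the projection to the base -/
  proj : X ⟶ C.X
  proj_str : proj ≫ C.str = str
  proj_real : conj ≫ proj = proj ≫ C.conj
  act_proj : action.act ≫ proj = pullback.snd _ _ ≫ proj
  locally_trivial : ∀ x : C.X, ∃ U : C.X.Opens, x ∈ U ∧
    ∃ e : pullback Gm.str (U.ι ≫ C.str) ≅ (proj ⁻¹ᵁ U : X.Opens).toScheme,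
      e.hom ≫ (proj ⁻¹ᵁ U).ι ≫ proj = pullback.snd _ _ ≫ U.ι ∧
      ∃ h : (e.hom ≫ (proj ⁻¹ᵁ U).ι) ≫ str = pullback.snd _ _ ≫ U.ι ≫ C.str,
        Gm.translate (U.ι ≫ C.str) ≫ e.hom ≫ (proj ⁻¹ᵁ U).ι =
          pullback.map Gm.str (pullback.snd Gm.str (U.ι ≫ C.str) ≫ U.ι ≫ C.str) Gm.str str
            (𝟙 Gm) (e.hom ≫ (proj ⁻¹ᵁ U).ι) (𝟙 _) (by simp)
            (by rw [h, Category.comp_id]) ≫ action.act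

/-- Two `𝕊¹`-torsors over `(C, τ)` are isomorphic if there is an isomorphism over `C` that is
`Gm`-equivariant and compatible with the real structures. -/
def CircleTorsor.IsIsomorphic {C : RealVariety} (P Q : CircleTorsor C) : Prop :=
  ∃ e : P.X ≅ Q.X, e.hom ≫ Q.proj = P.proj ∧ P.conj ≫ e.hom = e.hom ≫ Q.conj ∧
    ∃ h : e.hom ≫ Q.str = P.str,
      P.action.act ≫ e.hom =
        pullback.map Gm.str P.str Gm.str Q.str (𝟙 Gm) e.hom (𝟙 _)
          (by simp) (by rw [h, Category.comp_id]) ≫ Q.action.act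

/-! ### Submodules of the sheaf of rational functions -/

section RatSubsheaf

variable {X : Scheme.{0}} [IsIntegral X]

/-- An `𝒪`-submodule of the sheaf `𝒦` of rational functions of an integral scheme `X`. As `𝒦` is the
constant sheaf with value the function field `K` (so `𝒦(U) = K` for `U ≠ ∅` and `𝒦(∅) = 0`), it
consists of an `𝒪(U)`-submodule of `K` for each nonempty open `U`, compatibly with restriction and
with gluing. -/
@[ext]
structure RatSubsheaf (X : Scheme.{0}) [IsIntegral X] where
  /-- the sections over a nonempty open subset -/
  sections (U : X.Opens) [Nonempty U] : Submodule Γ(X, U) X.functionField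
  res {U V : X.Opens} [Nonempty U] [Nonempty V] (hVU : V ≤ U) {s : X.functionField} :
    s ∈ sections U → s ∈ sections V
  glue (U : X.Opens) [Nonempty U] (s : X.functionField) :
    (∀ x ∈ U, ∃ (V : X.Opens) (_ : Nonempty V), x ∈ V ∧ V ≤ U ∧ s ∈ sections V) → s ∈ sections U

lemma germToFunctionField_res {U V : X.Opens} [Nonempty U] [Nonempty V] (hVU : V ≤ U)
    (a : Γ(X, U)) :
    X.germToFunctionField V (X.presheaf.map (homOfLE hVU).op a) = X.germToFunctionField U a := by
  rw [Scheme.germToFunctionField, Scheme.germToFunctionField]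
  exact X.presheaf.germ_res_apply (homOfLE hVU) _ _ a

/-- A rational function that is regular near each point of `U` is regular on `U`. -/
lemma exists_germToFunctionField_eq (U : X.Opens) [Nonempty U] (s : X.functionField)
    (h : ∀ x ∈ U, ∃ (V : X.Opens) (_ : Nonempty V), x ∈ V ∧ V ≤ U ∧
      ∃ a : Γ(X, V), X.germToFunctionField V a = s) :
    ∃ a : Γ(X, U), X.germToFunctionField U a = s := by
  choose V hV hxV hVU a ha using fun x : U => h x.1 x.2
  have hV' (x : U) : Nonempty (V x) := ⟨⟨x.1, hxV x⟩⟩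
  obtain ⟨b, hb, -⟩ := TopCat.Sheaf.existsUnique_gluing' X.sheaf V U (fun x => homOfLE (hVU x))
    (fun x hx => TopologicalSpace.Opens.mem_iSup.2 ⟨⟨x, hx⟩, hxV ⟨x, hx⟩⟩) a (by
      intro x y
      have hne : Nonempty (V x ⊓ V y : X.Opens) := by
        have := (genericPoint_spec X).mem_open_set_iff (V x ⊓ V y).isOpen
        have h1 := (genericPoint_spec X).mem_open_set_iff (V x).isOpen
        have h2 := (genericPoint_spec X).mem_open_set_iff (V y).isOpen
        refine ⟨⟨genericPoint X, ?_, ?_⟩⟩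
        · exact h1.2 (by simpa using hV' x)
        · exact h2.2 (by simpa using hV' y)
      apply X.germToFunctionField_injective (V x ⊓ V y)
      exact (germToFunctionField_res inf_le_left (a x)).trans
        ((ha x).trans ((ha y).symm.trans (germToFunctionField_res inf_le_right (a y)).symm)))
  obtain ⟨x⟩ := ‹Nonempty U›
  have : Nonempty U := ⟨x⟩
  have : Nonempty (V x) := hV' x
  refine ⟨b, ?_⟩
  rw [← ha x, ← hb x]
  exact (germToFunctionField_res (hVU x) b).symm

/-- The submodule `f 𝒪` of `𝒦` generated by a rational function `f`. -/
def RatSubsheaf.principal (f : X.functionField) : RatSubsheaf X where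
  sections U _ := Submodule.span Γ(X, U) {f}
  res {U V} _ _ hVU {s} hs := by
    obtain ⟨a, rfl⟩ := Submodule.mem_span_singleton.1 hs
    refine Submodule.mem_span_singleton.2 ⟨X.presheaf.map (homOfLE hVU).op a, ?_⟩
    exact congrArg (· * f) (germToFunctionField_res hVU a)
  glue U _ s hs := by
    by_cases hf : f = 0
    · obtain ⟨x⟩ := ‹Nonempty U›
      obtain ⟨V, _, -, -, h⟩ := hs x.1 x.2
      subst hf
      have : s = 0 := by simpa using h
      rw [this]
      exact Submodule.zero_mem _
    · obtain ⟨a, ha⟩ := exists_germToFunctionField_eq U (s * f⁻¹) (by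
        intro x hx
        obtain ⟨V, hV, hxV, hVU, h⟩ := hs x hx
        obtain ⟨a, rfl⟩ := Submodule.mem_span_singleton.1 h
        exact ⟨V, hV, hxV, hVU, a, (mul_inv_cancel_right₀ hf _).symm⟩)
      refine Submodule.mem_span_singleton.2 ⟨a, ?_⟩
      exact (congrArg (· * f) ha).trans (inv_mul_cancel_right₀ hf s)

/-- The tensor product of two submodules of `𝒦`, seen in `𝒦` through multiplication: the image of
`L ⊗ M ⟶ 𝒦`, whose sections are the rational functions that are locally sums of products. (For
invertible `L` and `M` the morphism `L ⊗ M ⟶ 𝒦` is injective.) -/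
def RatSubsheaf.tensor (L M : RatSubsheaf X) : RatSubsheaf X where
  sections U _ :=
    { carrier := {s | ∀ x ∈ U, ∃ (V : X.Opens) (_ : Nonempty V), x ∈ V ∧ V ≤ U ∧
        s ∈ Submodule.span Γ(X, V)
          {r | ∃ l ∈ L.sections V, ∃ m ∈ M.sections V, r = l * m}}
      zero_mem' := fun x hx => ⟨U, inferInstance, hx, le_rfl, Submodule.zero_mem _⟩
      add_mem' := by
        intro s t hs ht x hx
        obtain ⟨V, hV, hxV, hVU, h⟩ := hs x hx
        obtain ⟨W, hW, hxW, hWU, h'⟩ := ht x hx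
        have hVW : Nonempty (V ⊓ W : X.Opens) := ⟨⟨x, hxV, hxW⟩⟩
        refine ⟨V ⊓ W, hVW, ⟨hxV, hxW⟩, inf_le_left.trans hVU, Submodule.add_mem _ ?_ ?_⟩
        · exact span_res inf_le_left h
        · exact span_res inf_le_right h'
      smul_mem' := by
        intro a s hs x hx
        obtain ⟨V, hV, hxV, hVU, h⟩ := hs x hx
        refine ⟨V, hV, hxV, hVU, ?_⟩
        have := Submodule.smul_mem _ (X.presheaf.map (homOfLE hVU).op a) h
        have e : X.presheaf.map (homOfLE hVU).op a • s = a • s :=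
          congrArg (· * s) (germToFunctionField_res hVU a)
        rwa [e] at this }
  res {U V} _ _ hVU {s} hs x hx := by
    obtain ⟨W, hW, hxW, hWU, h⟩ := hs x (hVU hx)
    have hVW : Nonempty (W ⊓ V : X.Opens) := ⟨⟨x, hxW, hx⟩⟩
    exact ⟨W ⊓ V, hVW, ⟨hxW, hx⟩, inf_le_right, span_res inf_le_left h⟩
  glue U _ s hs x hx := by
    obtain ⟨V, hV, hxV, hVU, h⟩ := hs x hx
    obtain ⟨W, hW, hxW, hWV, h'⟩ := h x hxV
    exact ⟨W, hW, hxW, hWV.trans hVU, h'⟩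
where
  span_res {L M : RatSubsheaf X} {U V : X.Opens} [Nonempty U] [Nonempty V] (hVU : V ≤ U)
      {s : X.functionField}
      (hs : s ∈ Submodule.span Γ(X, U) {r | ∃ l ∈ L.sections U, ∃ m ∈ M.sections U, r = l * m}) :
      s ∈ Submodule.span Γ(X, V) {r | ∃ l ∈ L.sections V, ∃ m ∈ M.sections V, r = l * m} := by
    induction hs using Submodule.span_induction with
    | mem r hr =>
      obtain ⟨l, hl, m, hm, rfl⟩ := hr
      exact Submodule.subset_span ⟨l, L.res hVU hl, m, M.res hVU hm, rfl⟩
    | zero => exact Submodule.zero_mem _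
    | add r t _ _ hr ht => exact Submodule.add_mem _ hr ht
    | smul a r _ hr =>
      have := Submodule.smul_mem _ (X.presheaf.map (homOfLE hVU).op a) hr
      have e : X.presheaf.map (homOfLE hVU).op a • r = a • r :=
        congrArg (· * r) (germToFunctionField_res hVU a)
      rwa [e] at this

/-- The dual `L^∨ = Hom(L, 𝒪)` of a submodule of `𝒦`, seen in `𝒦`: its sections over `U` are the
rational functions `s` such that multiplication by `s` maps `L|_U` to `𝒪_U`. -/
def RatSubsheaf.dual (L : RatSubsheaf X) : RatSubsheaf X where
  sections U _ :=
    { carrier := {s | ∀ (V : X.Opens) [Nonempty V], V ≤ U → ∀ l ∈ L.sections V,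
        ∃ a : Γ(X, V), X.germToFunctionField V a = s * l}
      zero_mem' := fun V _ _ l _ => ⟨0, by rw [map_zero, zero_mul]⟩
      add_mem' := by
        intro s t hs ht V _ hVU l hl
        obtain ⟨a, ha⟩ := hs V hVU l hl
        obtain ⟨b, hb⟩ := ht V hVU l hl
        exact ⟨a + b, by rw [map_add, ha, hb, add_mul]⟩
      smul_mem' := by
        intro c s hs V _ hVU l hl
        obtain ⟨a, ha⟩ := hs V hVU l hl
        refine ⟨X.presheaf.map (homOfLE hVU).op c * a, ?_⟩
        rw [map_mul, ha, germToFunctionField_res hVU c, ← mul_assoc]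
        rfl }
  res {U V} _ _ hVU {s} hs W _ hWV l hl := hs W (hWV.trans hVU) l hl
  glue U _ s hs V _ hVU l hl := by
    apply exists_germToFunctionField_eq
    intro x hx
    obtain ⟨W, hW, hxW, hWU, h⟩ := hs x (hVU hx)
    have hVW : Nonempty (W ⊓ V : X.Opens) := ⟨⟨x, hxW, hx⟩⟩
    exact ⟨W ⊓ V, hVW, ⟨hxW, hx⟩, inf_le_right, h (W ⊓ V) inf_le_left l (L.res inf_le_right hl)⟩

/-- The tensor power `L^{⊗n}` for a natural number `n`. -/
def RatSubsheaf.npow (L : RatSubsheaf X) : ℕ → RatSubsheaf X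
  | 0 => RatSubsheaf.principal 1
  | n + 1 => (L.npow n).tensor L

/-- The tensor power `L^{⊗m}` for an integer `m`; for `m < 0` it is the `(-m)`-th tensor power of
the dual of `L`. -/
def RatSubsheaf.zpow (L : RatSubsheaf X) : ℤ → RatSubsheaf X
  | Int.ofNat n => L.npow n
  | Int.negSucc n => L.dual.npow (n + 1)

/-- A submodule of `𝒦` is invertible if it is locally free of rank one, that is, locally of the form
`g 𝒪` for a nonzero rational function `g`. -/
def RatSubsheaf.IsInvertible (L : RatSubsheaf X) : Prop :=
  ∀ x : X, ∃ U : X.Opens, x ∈ U ∧ ∃ g : X.functionField, g ≠ 0 ∧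
    ∀ (V : X.Opens) [Nonempty V], V ≤ U → L.sections V = Submodule.span Γ(X, V) {g}

end RatSubsheaf

/-! ### The action of the real structure on rational functions -/

section Conj

variable (C : RealVariety)

instance : IsIso C.conj := ⟨C.conj, C.conj_conj, C.conj_conj⟩

/-- The comorphism `τ^* : K ⟶ K` of the real structure `τ` on the field of rational functions: the
map on stalks at the generic point, which is fixed by `τ`. -/
def RealVariety.ratConj : C.X.functionField →+* C.X.functionField :=
  (C.X.presheaf.stalkSpecializes
    (specializes_of_eq (genericPoint_eq_of_isOpenImmersion C.conj)) ≫
      C.conj.stalkMap (genericPoint C.X)).hom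

instance (U : C.X.Opens) [h : Nonempty U] : Nonempty (C.conj ⁻¹ᵁ U : C.X.Opens) := by
  obtain ⟨x⟩ := h
  refine ⟨⟨C.conj x.1, ?_⟩⟩
  change C.conj (C.conj x.1) ∈ U
  rw [← Scheme.Hom.comp_apply, C.conj_conj]
  exact x.2

lemma RealVariety.ratConj_germ (U : C.X.Opens) [Nonempty U] (a : Γ(C.X, U)) :
    C.ratConj (C.X.germToFunctionField U a) =
      C.X.germToFunctionField (C.conj ⁻¹ᵁ U) (C.conj.app U a) := by
  unfold RealVariety.ratConj Scheme.germToFunctionField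
  rw [CommRingCat.hom_comp, RingHom.comp_apply]
  erw [TopCat.Presheaf.germ_stalkSpecializes_apply]
  exact Scheme.Hom.germ_stalkMap_apply C.conj U _ _ a

lemma RealVariety.ratConj_ratConj (s : C.X.functionField) : C.ratConj (C.ratConj s) = s := by
  obtain ⟨U, -, a, _, rfl, -⟩ : ∃ U ∈ (Set.univ : Set C.X.Opens), ∃ a : Γ(C.X, U),
      ∃ _ : Nonempty U, C.X.germToFunctionField U a = s ∧ True := by
    obtain ⟨U, hU, a, ha⟩ := C.X.presheaf.exists_germ_eq s
    exact ⟨U, trivial, a, ⟨⟨_, hU⟩⟩, ha, trivial⟩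
  rw [ratConj_germ, ratConj_germ]
  have key : ∀ (g : C.X ⟶ C.X) (hg : g = 𝟙 _) (_ : Nonempty (g ⁻¹ᵁ U : C.X.Opens)),
      C.X.germToFunctionField (g ⁻¹ᵁ U) (g.app U a) = C.X.germToFunctionField U a := by
    rintro g rfl _
    rw [Scheme.Hom.id_app]
    rfl
  have := key _ C.conj_conj (inferInstanceAs (Nonempty (C.conj ⁻¹ᵁ (C.conj ⁻¹ᵁ U) : C.X.Opens)))
  rw [Scheme.Hom.comp_app] at this
  exact this

/-- The pull-back `τ^* L` of a submodule `L ⊆ 𝒦` by the real structure `τ`: as `τ` is an involution,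
`(τ^* L)(U) = { τ^* s | s ∈ L(τ(U)) }` with `τ(U) = τ⁻¹(U)`. -/
def RealVariety.pullbackConj (L : RatSubsheaf C.X) : RatSubsheaf C.X where
  sections U _ :=
    { carrier := {r | ∃ s ∈ L.sections (C.conj ⁻¹ᵁ U), C.ratConj s = r}
      zero_mem' := ⟨0, Submodule.zero_mem _, map_zero _⟩
      add_mem' := by
        rintro _ _ ⟨s, hs, rfl⟩ ⟨t, ht, rfl⟩
        exact ⟨s + t, Submodule.add_mem _ hs ht, map_add _ _ _⟩
      smul_mem' := by
        rintro a _ ⟨s, hs, rfl⟩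
        refine ⟨C.conj.app U a • s, Submodule.smul_mem _ _ hs, ?_⟩
        change C.ratConj (C.X.germToFunctionField _ (C.conj.app U a) * s) =
          C.X.germToFunctionField U a * C.ratConj s
        rw [map_mul, ← ratConj_germ, ratConj_ratConj] }
  res {U V} _ _ hVU {s} hs := by
    obtain ⟨r, hr, rfl⟩ := hs
    exact ⟨r, L.res (show C.conj ⁻¹ᵁ V ≤ C.conj ⁻¹ᵁ U from fun x hx => hVU hx) hr, rfl⟩
  glue U _ s hs := by
    refine ⟨C.ratConj s, L.glue _ _ ?_, C.ratConj_ratConj s⟩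
    intro x hx
    obtain ⟨V, hV, hxV, hVU, r, hr, rfl⟩ := hs (C.conj x) hx
    refine ⟨C.conj ⁻¹ᵁ V, inferInstance, hxV, fun y hy => hVU hy, ?_⟩
    rwa [C.ratConj_ratConj]

end Conj

/-! ### Pairs `(L, h)` and the torsors they determine -/

/-- The pairs `(L, h)` on `(C, τ)`: an invertible submodule `L ⊆ 𝒦` and a nonzero real rational
function `h` such that `L ⊗ τ^* L = h⁻¹ 𝒪` as submodules of `𝒦`. -/
structure IsCirclePair (C : RealVariety) (L : RatSubsheaf C.X) (h : C.X.functionField) : Prop where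
  invertible : L.IsInvertible
  ne_zero : h ≠ 0
  real : C.ratConj h = h
  tensor_eq : L.tensor (C.pullbackConj L) = RatSubsheaf.principal h⁻¹

section Torsor

variable {C : RealVariety} (P : CircleTorsor C)

/-- Regular functions on `ρ⁻¹(U)` of weight `m`: those with `μ^* f = f ⊗ t^m`, as functions on
`Gm × ρ⁻¹(U)`. -/
def CircleTorsor.IsWeight (m : ℤ) (U : C.X.Opens) (f : Γ(P.X, P.proj ⁻¹ᵁ U)) : Prop :=
  P.action.act.appLE (P.proj ⁻¹ᵁ U) (pullback.snd Gm.str P.str ⁻¹ᵁ P.proj ⁻¹ᵁ U)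
      (by rw [← Scheme.Hom.comp_preimage, ← Scheme.Hom.comp_preimage, P.act_proj]) f =
    (pullback.snd Gm.str P.str).app (P.proj ⁻¹ᵁ U) f *
      (pullback.fst Gm.str P.str).appLE ⊤ (pullback.snd Gm.str P.str ⁻¹ᵁ P.proj ⁻¹ᵁ U) le_top
        ((Scheme.ΓSpecIso (.of ℂ[T;T⁻¹])).inv (LaurentPolynomial.T m : ℂ[T;T⁻¹]))

/-- The comorphism `σ^* : (ρ_* 𝒪_P)(U) ⟶ (ρ_* 𝒪_P)(τ⁻¹(U))` of the real structure `σ` of `P`. -/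
def CircleTorsor.conjComorphism (U : C.X.Opens) :
    Γ(P.X, P.proj ⁻¹ᵁ U) →+* Γ(P.X, P.proj ⁻¹ᵁ C.conj ⁻¹ᵁ U) :=
  (P.conj.appLE (P.proj ⁻¹ᵁ U) (P.proj ⁻¹ᵁ C.conj ⁻¹ᵁ U)
    (by rw [← Scheme.Hom.comp_preimage, ← Scheme.Hom.comp_preimage, P.proj_real])).hom

/-- An isomorphism `ρ_* 𝒪_P = ⨁ L^{⊗m}` of `ℤ`-graded `𝒪_C`-algebras, where `ρ_* 𝒪_P` is graded by
the weights of the action, under which the comorphism `σ^*` of the real structure of `P` is the one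
that `h` defines, namely `L^{⊗m} ⟶ L^{⊗-m}`, `s ↦ h^m τ^* s`.

As all `L^{⊗m}` lie in `𝒦`, the sections of `⨁ L^{⊗m}` over `U` are the Laurent polynomials
`∑ s_m T^m` over the function field with `s_m ∈ L^{⊗m}(U)`. -/
structure CircleTorsor.Presentation (L : RatSubsheaf C.X) (h : C.X.functionField) where
  /-- the isomorphism on the sections over `U`, with values in the Laurent polynomials -/
  toLaurent (U : C.X.Opens) [Nonempty U] : Γ(P.X, P.proj ⁻¹ᵁ U) →+* (C.X.functionField)[T;T⁻¹]
  injective (U : C.X.Opens) [Nonempty U] : Function.Injective (toLaurent U)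
  mem_range_iff (U : C.X.Opens) [Nonempty U] (q : (C.X.functionField)[T;T⁻¹]) :
    q ∈ (toLaurent U).range ↔ ∀ m : ℤ, q.coeff m ∈ (L.zpow m).sections U
  restrict {U V : C.X.Opens} [Nonempty U] [Nonempty V] (hVU : V ≤ U) (f : Γ(P.X, P.proj ⁻¹ᵁ U)) :
    toLaurent V (P.X.presheaf.map (homOfLE (P.proj.preimage_mono hVU)).op f) = toLaurent U f
  base (U : C.X.Opens) [Nonempty U] (a : Γ(C.X, U)) :
    toLaurent U (P.proj.app U a) = LaurentPolynomial.C (C.X.germToFunctionField U a)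
  weight (U : C.X.Opens) [Nonempty U] (m : ℤ) (f : Γ(P.X, P.proj ⁻¹ᵁ U)) :
    P.IsWeight m U f ↔
      ∃ s : C.X.functionField, toLaurent U f = LaurentPolynomial.C s * LaurentPolynomial.T m
  conj (U : C.X.Opens) [Nonempty U] (m : ℤ) (f : Γ(P.X, P.proj ⁻¹ᵁ U)) (s : C.X.functionField) :
    toLaurent U f = LaurentPolynomial.C s * LaurentPolynomial.T m →
      toLaurent (C.conj ⁻¹ᵁ U) (P.conjComorphism U f) =
        LaurentPolynomial.C (h ^ m * C.ratConj s) * LaurentPolynomial.T (-m)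

/-- The `𝕊¹`-torsor `P` is the one determined by the pair `(L, h)`. -/
def CircleTorsor.IsDeterminedBy (L : RatSubsheaf C.X) (h : C.X.functionField) : Prop :=
  Nonempty (P.Presentation L h)

end Torsor

end CircleTorsors

end

open CategoryTheory AlgebraicGeometry Limits
open scoped LaurentPolynomial TensorProduct

noncomputable section

namespace CircleTorsors

/-! ### Generators of submodules of the sheaf of rational functions -/

section Generators

variable {X : Scheme.{0}} [IsIntegral X]

/-! A torsor is handled through the functor that it represents. A `Frame` of L along π : Y → X
attaches to every local generator of L a unit on Y, linearly in the generator; it is an isomorphism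
of π^*L with the structure sheaf. On the spectrum of ⨁ L^m over X the tautological frame sends g to
gT, and it is universal: every frame on a scheme Y over X is its pull-back by a unique X-morphism
from Y (`IsUniversal.hom_ext`, `IsUniversal.exists_pull_eq`). So structure on this scheme is given
by operations on frames. The group Gm acts by multiplying frames by units. The real structure comes
from `conjFrame`, whose unit at g is the inverse of the unit at (h τ^*g)⁻¹. That function generates
L on τ⁻¹(U) because L ⊗ τ^*L = h⁻¹𝒪, and the operation is an involution because τ^*h = h. The axioms
of a torsor then become identities between frames (`exists_torsor_of_isCirclePair`).

Over an affine trivializing U the functions on ρ⁻¹(U) are Laurent polynomials in the unit of the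
frame. Expanding that unit as gT removes the dependence on g and yields the graded isomorphism with
⨁ L^m. Hence a universal frame of weight one that σ carries to its conjugate is enough for a
presentation (`isDeterminedBy_of_frame`).

For a given torsor P, local sections produce units of weight one (`exists_splitting`), functions of
weight zero descend to the base (`exists_app_eq`), and frames of weight one are universal
(`isUniversal_of_isWeight`). As P is integral, a frame on it is encoded by one rational function θ,
with value θ·ρ^*g at g (`Frame.exists_coeff`), and compatibility with the real structures reads
σ^*θ·θ = ρ^*h (`conjComorphism_mul_conjSec_iff`). To find a pair for P, take a unit of weight one
over a dense open subset as θ: then L is generated locally by the k for which θ·ρ^*k is a unit of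
weight one, and σ^*θ·θ descends to h.

For the last claim, two such functions θ₁, θ₂ on the same torsor have weight one, so θ₂ = θ₁·ρ^*f
with f rational on C (`IsCoeff.exists_eq_twist`). Comparing generators gives L₁^∨ ⊗ L₂ = f⁻¹𝒪, and
comparing σ^*θ·θ gives h₂ = f·τ^*f·h₁. Conversely, multiplying θ₁ by ρ^*f produces a frame for the
second pair, and torsors carrying universal frames for the same pair are isomorphic. -/

/-- The rational functions that are regular on `U`. -/
def regularOn (U : X.Opens) [Nonempty U] : Subring X.functionField :=
  (X.germToFunctionField U).hom.range

lemma mem_regularOn {U : X.Opens} [Nonempty U] {s : X.functionField} :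
    s ∈ regularOn U ↔ ∃ a : Γ(X, U), X.germToFunctionField U a = s := Iff.rfl

lemma germ_mem_regularOn {U : X.Opens} [Nonempty U] (a : Γ(X, U)) :
    X.germToFunctionField U a ∈ regularOn U := ⟨a, rfl⟩

lemma regularOn_res {U V : X.Opens} [Nonempty U] [Nonempty V] (hVU : V ≤ U)
    {s : X.functionField} (hs : s ∈ regularOn U) : s ∈ regularOn V := by
  obtain ⟨a, rfl⟩ := hs
  exact ⟨X.presheaf.map (homOfLE hVU).op a, germToFunctionField_res hVU a⟩

lemma regularOn_glue (U : X.Opens) [Nonempty U] (s : X.functionField)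
    (h : ∀ x ∈ U, ∃ (V : X.Opens) (_ : Nonempty V), x ∈ V ∧ V ≤ U ∧ s ∈ regularOn V) :
    s ∈ regularOn U :=
  exists_germToFunctionField_eq U s h

namespace RatSubsheaf

/-- The rational function `g` generates `L` on `U`. -/
def IsGen (L : RatSubsheaf X) (U : X.Opens) (g : X.functionField) : Prop :=
  g ≠ 0 ∧ ∀ (V : X.Opens) [Nonempty V], V ≤ U → ∀ s, s ∈ L.sections V ↔ s * g⁻¹ ∈ regularOn V

lemma mem_span_singleton_iff {V : X.Opens} [Nonempty V] {g s : X.functionField} (hg : g ≠ 0) :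
    s ∈ Submodule.span Γ(X, V) {g} ↔ s * g⁻¹ ∈ regularOn V := by
  rw [Submodule.mem_span_singleton, mem_regularOn]
  refine exists_congr fun a => ?_
  change X.germToFunctionField V a * g = s ↔ _
  rw [eq_mul_inv_iff_mul_eq₀ hg]

lemma isGen_iff {L : RatSubsheaf X} {U : X.Opens} {g : X.functionField} :
    L.IsGen U g ↔ g ≠ 0 ∧ ∀ (V : X.Opens) [Nonempty V], V ≤ U →
      L.sections V = Submodule.span Γ(X, V) {g} := by
  refine and_congr_right fun hg => forall_congr' fun V => forall_congr' fun _ =>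
    forall_congr' fun _ => ?_
  rw [SetLike.ext_iff]
  exact forall_congr' fun s => by rw [mem_span_singleton_iff hg]

lemma isInvertible_iff {L : RatSubsheaf X} :
    L.IsInvertible ↔ ∀ x : X, ∃ U : X.Opens, x ∈ U ∧ ∃ g, L.IsGen U g := by
  simp only [IsInvertible, isGen_iff]

lemma IsGen.res {L : RatSubsheaf X} {U V : X.Opens} {g : X.functionField} (h : L.IsGen U g)
    (hVU : V ≤ U) : L.IsGen V g :=
  ⟨h.1, fun W _ hW => h.2 W (hW.trans hVU)⟩

lemma IsGen.self_mem {L : RatSubsheaf X} {U V : X.Opens} [Nonempty V] {g : X.functionField}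
    (h : L.IsGen U g) (hVU : V ≤ U) : g ∈ L.sections V := by
  rw [h.2 V hVU, mul_inv_cancel₀ h.1]
  exact one_mem _

lemma IsGen.div_mem {L : RatSubsheaf X} {U V : X.Opens} [Nonempty V] {g g' : X.functionField}
    (h : L.IsGen U g) (h' : L.IsGen V g') (hVU : V ≤ U) : g * g'⁻¹ ∈ regularOn V :=
  (h'.2 V le_rfl g).1 (h.self_mem hVU)

lemma IsGen.mul_unit {L : RatSubsheaf X} {U : X.Opens} [Nonempty U] {g g' : X.functionField}
    (h : L.IsGen U g) (hg' : g' ≠ 0) (h1 : g' * g⁻¹ ∈ regularOn U) (h2 : g * g'⁻¹ ∈ regularOn U) :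
    L.IsGen U g' := by
  refine ⟨hg', fun V _ hV s => (h.2 V hV s).trans ⟨fun hs => ?_, fun hs => ?_⟩⟩
  · have := mul_mem hs (regularOn_res hV h2)
    rwa [mul_assoc, inv_mul_cancel_left₀ h.1] at this
  · have := mul_mem hs (regularOn_res hV h1)
    rwa [mul_assoc, inv_mul_cancel_left₀ hg'] at this

lemma isGen_principal {f : X.functionField} (hf : f ≠ 0) (U : X.Opens) :
    (principal f).IsGen U f :=
  ⟨hf, fun _ _ _ _ => mem_span_singleton_iff hf⟩

/-- Sections of the tensor product are only locally sums of products, so regularity after division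
by g g' is checked on small open subsets and glued. Conversely a single product with second factor
g' suffices. -/
lemma IsGen.tensor {L M : RatSubsheaf X} {U : X.Opens} {g g' : X.functionField}
    (h : L.IsGen U g) (h' : M.IsGen U g') : (L.tensor M).IsGen U (g * g') := by
  refine ⟨mul_ne_zero h.1 h'.1, fun V _ hV s => ⟨fun hs => ?_, fun hs => ?_⟩⟩
  · refine regularOn_glue V _ fun x hx => ?_
    obtain ⟨W, hW, hxW, hWV, hsW⟩ := hs x hx
    refine ⟨W, hW, hxW, hWV, ?_⟩
    clear hs
    induction hsW using Submodule.span_induction with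
    | mem r hr =>
      obtain ⟨l, hl, m, hm, rfl⟩ := hr
      have := mul_mem ((h.2 W (hWV.trans hV) l).1 hl) ((h'.2 W (hWV.trans hV) m).1 hm)
      rwa [show l * m * (g * g')⁻¹ = l * g⁻¹ * (m * g'⁻¹) by rw [mul_inv]; ring]
    | zero => rw [zero_mul]; exact zero_mem _
    | add r t _ _ hr ht => rw [add_mul]; exact add_mem hr ht
    | smul a r _ hr =>
      change X.germToFunctionField W a * r * _ ∈ _
      rw [mul_assoc]
      exact mul_mem (germ_mem_regularOn a) hr
  · intro x hx
    refine ⟨V, inferInstance, hx, le_rfl, Submodule.subset_span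
      ⟨s * (g * g')⁻¹ * g, ?_, g', h'.self_mem hV, ?_⟩⟩
    · rwa [h.2 V hV, mul_inv_cancel_right₀ h.1]
    · rw [mul_assoc, inv_mul_cancel_right₀ (mul_ne_zero h.1 h'.1)]

lemma IsGen.dual {L : RatSubsheaf X} {U : X.Opens} {g : X.functionField}
    (h : L.IsGen U g) : L.dual.IsGen U g⁻¹ := by
  refine ⟨inv_ne_zero h.1, fun V _ hV s => ?_⟩
  rw [inv_inv]
  refine ⟨fun hs => hs V le_rfl g (h.self_mem hV), fun hs W _ hW l hl => ?_⟩
  have := mul_mem (regularOn_res hW hs) ((h.2 W (hW.trans hV) l).1 hl)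
  rwa [show s * g * (l * g⁻¹) = s * l by
    rw [show s * g * (l * g⁻¹) = s * l * (g * g⁻¹) by ring, mul_inv_cancel₀ h.1, mul_one]] at this

lemma IsGen.npow {L : RatSubsheaf X} {U : X.Opens} {g : X.functionField}
    (h : L.IsGen U g) : ∀ n : ℕ, (L.npow n).IsGen U (g ^ n)
  | 0 => by rw [pow_zero]; exact isGen_principal one_ne_zero U
  | n + 1 => by rw [pow_succ]; exact (IsGen.npow h n).tensor h

lemma IsGen.zpow {L : RatSubsheaf X} {U : X.Opens} {g : X.functionField}
    (h : L.IsGen U g) : ∀ m : ℤ, (L.zpow m).IsGen U (g ^ m)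
  | Int.ofNat n => by
    rw [Int.ofNat_eq_natCast, zpow_natCast]
    exact h.npow n
  | Int.negSucc n => by
    rw [zpow_negSucc, ← inv_pow]
    exact h.dual.npow (n + 1)

/-- Membership is local by `glue`, and a common generator decides it locally. Equalities of
invertible submodules are reduced in this way to identities between rational functions. -/
lemma ext_of_isGen {L M : RatSubsheaf X}
    (h : ∀ x : X, ∃ U : X.Opens, x ∈ U ∧ ∃ g, L.IsGen U g ∧ M.IsGen U g) : L = M := by
  have key : ∀ L M : RatSubsheaf X,
      (∀ x : X, ∃ U : X.Opens, x ∈ U ∧ ∃ g, L.IsGen U g ∧ M.IsGen U g) →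
      ∀ (U : X.Opens) [Nonempty U] (s), s ∈ L.sections U → s ∈ M.sections U := by
    intro L M h U _ s hs
    refine M.glue U s fun x hx => ?_
    obtain ⟨V, hxV, g, hL, hM⟩ := h x
    have : Nonempty (V ⊓ U : X.Opens) := ⟨⟨x, hxV, hx⟩⟩
    exact ⟨V ⊓ U, this, ⟨hxV, hx⟩, inf_le_right,
      (hM.2 _ inf_le_left s).2 ((hL.2 _ inf_le_left s).1 (L.res inf_le_right hs))⟩
  refine RatSubsheaf.ext (funext fun U => funext fun _ => Submodule.ext fun s => ⟨key L M h U s,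
    key M L (fun x => ?_) U s⟩)
  obtain ⟨V, hxV, g, hL, hM⟩ := h x
  exact ⟨V, hxV, g, hM, hL⟩

lemma mul_mem_tensor {L M : RatSubsheaf X} {U : X.Opens} [Nonempty U] {l m : X.functionField}
    (hl : l ∈ L.sections U) (hm : m ∈ M.sections U) : l * m ∈ (L.tensor M).sections U :=
  fun _ hx => ⟨U, inferInstance, hx, le_rfl, Submodule.subset_span ⟨l, hl, m, hm, rfl⟩⟩

lemma tensor_comm (L M : RatSubsheaf X) : L.tensor M = M.tensor L := by
  have key : ∀ L M : RatSubsheaf X, ∀ (U : X.Opens) [Nonempty U] (s),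
      s ∈ (L.tensor M).sections U → s ∈ (M.tensor L).sections U := by
    intro L M U _ s hs x hx
    obtain ⟨V, hV, hxV, hVU, h⟩ := hs x hx
    refine ⟨V, hV, hxV, hVU, Submodule.span_mono ?_ h⟩
    rintro _ ⟨l, hl, m, hm, rfl⟩
    exact ⟨m, hm, l, hl, mul_comm _ _⟩
  exact RatSubsheaf.ext (funext fun U => funext fun _ => Submodule.ext fun s =>
    ⟨key L M U s, key M L U s⟩)

/-- If `L ⊗ M = k 𝒪`, then a generator `g` of `L` gives the generator `k / g` of `M`. -/
lemma IsGen.of_tensor_eq_principal {L M : RatSubsheaf X} {k : X.functionField} (hk : k ≠ 0)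
    (hLM : L.tensor M = principal k) (hM : M.IsInvertible) {U : X.Opens} {g : X.functionField}
    (h : L.IsGen U g) : M.IsGen U (k * g⁻¹) := by
  refine ⟨mul_ne_zero hk (inv_ne_zero h.1), fun V _ hV s => ?_⟩
  rw [mul_inv, inv_inv, mul_comm k⁻¹, ← mul_assoc]
  constructor
  · intro hs
    have := mul_mem_tensor (h.self_mem hV) hs
    rw [hLM, (isGen_principal hk V).2 V le_rfl, mul_comm g] at this
    exact this
  · intro hs
    refine M.glue V s fun x hx => ?_
    obtain ⟨W, hxW, g', hg'⟩ := isInvertible_iff.1 hM x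
    have : Nonempty (W ⊓ V : X.Opens) := ⟨⟨x, hxW, hx⟩⟩
    refine ⟨W ⊓ V, this, ⟨hxW, hx⟩, inf_le_right, (hg'.2 _ inf_le_left s).2 ?_⟩
    -- As k is a section of L ⊗ M, which g g' generates here, k/(g g') is regular; its product with
    -- s g/k is s/g'.
    have hk' := (isGen_principal hk (W ⊓ V)).self_mem le_rfl
    rw [← hLM, ((h.res (inf_le_right.trans hV)).tensor (hg'.res inf_le_left)).2 _ le_rfl] at hk'
    have := mul_mem (regularOn_res inf_le_right hs) hk'
    have h1 := h.1
    have h2 := hg'.1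
    rwa [show s * g * k⁻¹ * (k * (g * g')⁻¹) = s * g'⁻¹ by field_simp] at this

end RatSubsheaf

end Generators

/-! ### Generators and the real structure -/

section Conj

variable {C : RealVariety}

lemma regularOn_conj_iff {V : C.X.Opens} [Nonempty V] {s : C.X.functionField} :
    C.ratConj s ∈ regularOn (C.conj ⁻¹ᵁ V) ↔ s ∈ regularOn V := by
  have key : ∀ (V : C.X.Opens) [Nonempty V] (s : C.X.functionField), s ∈ regularOn V →
      C.ratConj s ∈ regularOn (C.conj ⁻¹ᵁ V) := by
    rintro V _ _ ⟨a, rfl⟩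
    exact ⟨C.conj.app V a, (C.ratConj_germ V a).symm⟩
  refine ⟨fun h => ?_, key V s⟩
  have h' := key _ _ h
  rw [C.ratConj_ratConj] at h'
  refine regularOn_res (fun x hx => ?_) h'
  change C.conj (C.conj x) ∈ V
  rwa [← Scheme.Hom.comp_apply, C.conj_conj]

lemma RatSubsheaf.IsGen.pullbackConj {L : RatSubsheaf C.X} {U : C.X.Opens} {g : C.X.functionField}
    (h : L.IsGen U g) : (C.pullbackConj L).IsGen (C.conj ⁻¹ᵁ U) (C.ratConj g) := by
  refine ⟨fun h0 => h.1 ?_, fun V _ hV s => ?_⟩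
  · rw [← C.ratConj_ratConj g, h0, map_zero]
  · have hV' : C.conj ⁻¹ᵁ V ≤ U := fun x hx => by
      have := hV hx
      change C.conj (C.conj x) ∈ U at this
      rwa [← Scheme.Hom.comp_apply, C.conj_conj] at this
    have : s ∈ (C.pullbackConj L).sections V ↔ C.ratConj s ∈ L.sections (C.conj ⁻¹ᵁ V) := by
      refine ⟨?_, fun hs => ⟨_, hs, C.ratConj_ratConj s⟩⟩
      rintro ⟨r, hr, rfl⟩
      rwa [C.ratConj_ratConj]
    rw [this, h.2 _ hV', ← regularOn_conj_iff (s := s * (C.ratConj g)⁻¹), map_mul, map_inv₀,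
      C.ratConj_ratConj]

lemma ratConj_ne_zero {s : C.X.functionField} (hs : s ≠ 0) : C.ratConj s ≠ 0 :=
  (map_ne_zero_iff _ C.ratConj.injective).2 hs

/-- On τ⁻¹(U) the function τ^*g generates τ^*L, so the equality L ⊗ τ^*L = h⁻¹𝒪 forces h⁻¹/τ^*g to
generate L. This is how a pair makes τ act on the generators of L. -/
lemma IsCirclePair.isGen_conj {L : RatSubsheaf C.X} {h : C.X.functionField}
    (hL : IsCirclePair C L h) {U : C.X.Opens} {g : C.X.functionField} (hg : L.IsGen U g) :
    L.IsGen (C.conj ⁻¹ᵁ U) (h * C.ratConj g)⁻¹ := by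
  have := RatSubsheaf.IsGen.of_tensor_eq_principal (inv_ne_zero hL.ne_zero)
    ((RatSubsheaf.tensor_comm _ _).trans hL.tensor_eq) hL.invertible hg.pullbackConj
  rwa [← mul_inv] at this

end Conj

/-! ### Points of the multiplicative group -/

/-- Inverses in a commutative ring are unique, so the value at T determines the values at all its
integer powers. -/
lemma laurent_ringHom_ext {R S : Type*} [CommRing R] [CommRing S] {f g : R[T;T⁻¹] →+* S}
    (hC : ∀ a, f (LaurentPolynomial.C a) = g (LaurentPolynomial.C a))
    (hT : f (LaurentPolynomial.T 1) = g (LaurentPolynomial.T 1)) : f = g := by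
  have hu : ∀ n : ℕ, f (LaurentPolynomial.T n) = g (LaurentPolynomial.T n) := fun n => by
    have := congrArg (· ^ n) hT
    simpa [← map_pow, LaurentPolynomial.T_pow] using this
  have h1 : ∀ (k : R[T;T⁻¹] →+* S) (n : ℤ),
      k (LaurentPolynomial.T n) * k (LaurentPolynomial.T (-n)) = 1 := fun k n => by
    rw [← map_mul, ← LaurentPolynomial.T_add, add_neg_cancel, LaurentPolynomial.T_zero, map_one]
  have hneg : ∀ n : ℕ, f (LaurentPolynomial.T (-n)) = g (LaurentPolynomial.T (-n)) := fun n => by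
    have h2 := h1 f n
    rw [hu n] at h2
    calc f (LaurentPolynomial.T (-n))
        = g (LaurentPolynomial.T n) * g (LaurentPolynomial.T (-n)) *
            f (LaurentPolynomial.T (-n)) := by rw [h1, one_mul]
      _ = g (LaurentPolynomial.T n) * f (LaurentPolynomial.T (-n)) *
            g (LaurentPolynomial.T (-n)) := by ring
      _ = g (LaurentPolynomial.T (-n)) := by rw [h2, one_mul]
  have hz : ∀ n : ℤ, f (LaurentPolynomial.T n) = g (LaurentPolynomial.T n) := fun n => by
    obtain ⟨m, rfl | rfl⟩ := n.eq_nat_or_neg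
    · exact hu m
    · exact hneg m
  refine RingHom.ext fun p => ?_
  induction p using LaurentPolynomial.induction_on' with
  | add p q hp hq => rw [map_add, map_add, hp, hq]
  | C_mul_T n a => rw [map_mul, map_mul, hC, hz]

/-! ### Pull-back and restriction of sections -/

section Sections

variable {X Y Z : Scheme.{0}}

/-- Writing pull-backs and restrictions uniformly as `appLE` lets equal composites be exchanged
through `appLE_congr_hom`, without transport along equalities of open subsets. -/
lemma appLE_appLE (f : X ⟶ Y) (g : Y ⟶ Z) {U : Z.Opens} {V : Y.Opens} {W : X.Opens}
    (e₁ : V ≤ g ⁻¹ᵁ U) (e₂ : W ≤ f ⁻¹ᵁ V) (c : Γ(Z, U)) :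
    f.appLE V W e₂ (g.appLE U V e₁ c) =
      (f ≫ g).appLE U W (e₂.trans ((TopologicalSpace.Opens.map f.base).map (homOfLE e₁)).le) c := by
  rw [← CommRingCat.comp_apply, Scheme.Hom.appLE_comp_appLE]

lemma appLE_congr_hom {f g : X ⟶ Y} (h : f = g) {U : Y.Opens} {V : X.Opens} (e : V ≤ f ⁻¹ᵁ U)
    (e' : V ≤ g ⁻¹ᵁ U) (c : Γ(Y, U)) : f.appLE U V e c = g.appLE U V e' c := by
  subst h; rfl

lemma map_appLE_apply (f : X ⟶ Y) {U U' : Y.Opens} {V : X.Opens} (hU : U ≤ U') (e : V ≤ f ⁻¹ᵁ U)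
    (c : Γ(Y, U')) : f.appLE U V e (Y.presheaf.map (homOfLE hU).op c) =
      f.appLE U' V (e.trans (f.preimage_mono hU)) c := by
  rw [← CommRingCat.comp_apply, Scheme.Hom.map_appLE]

lemma appLE_map_apply (f : X ⟶ Y) {U : Y.Opens} {V V' : X.Opens} (hV : V' ≤ V) (e : V ≤ f ⁻¹ᵁ U)
    (c : Γ(Y, U)) : X.presheaf.map (homOfLE hV).op (f.appLE U V e c) =
      f.appLE U V' (hV.trans e) c := by
  rw [← CommRingCat.comp_apply, Scheme.Hom.appLE_map]

lemma app_eq_appLE_apply (f : X ⟶ Y) {U : Y.Opens} (c : Γ(Y, U)) :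
    f.app U c = f.appLE U (f ⁻¹ᵁ U) le_rfl c := by
  rw [Scheme.Hom.app_eq_appLE]

lemma map_eq_appLE {U V : X.Opens} (h : V ≤ U) (c : Γ(X, U)) :
    X.presheaf.map (homOfLE h).op c = (𝟙 X : X ⟶ X).appLE U V h c := by
  have h1 : (𝟙 X : X ⟶ X).appLE U ((𝟙 X : X ⟶ X) ⁻¹ᵁ U) (le_refl _) = 𝟙 _ := by
    rw [Scheme.Hom.appLE_eq_app, Scheme.Hom.id_app]
  have h2 := appLE_map_apply (𝟙 X) (V := (𝟙 X : X ⟶ X) ⁻¹ᵁ U) (V' := V) (U := U) h (le_refl _) c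
  rw [← h2, h1]
  rfl

lemma le_preimage_top (f : X ⟶ Y) (V : X.Opens) : V ≤ f ⁻¹ᵁ (⊤ : Y.Opens) := le_top

lemma appLE_top (f : X ⟶ Y) (e : ⊤ ≤ f ⁻¹ᵁ ⊤) : f.appLE ⊤ ⊤ e = f.appTop :=
  f.appLE_eq_app (U := ⊤)

end Sections

/-- The coordinate of the multiplicative group. -/
def Gm.T : Γ(Gm, ⊤) := (Scheme.ΓSpecIso (.of ℂ[T;T⁻¹])).inv (LaurentPolynomial.T 1)

/-- The pull-back of the coordinate of `Gm` by a morphism, restricted to an open subset. -/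
def Gm.coord {Y : Scheme.{0}} (F : Y ⟶ Gm) (V : Y.Opens) : Γ(Y, V) := F.appLE ⊤ V (le_preimage_top F V) Gm.T

variable {Y Z : Scheme.{0}}

lemma Gm.appLE_coord (m : Z ⟶ Y) (F : Y ⟶ Gm) {V : Y.Opens} {W : Z.Opens} (e : W ≤ m ⁻¹ᵁ V) :
    m.appLE V W e (Gm.coord F V) = Gm.coord (m ≫ F) W :=
  appLE_appLE m F _ _ _

lemma Gm.map_coord (F : Y ⟶ Gm) {V W : Y.Opens} (e : W ≤ V) :
    Y.presheaf.map (homOfLE e).op (Gm.coord F V) = Gm.coord F W :=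
  appLE_map_apply F _ _ _

lemma Gm.appLE_T (F : Y ⟶ Gm) (V : Y.Opens) (m : ℤ) (u : Γ(Y, V)ˣ) (hu : Gm.coord F V = u) :
    F.appLE ⊤ V (le_preimage_top F V) ((Scheme.ΓSpecIso (.of ℂ[T;T⁻¹])).inv (LaurentPolynomial.T m : ℂ[T;T⁻¹])) =
      (u ^ m : Γ(Y, V)ˣ) := by
  set φ : ℂ[T;T⁻¹] →+* Γ(Y, V) :=
    ((Scheme.ΓSpecIso (.of ℂ[T;T⁻¹])).inv ≫ F.appLE ⊤ V (le_preimage_top F V)).hom with hφ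
  have : φ = LaurentPolynomial.eval₂ (φ.comp LaurentPolynomial.C) u := by
    apply laurent_ringHom_ext
    · intro a; simp
    · rw [LaurentPolynomial.eval₂_T, zpow_one, ← hu]; rfl
  change φ _ = _
  rw [this, LaurentPolynomial.eval₂_T]

lemma Gm.isUnit_coord (F : Y ⟶ Gm) (V : Y.Opens) : IsUnit (Gm.coord F V) :=
  ((LaurentPolynomial.isUnit_T 1).map
    ((Scheme.ΓSpecIso (.of ℂ[T;T⁻¹])).inv ≫ F.appLE ⊤ V (le_preimage_top F V)).hom)

/-- As `Gm` is affine, only the comorphism matters; the structure morphism fixes it on scalars and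
the coordinate fixes it on T. -/
lemma Gm.hom_ext {F G : Y ⟶ Gm} (h : F ≫ Gm.str = G ≫ Gm.str)
    (hT : Gm.coord F ⊤ = Gm.coord G ⊤) : F = G := by
  apply ext_to_Spec
  apply CommRingCat.hom_ext
  apply laurent_ringHom_ext
  · intro a
    have key : ∀ F : Y ⟶ Gm, ((Scheme.ΓSpecIso (.of ℂ[T;T⁻¹])).inv ≫ Scheme.Γ.map F.op).hom
        (LaurentPolynomial.C a) =
        ((Scheme.ΓSpecIso (.of ℂ)).inv ≫ (F ≫ Gm.str).appTop).hom a := by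
      intro F
      rw [Scheme.Hom.comp_appTop, ← Category.assoc]
      unfold Gm.str
      rw [← Scheme.ΓSpecIso_inv_naturality]
      rfl
    rw [key, key, h]
  · rw [Gm.coord, Gm.coord, appLE_top, appLE_top] at hT
    exact hT

/-- The morphism to `Gm` defined by a unit. -/
def toGm (q : Y ⟶ Spec (.of ℂ)) (u : Γ(Y, ⊤)ˣ) : Y ⟶ Gm :=
  Y.toSpecΓ ≫ Spec.map (CommRingCat.ofHom
    (LaurentPolynomial.eval₂ ((Scheme.ΓSpecIso (.of ℂ)).inv ≫ q.appTop).hom u))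

lemma toGm_str (q : Y ⟶ Spec (.of ℂ)) (u : Γ(Y, ⊤)ˣ) : toGm q u ≫ Gm.str = q := by
  unfold toGm Gm.str
  rw [Category.assoc, ← Spec.map_comp, ← CommRingCat.ofHom_comp]
  have : (LaurentPolynomial.eval₂ ((Scheme.ΓSpecIso (.of ℂ)).inv ≫ q.appTop).hom u).comp
      (algebraMap ℂ ℂ[T;T⁻¹]) = ((Scheme.ΓSpecIso (.of ℂ)).inv ≫ q.appTop).hom := by
    ext a
    exact LaurentPolynomial.eval₂_C _ _ a
  rw [this, CommRingCat.ofHom_hom, Spec.map_comp, ← Scheme.toSpecΓ_naturality_assoc]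
  simp

lemma coord_toGm (q : Y ⟶ Spec (.of ℂ)) (u : Γ(Y, ⊤)ˣ) : Gm.coord (toGm q u) ⊤ = u := by
  have h : (toGm q u).appTop = (Scheme.ΓSpecIso (.of ℂ[T;T⁻¹])).hom ≫ CommRingCat.ofHom
      (LaurentPolynomial.eval₂ ((Scheme.ΓSpecIso (.of ℂ)).inv ≫ q.appTop).hom u) := by
    unfold toGm
    rw [Scheme.Hom.comp_appTop, Scheme.toSpecΓ_appTop, Scheme.ΓSpecIso_naturality]
  have h2 : Gm.coord (toGm q u) ⊤ = (toGm q u).appTop Gm.T := by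
    rw [Gm.coord, appLE_top]
  rw [h2, h, Gm.T, CommRingCat.comp_apply]
  rw [← CommRingCat.comp_apply (Scheme.ΓSpecIso (.of ℂ[T;T⁻¹])).inv, Iso.inv_hom_id]
  simp

lemma Gm.coord_specMap {R : Type} [CommRing R] (φ : ℂ[T;T⁻¹] →+* R) :
    Gm.coord (Spec.map (CommRingCat.ofHom φ)) ⊤ =
      (Scheme.ΓSpecIso (.of R)).inv (φ (LaurentPolynomial.T 1)) := by
  rw [Gm.coord, appLE_top, Gm.T, ← CommRingCat.comp_apply, ← Scheme.ΓSpecIso_inv_naturality]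
  rfl

lemma Gm.coord_mul : Gm.coord Gm.mul ⊤ =
    Gm.coord (pullback.fst Gm.str Gm.str) ⊤ * Gm.coord (pullback.snd Gm.str Gm.str) ⊤ := by
  -- The morphism θ identifies the product with the spectrum of the tensor product; the claim is
  -- then that T is group-like.
  obtain ⟨θ, h1, h2, h3⟩ : ∃ θ : pullback Gm.str Gm.str ⟶ Spec (.of (ℂ[T;T⁻¹] ⊗[ℂ] ℂ[T;T⁻¹])),
      θ ≫ Spec.map (CommRingCat.ofHom Algebra.TensorProduct.includeLeftRingHom) =
        pullback.fst Gm.str Gm.str ∧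
      θ ≫ Spec.map (CommRingCat.ofHom (RingHomClass.toRingHom
        (Algebra.TensorProduct.includeRight (R := ℂ) (A := ℂ[T;T⁻¹])))) =
          pullback.snd Gm.str Gm.str ∧
      Gm.mul = θ ≫ Spec.map (CommRingCat.ofHom
        (Bialgebra.comulAlgHom ℂ ℂ[T;T⁻¹] : ℂ[T;T⁻¹] →+* ℂ[T;T⁻¹] ⊗[ℂ] ℂ[T;T⁻¹])) :=
    ⟨_, pullbackSpecIso_hom_fst ℂ ℂ[T;T⁻¹] ℂ[T;T⁻¹], pullbackSpecIso_hom_snd ℂ ℂ[T;T⁻¹] ℂ[T;T⁻¹],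
      rfl⟩
  have key : ∀ φ : ℂ[T;T⁻¹] →+* ℂ[T;T⁻¹] ⊗[ℂ] ℂ[T;T⁻¹],
      Gm.coord (θ ≫ Spec.map (CommRingCat.ofHom φ)) ⊤ =
      θ.appLE ⊤ ⊤ (le_preimage_top _ _)
        ((Scheme.ΓSpecIso (.of (ℂ[T;T⁻¹] ⊗[ℂ] ℂ[T;T⁻¹]))).inv (φ (LaurentPolynomial.T 1))) := by
    intro φ
    rw [← Gm.coord_specMap, Gm.appLE_coord]
  rw [← h1, ← h2, h3, key, key, key, ← map_mul, ← map_mul]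
  congr 2
  change Coalgebra.comul (LaurentPolynomial.T 1 : ℂ[T;T⁻¹]) =
    (LaurentPolynomial.T 1 ⊗ₜ[ℂ] 1) * (1 ⊗ₜ[ℂ] LaurentPolynomial.T 1 : ℂ[T;T⁻¹] ⊗[ℂ] ℂ[T;T⁻¹])
  simp

lemma Gm.coord_lift_mul (F G : Y ⟶ Gm) (h : F ≫ Gm.str = G ≫ Gm.str) (V : Y.Opens) :
    Gm.coord (pullback.lift F G h ≫ Gm.mul) V = Gm.coord F V * Gm.coord G V := by
  rw [← Gm.appLE_coord (V := ⊤) _ _ (le_preimage_top _ _), Gm.coord_mul, map_mul, Gm.appLE_coord, Gm.appLE_coord,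
    pullback.lift_fst, pullback.lift_snd]

lemma Gm.coord_circleConj (F : Y ⟶ Gm) (V : Y.Opens) (u : Γ(Y, V)ˣ) (hu : Gm.coord F V = u) :
    Gm.coord (F ≫ Gm.circleConj) V = (u⁻¹ : Γ(Y, V)ˣ) := by
  rw [← Gm.appLE_coord (V := ⊤) _ _ (le_preimage_top _ _), Gm.circleConj, Gm.coord_specMap]
  have := circleConjComorphism_C_mul_T 1 1
  simp only [map_one, one_mul] at this
  rw [this, Gm.appLE_T F V (-1) u hu, zpow_neg_one]

lemma Gm.coord_one (q : Y ⟶ Spec (.of ℂ)) (V : Y.Opens) : Gm.coord (q ≫ Gm.one) V = 1 := by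
  rw [← Gm.appLE_coord (V := ⊤) _ _ (le_preimage_top _ _), Gm.one, Gm.coord_specMap]
  simp

/-! ### Frames -/

/-- The morphism `W ⟶ Gm` defined by a unit on the open subset `W`. -/
def toGmOn {Y : Scheme.{0}} (p : Y ⟶ Spec (.of ℂ)) (W : Y.Opens) (c : Γ(Y, W)) (hc : IsUnit c) :
    W.toScheme ⟶ Gm :=
  toGm (W.ι ≫ p) (hc.map (W.ι.appLE W ⊤ W.ι_preimage_self.ge).hom).unit

lemma toGmOn_str {Y : Scheme.{0}} (p : Y ⟶ Spec (.of ℂ)) (W : Y.Opens) (c : Γ(Y, W))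
    (hc : IsUnit c) : toGmOn p W c hc ≫ Gm.str = W.ι ≫ p := toGm_str _ _

lemma coord_toGmOn {Y : Scheme.{0}} (p : Y ⟶ Spec (.of ℂ)) (W : Y.Opens) (c : Γ(Y, W))
    (hc : IsUnit c) (V : W.toScheme.Opens) (hV : V ≤ W.ι ⁻¹ᵁ W) :
    Gm.coord (toGmOn p W c hc) V = W.ι.appLE W V hV c := by
  have h : (⊤ : W.toScheme.Opens) ≤ W.ι ⁻¹ᵁ W := W.ι_preimage_self.ge
  rw [← Gm.map_coord (V := ⊤) _ le_top, toGmOn, coord_toGm, IsUnit.unit_spec]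
  exact appLE_map_apply W.ι (V := ⊤) (V' := V) le_top h c

/-- A point of Gm × Y is a point of Y with a unit: the scalars on the factor Gm are already fixed by
the point of Y. -/
lemma pullback_Gm_hom_ext {Y Z : Scheme.{0}} {p : Y ⟶ Spec (.of ℂ)} {m m' : Z ⟶ pullback Gm.str p}
    (h : m ≫ pullback.snd _ _ = m' ≫ pullback.snd _ _)
    (hT : Gm.coord (m ≫ pullback.fst _ _) ⊤ = Gm.coord (m' ≫ pullback.fst _ _) ⊤) : m = m' := by
  refine pullback.hom_ext (Gm.hom_ext ?_ hT) h
  rw [Category.assoc, Category.assoc, pullback.condition, reassoc_of% h]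

lemma opens_ι_appLE_injective {Y : Scheme.{0}} (W : Y.Opens) {V : W.toScheme.Opens}
    (hV : V ≤ W.ι ⁻¹ᵁ W) (hV' : V = ⊤) : Function.Injective (W.ι.appLE W V hV) := by
  subst hV'
  exact ((ConcreteCategory.isIso_iff_bijective _).1
    (inferInstanceAs (IsIso (W.ι.appLE W ⊤ W.ι_preimage_self.ge)))).1

lemma exists_glue_opens {Y P : Scheme.{0}} {I : Type} (W : I → Y.Opens)
    (hW : TopologicalSpace.IsOpenCover W) (m : ∀ i, (W i).toScheme ⟶ P)
    (h : ∀ i j, pullback.fst (W i).ι (W j).ι ≫ m i = pullback.snd (W i).ι (W j).ι ≫ m j) :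
    ∃ n : Y ⟶ P, ∀ i, (W i).ι ≫ n = m i :=
  ⟨Scheme.Cover.glueMorphisms (Y.openCoverOfIsOpenCover W hW) m h, fun i =>
    Scheme.Cover.ι_glueMorphisms (Y.openCoverOfIsOpenCover W hW) m h i⟩

lemma Frame.preimage_le_of_comp {X Y P : Scheme.{0}} {π : Y ⟶ X} {ρ : P ⟶ X} {m : Y ⟶ P}
    (hm : m ≫ ρ = π) (U : X.Opens) : π ⁻¹ᵁ U ≤ m ⁻¹ᵁ (ρ ⁻¹ᵁ U) := by
  rw [← Scheme.Hom.comp_preimage, hm]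

section Frames

variable {X : Scheme.{0}} [IsIntegral X]

/-- A nonempty open subset together with a generator of `L` on it. -/
structure LocalGen (L : RatSubsheaf X) where
  /-- the open subset -/
  U : X.Opens
  nonempty : Nonempty U
  /-- the generator -/
  g : X.functionField
  gen : L.IsGen U g

attribute [instance] LocalGen.nonempty

variable {L : RatSubsheaf X}

/-- Only the open subsets are compared. Two generators on the same open subset are thus comparable
in both directions, and one compatibility condition for frames covers both restriction and change of
generator. -/
instance : Preorder (LocalGen L) := Preorder.lift LocalGen.U

lemma LocalGen.le_U {i j : LocalGen L} (h : i ≤ j) : i.U ≤ j.U := h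

lemma LocalGen.exists_ratio {i j : LocalGen L} (h : i ≤ j) :
    ∃ a : Γ(X, i.U), IsUnit a ∧ X.germToFunctionField i.U a = j.g * i.g⁻¹ := by
  obtain ⟨a, ha⟩ := j.gen.div_mem i.gen (le_U h)
  obtain ⟨b, hb⟩ := i.gen.div_mem (j.gen.res (le_U h)) le_rfl
  refine ⟨a, IsUnit.of_mul_eq_one b (X.germToFunctionField_injective i.U ?_), ha⟩
  have hi := i.gen.1
  have hj := j.gen.1
  rw [map_mul, map_one]
  erw [ha, hb]
  field_simp

/-- The quotient of the generator `j.g` by the generator `i.g`, as a unit on the smaller open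
subset `i.U`. -/
def LocalGen.ratio {i j : LocalGen L} (h : i ≤ j) : Γ(X, i.U) := (exists_ratio h).choose

lemma LocalGen.isUnit_ratio {i j : LocalGen L} (h : i ≤ j) : IsUnit (ratio h) :=
  (exists_ratio h).choose_spec.1

lemma LocalGen.germ_ratio {i j : LocalGen L} (h : i ≤ j) :
    X.germToFunctionField i.U (ratio h) = j.g * i.g⁻¹ :=
  (exists_ratio h).choose_spec.2

/-- The restriction of a local generator to a nonempty open subset. -/
def LocalGen.restrict (i : LocalGen L) (V : X.Opens) [hV : Nonempty V] (h : V ≤ i.U) :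
    LocalGen L := ⟨V, hV, i.g, i.gen.res h⟩

lemma LocalGen.restrict_le (i : LocalGen L) (V : X.Opens) [Nonempty V] (h : V ≤ i.U) :
    i.restrict V h ≤ i := h

/-- A trivialization of the pull-back of the dual of `L`: a unit `c i` for each local generator
`i` of `L`, depending linearly on the generator. -/
@[ext]
structure Frame (L : RatSubsheaf X) {Y : Scheme.{0}} (π : Y ⟶ X) where
  /-- the unit attached to a local generator -/
  sec (i : LocalGen L) : Γ(Y, π ⁻¹ᵁ i.U)
  isUnit (i : LocalGen L) : IsUnit (sec i)
  compat {i j : LocalGen L} (h : i ≤ j) :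
    Y.presheaf.map (homOfLE (π.preimage_mono (LocalGen.le_U h))).op (sec j) =
      π.app i.U (LocalGen.ratio h) * sec i

namespace Frame

variable {Y Z P : Scheme.{0}} {π : Y ⟶ X} {ρ : P ⟶ X}

/-- The pull-back of a frame. -/
def pull (φ : Frame L ρ) (m : Y ⟶ P) (hm : m ≫ ρ = π) : Frame L π where
  sec i := m.appLE (ρ ⁻¹ᵁ i.U) (π ⁻¹ᵁ i.U) (preimage_le_of_comp hm _) (φ.sec i)
  isUnit i := (φ.isUnit i).map _
  compat {i j} h := by
    rw [appLE_map_apply, ← map_appLE_apply m (ρ.preimage_mono (LocalGen.le_U h)) (preimage_le_of_comp hm i.U),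
      φ.compat h, map_mul, app_eq_appLE_apply, appLE_appLE, app_eq_appLE_apply]
    congr 1
    exact appLE_congr_hom hm _ _ _

lemma pull_pull (φ : Frame L ρ) (m : Y ⟶ P) (hm : m ≫ ρ = π) {κ : Z ⟶ X} (n : Z ⟶ Y)
    (hn : n ≫ π = κ) :
    (φ.pull m hm).pull n hn = φ.pull (n ≫ m) (by rw [Category.assoc, hm, hn]) := by
  apply Frame.ext
  funext i
  exact appLE_appLE _ _ _ _ _

lemma pull_congr (φ : Frame L ρ) {m m' : Y ⟶ P} (h : m = m') (hm : m ≫ ρ = π)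
    (hm' : m' ≫ ρ = π) : φ.pull m hm = φ.pull m' hm' := by
  subst h; rfl

/-- Frames that agree on local generators around the image of each point are equal. -/
lemma ext_of_cover {φ ψ : Frame L π} (h : ∀ y : Y, ∃ i : LocalGen L, π y ∈ i.U ∧
    φ.sec i = ψ.sec i) : φ = ψ := by
  apply Frame.ext
  funext j
  refine Y.IsSheaf.section_ext fun y hy => ?_
  obtain ⟨i, hi, hij⟩ := h y
  have : Nonempty (i.U ⊓ j.U : X.Opens) := ⟨⟨π y, hi, hy⟩⟩
  -- This local generator lies below both i and j. The frames agree at i, hence at k because the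
  -- ratio is a unit, hence at j near y.
  let k : LocalGen L := i.restrict (i.U ⊓ j.U) inf_le_left
  have hki : k ≤ i := inf_le_left (a := i.U) (b := j.U)
  have hkj : k ≤ j := inf_le_right (a := i.U) (b := j.U)
  refine ⟨π ⁻¹ᵁ k.U, π.preimage_mono (LocalGen.le_U hkj), ⟨hi, hy⟩, ?_⟩
  have e1 := φ.compat hki
  have e2 := ψ.compat hki
  rw [hij, e2] at e1
  have e3 : ψ.sec k = φ.sec k :=
    ((LocalGen.isUnit_ratio hki).map (π.app k.U).hom).mul_left_cancel e1
  exact (φ.compat hkj).trans ((congrArg _ e3.symm).trans (ψ.compat hkj).symm)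

section Chart

variable (q : X ⟶ Spec (.of ℂ))

/-- The morphism `ρ⁻¹(U) ⟶ Gm × U` over `U` that a frame defines for a generator on `U`. -/
def chart (φ : Frame L ρ) (i : LocalGen L) :
    (ρ ⁻¹ᵁ i.U).toScheme ⟶ pullback Gm.str (i.U.ι ≫ q) :=
  pullback.lift (toGmOn (ρ ≫ q) (ρ ⁻¹ᵁ i.U) (φ.sec i) (φ.isUnit i)) (ρ ∣_ i.U)
    (by rw [toGmOn_str, morphismRestrict_ι_assoc])

lemma chart_fst (φ : Frame L ρ) (i : LocalGen L) : φ.chart q i ≫ pullback.fst _ _ =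
    toGmOn (ρ ≫ q) (ρ ⁻¹ᵁ i.U) (φ.sec i) (φ.isUnit i) := pullback.lift_fst _ _ _

lemma chart_snd (φ : Frame L ρ) (i : LocalGen L) : φ.chart q i ≫ pullback.snd _ _ =
    ρ ∣_ i.U := pullback.lift_snd _ _ _

/-- The frame identifies `P` with `Gm × U` locally on the base. -/
def IsUniversal (φ : Frame L ρ) : Prop :=
  ∀ x : X, ∃ i : LocalGen L, x ∈ i.U ∧ IsIso (φ.chart q i)

variable {q}

/-- In a chart a morphism to P over X is a unit on a scheme over U, and this unit is the value of
the pulled-back frame at the generator on U. -/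
lemma IsUniversal.hom_ext {φ : Frame L ρ} (hφ : φ.IsUniversal q) {m m' : Y ⟶ P}
    (hm : m ≫ ρ = π) (hm' : m' ≫ ρ = π) (h : φ.pull m hm = φ.pull m' hm') : m = m' := by
  refine Scheme.hom_ext_of_forall _ _ fun y => ?_
  obtain ⟨i, hi, hiso⟩ := hφ (π y)
  refine ⟨π ⁻¹ᵁ i.U, hi, ?_⟩
  rw [← Scheme.Hom.resLE_comp_ι m (preimage_le_of_comp hm i.U),
    ← Scheme.Hom.resLE_comp_ι m' (preimage_le_of_comp hm' i.U)]
  congr 1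
  rw [← cancel_mono (φ.chart q i)]
  refine pullback_Gm_hom_ext ?_ ?_
  · rw [Category.assoc, Category.assoc, chart_snd, ← cancel_mono i.U.ι, Category.assoc,
      Category.assoc, morphismRestrict_ι, Scheme.Hom.resLE_comp_ι_assoc,
      Scheme.Hom.resLE_comp_ι_assoc, hm, hm']
  · rw [Category.assoc, Category.assoc, chart_fst]
    have h1 : (⊤ : (ρ ⁻¹ᵁ i.U).toScheme.Opens) ≤ (ρ ⁻¹ᵁ i.U).ι ⁻¹ᵁ (ρ ⁻¹ᵁ i.U) :=
      (ρ ⁻¹ᵁ i.U).ι_preimage_self.ge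
    have h2 : (⊤ : (π ⁻¹ᵁ i.U).toScheme.Opens) ≤ (π ⁻¹ᵁ i.U).ι ⁻¹ᵁ (π ⁻¹ᵁ i.U) :=
      (π ⁻¹ᵁ i.U).ι_preimage_self.ge
    have key : ∀ (m : Y ⟶ P) (hm : m ≫ ρ = π),
        Gm.coord (m.resLE (ρ ⁻¹ᵁ i.U) (π ⁻¹ᵁ i.U) (preimage_le_of_comp hm i.U) ≫
          toGmOn (ρ ≫ q) (ρ ⁻¹ᵁ i.U) (φ.sec i) (φ.isUnit i)) ⊤ =
        (π ⁻¹ᵁ i.U).ι.appLE (π ⁻¹ᵁ i.U) ⊤ h2 ((φ.pull m hm).sec i) := by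
      intro m hm
      rw [← Gm.appLE_coord (V := ⊤) _ _ (le_preimage_top _ _), coord_toGmOn _ _ _ _ _ h1,
        appLE_appLE]
      refine Eq.trans ?_ (appLE_appLE _ _ _ _ _).symm
      exact appLE_congr_hom (Scheme.Hom.resLE_comp_ι m (preimage_le_of_comp hm i.U)) _ _ _
    rw [key m hm, key m' hm', h]

/-- Frames on schemes over `X` are the pull-backs of a universal frame. -/
lemma IsUniversal.exists_pull_eq {φ : Frame L ρ} (hφ : φ.IsUniversal q) (ψ : Frame L π) :
    ∃ (m : Y ⟶ P) (hm : m ≫ ρ = π), φ.pull m hm = ψ := by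
  choose i hi hiso using hφ
  let W : X → Y.Opens := fun x => π ⁻¹ᵁ (i x).U
  have hW : ∀ x, (⊤ : (W x).toScheme.Opens) ≤ (W x).ι ⁻¹ᵁ (W x) := fun x =>
    (W x).ι_preimage_self.ge
  -- The local solution: the unit of ψ gives a point of Gm × U, which the inverse chart of φ turns
  -- into a point of P.
  let m : ∀ x, (W x).toScheme ⟶ P := fun x =>
    ψ.chart q (i x) ≫ inv (φ.chart q (i x)) ≫ (ρ ⁻¹ᵁ (i x).U).ι
  have hm : ∀ x, m x ≫ ρ = (W x).ι ≫ π := fun x => by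
    have h1 : (ρ ⁻¹ᵁ (i x).U).ι ≫ ρ = φ.chart q (i x) ≫ pullback.snd _ _ ≫ (i x).U.ι := by
      rw [← Category.assoc, chart_snd, morphismRestrict_ι]
    simp only [m, Category.assoc]
    rw [h1, IsIso.inv_hom_id_assoc, ← Category.assoc, chart_snd, morphismRestrict_ι]
  have hpull : ∀ x, φ.pull (m x) (hm x) = ψ.pull (W x).ι rfl := fun x => by
    refine ext_of_cover fun y => ⟨i x, y.2, ?_⟩
    have hV : ((W x).ι ≫ π) ⁻¹ᵁ (i x).U ≤ (W x).ι ⁻¹ᵁ (W x) := le_of_eq rfl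
    have h1 : (⊤ : (ρ ⁻¹ᵁ (i x).U).toScheme.Opens) ≤ (ρ ⁻¹ᵁ (i x).U).ι ⁻¹ᵁ (ρ ⁻¹ᵁ (i x).U) :=
      (ρ ⁻¹ᵁ (i x).U).ι_preimage_self.ge
    refine Eq.trans ?_ (coord_toGmOn (π ≫ q) (W x) (ψ.sec (i x)) (ψ.isUnit (i x)) _ hV)
    rw [← chart_fst]
    have h2 : ψ.chart q (i x) ≫ pullback.fst _ _ =
        (ψ.chart q (i x) ≫ inv (φ.chart q (i x))) ≫ φ.chart q (i x) ≫ pullback.fst _ _ := by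
      simp
    rw [h2, chart_fst, ← Gm.appLE_coord (V := ⊤) _ _ (le_preimage_top _ _),
      coord_toGmOn _ _ _ _ _ h1, appLE_appLE]
    exact appLE_congr_hom (Category.assoc _ _ _).symm _ _ _
  have hcov : TopologicalSpace.IsOpenCover W := by
    rw [TopologicalSpace.IsOpenCover, eq_top_iff]
    exact fun y _ => TopologicalSpace.Opens.mem_iSup.2 ⟨π y, hi (π y)⟩
  -- On overlaps both local solutions pull φ back to the restriction of ψ, so uniqueness makes them
  -- agree.
  have hglue : ∀ x y, pullback.fst (W x).ι (W y).ι ≫ m x = pullback.snd (W x).ι (W y).ι ≫ m y := by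
    intro x y
    have hφ : φ.IsUniversal q := fun x => ⟨i x, hi x, hiso x⟩
    have h2 : pullback.snd (W x).ι (W y).ι ≫ (W y).ι ≫ π =
        pullback.fst (W x).ι (W y).ι ≫ (W x).ι ≫ π := (pullback.condition_assoc π).symm
    refine hφ.hom_ext (π := pullback.fst (W x).ι (W y).ι ≫ (W x).ι ≫ π)
      (by rw [Category.assoc, hm]) (by rw [Category.assoc, hm, h2]) ?_
    rw [← pull_pull _ _ (hm x) _ rfl, hpull, pull_pull, ← pull_pull _ _ (hm y) _ h2,
      hpull, pull_pull]
    exact pull_congr _ pullback.condition _ _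
  obtain ⟨n, hn⟩ := exists_glue_opens W hcov m hglue
  have hnρ : n ≫ ρ = π := by
    refine Scheme.hom_ext_of_forall _ _ fun y => ⟨W (π y), hi _, ?_⟩
    rw [← Category.assoc, hn, hm]
  refine ⟨n, hnρ, ext_of_cover fun y => ⟨i (π y), hi _, ?_⟩⟩
  have h3 : (φ.pull n hnρ).pull (W (π y)).ι rfl = ψ.pull (W (π y)).ι rfl := by
    rw [← hpull, pull_pull]
    exact pull_congr _ (hn _) _ _
  exact opens_ι_appLE_injective (W (π y)) (V := ((W (π y)).ι ≫ π) ⁻¹ᵁ (i (π y)).U)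
    (le_of_eq rfl) (W (π y)).ι_preimage_self (congrArg (fun ψ => ψ.sec (i (π y))) h3)

end Chart

end Frame

end Frames

/-! ### The universal frame -/

section UniversalFrame

variable {X : Scheme.{0}} [IsIntegral X] {L : RatSubsheaf X}

namespace LocalGen

lemma ratio_self (i : LocalGen L) : ratio (le_refl i) = 1 := by
  apply X.germToFunctionField_injective i.U
  rw [map_one]
  exact (germ_ratio (le_refl i)).trans (mul_inv_cancel₀ i.gen.1)

/-- The cocycle identity g_k/g_i = (g_j/g_i)(g_k/g_j), which makes the transition morphisms
functorial. -/
lemma ratio_trans {i j k : LocalGen L} (hij : i ≤ j) (hjk : j ≤ k) :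
    ratio (hij.trans hjk) = ratio hij * X.presheaf.map (homOfLE (le_U hij)).op (ratio hjk) := by
  apply X.germToFunctionField_injective i.U
  rw [map_mul]
  have h1 := germToFunctionField_res (le_U hij) (ratio hjk)
  have hj := j.gen.1
  refine (germ_ratio _).trans (Eq.trans ?_ (congrArg₂ (· * ·) (germ_ratio hij)
    (h1.trans (germ_ratio hjk))).symm)
  field_simp

omit [IsIntegral X] in
lemma exists_lift_homOfLE_eq {U V : X.Opens} (x : (pullback U.ι V.ι : Scheme.{0})) :
    ∃ y : (U ⊓ V : X.Opens).toScheme, pullback.lift (X.homOfLE (inf_le_left (a := U) (b := V)))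
      (X.homOfLE (inf_le_right (a := U) (b := V)))
      (by rw [Scheme.homOfLE_ι, Scheme.homOfLE_ι]) y = x := by
  let a := (pullback.fst U.ι V.ι ≫ U.ι) x
  have haU : a ∈ U := (pullback.fst U.ι V.ι x).2
  have haV : a ∈ V := by
    unfold a; rw [pullback.condition]; exact (pullback.snd U.ι V.ι x).2
  have haUV : a ∈ U ⊓ V := ⟨haU, haV⟩
  let y : (U ⊓ V : X.Opens).toScheme := ⟨a, haUV⟩
  have hy : (U ⊓ V).ι y = a := rfl
  refine ⟨y, (pullback.fst U.ι V.ι ≫ U.ι).isOpenEmbedding.injective ?_⟩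
  rw [← Scheme.Hom.comp_apply, pullback.lift_fst_assoc, Scheme.homOfLE_ι, hy]

/-- The cover by the open subsets on which `L` has a generator. -/
abbrev cover (hL : L.IsInvertible) : X.OpenCover where
  I₀ := LocalGen L
  X i := i.U
  f i := i.U.ι
  mem₀ := by
    rw [Scheme.presieve₀_mem_precoverage_iff]
    refine ⟨fun x ↦ ?_, inferInstance⟩
    obtain ⟨U, hxU, g, hg⟩ := RatSubsheaf.isInvertible_iff.1 hL x
    exact ⟨⟨U, ⟨⟨x, hxU⟩⟩, g, hg⟩, ⟨x, hxU⟩, rfl⟩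

/-- An intersection, with the generator of the first open subset, lies below both members because
the order ignores generators. Gluing is therefore governed by a functor on a preorder, with no
separate cocycle condition. -/
instance (hL : L.IsInvertible) : (cover hL).LocallyDirected where
  trans {i j} f := X.homOfLE (le_U f.le)
  trans_id i := X.homOfLE_rfl i.U
  trans_comp {i j k} f g := (X.homOfLE_homOfLE _ _).symm
  w {i j} f := X.homOfLE_ι _
  directed {i j} x := by
    obtain ⟨y, hy⟩ := exists_lift_homOfLE_eq (U := i.U) (V := j.U) x
    have : Nonempty (i.U ⊓ j.U : X.Opens) := ⟨y⟩
    exact ⟨i.restrict (i.U ⊓ j.U) inf_le_left, homOfLE (inf_le_left (a := i.U) (b := j.U)),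
      homOfLE (inf_le_right (a := i.U) (b := j.U)), y, hy⟩

end LocalGen

lemma exists_gluing_of_relativeGluingData {S : Scheme.{0}} (𝒰 : S.OpenCover) [Category 𝒰.I₀]
    [𝒰.LocallyDirected] [Small.{0} 𝒰.I₀] [Quiver.IsThin 𝒰.I₀] (d : 𝒰.RelativeGluingData) :
    ∃ (P : Scheme.{0}) (ρ : P ⟶ S) (κ : ∀ i, d.functor.obj i ⟶ P),
      (∀ {i j} (f : i ⟶ j), d.functor.map f ≫ κ j = κ i) ∧
      ∀ i, IsPullback (d.natTrans.app i) (κ i) (𝒰.f i) ρ :=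
  ⟨d.glued, d.toBase, fun i => colimit.ι d.functor i, fun f => colimit.w d.functor f,
    d.isPullback_natTrans_ι_toBase⟩

section Transition

variable (q : X ⟶ Spec (.of ℂ)) {i j k : LocalGen L}

omit [IsIntegral X] in
lemma base_le (U : X.Opens) {Z : Scheme.{0}} (t : Z ⟶ U.toScheme) :
    (⊤ : Z.Opens) ≤ (t ≫ U.ι) ⁻¹ᵁ U := fun x _ => (t x).2

/-- The ratio of two generators on a scheme over the smaller open subset. -/
def ratioOn (h : i ≤ j) {Z : Scheme.{0}} (t : Z ⟶ i.U.toScheme) : Γ(Z, ⊤) :=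
  (t ≫ i.U.ι).appLE i.U ⊤ (base_le _ _) (LocalGen.ratio h)

lemma isUnit_ratioOn (h : i ≤ j) {Z : Scheme.{0}} (t : Z ⟶ i.U.toScheme) :
    IsUnit (ratioOn h t) :=
  (LocalGen.isUnit_ratio h).map ((t ≫ i.U.ι).appLE i.U ⊤ (base_le _ _)).hom

lemma appLE_ratioOn (h : i ≤ j) {Z Z' : Scheme.{0}} (t : Z ⟶ i.U.toScheme) (m : Z' ⟶ Z) :
    m.appLE ⊤ ⊤ (le_preimage_top _ _) (ratioOn h t) = ratioOn h (m ≫ t) :=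
  (appLE_appLE _ _ _ _ _).trans (appLE_congr_hom (Category.assoc _ _ _).symm _ _ _)

/-- The change of trivializations `Gm × U ⟶ Gm × V` for two generators on `U ≤ V`. -/
def transition (h : i ≤ j) : pullback Gm.str (i.U.ι ≫ q) ⟶ pullback Gm.str (j.U.ι ≫ q) :=
  pullback.lift
    (pullback.lift (pullback.fst _ _)
      (toGm (pullback.snd Gm.str (i.U.ι ≫ q) ≫ i.U.ι ≫ q) (isUnit_ratioOn h (pullback.snd _ _)).unit)
      (by rw [toGm_str, pullback.condition]) ≫ Gm.mul)
    (pullback.snd _ _ ≫ X.homOfLE (LocalGen.le_U h))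
    (by rw [Category.assoc, Gm.mul_str, pullback.lift_fst_assoc, pullback.condition,
      Category.assoc, Scheme.homOfLE_ι_assoc])

lemma transition_snd (h : i ≤ j) : transition q h ≫ pullback.snd _ _ =
    pullback.snd _ _ ≫ X.homOfLE (LocalGen.le_U h) := pullback.lift_snd _ _ _

lemma coord_transition (h : i ≤ j) {Z : Scheme.{0}} (m : Z ⟶ pullback Gm.str (i.U.ι ≫ q)) :
    Gm.coord (m ≫ transition q h ≫ pullback.fst _ _) ⊤ =
      Gm.coord (m ≫ pullback.fst _ _) ⊤ * ratioOn h (m ≫ pullback.snd _ _) := by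
  rw [transition, pullback.lift_fst, ← Gm.appLE_coord (V := ⊤) _ _ (le_preimage_top _ _),
    Gm.coord_lift_mul, map_mul, coord_toGm, IsUnit.unit_spec, appLE_ratioOn, Gm.appLE_coord]

lemma transition_self (i : LocalGen L) : transition q (le_refl i) = 𝟙 _ := by
  refine pullback_Gm_hom_ext ?_ ?_
  · rw [transition_snd, Scheme.homOfLE_rfl, Category.comp_id, Category.id_comp]
  · have := coord_transition q (le_refl i) (𝟙 _)
    rw [Category.id_comp, Category.id_comp] at this
    rw [this, ratioOn, LocalGen.ratio_self, map_one, mul_one, Category.id_comp]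

lemma transition_trans (h : i ≤ j) (h' : j ≤ k) :
    transition q (h.trans h') = transition q h ≫ transition q h' := by
  refine pullback_Gm_hom_ext ?_ ?_
  · rw [transition_snd, Category.assoc, transition_snd, ← Category.assoc, transition_snd,
      Category.assoc, Scheme.homOfLE_homOfLE]
  · have h1 := coord_transition q (h.trans h') (𝟙 _)
    have h2 := coord_transition q h (𝟙 _)
    have h3 := coord_transition q h' (transition q h)
    rw [Category.id_comp, Category.id_comp] at h1 h2
    rw [Category.assoc, h3, h1, h2, mul_assoc]
    congr 1
    rw [ratioOn, LocalGen.ratio_trans h h', map_mul, map_appLE_apply _ (LocalGen.le_U h)]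
    congr 1
    refine appLE_congr_hom ?_ _ _ _
    rw [Category.id_comp, transition_snd, Category.assoc, Scheme.homOfLE_ι]

/-- Over the smaller open subset the transition multiplies the coordinate by a unit, so it is
inverted by multiplying with the inverse ratio. This is the equifibered condition of the gluing
data. -/
lemma isPullback_transition (h : i ≤ j) : IsPullback (transition q h)
    (pullback.snd Gm.str (i.U.ι ≫ q)) (pullback.snd Gm.str (j.U.ι ≫ q)) (X.homOfLE (LocalGen.le_U h)) := by
  have key : ∀ {Z : Scheme.{0}} (s : Z ⟶ pullback Gm.str (j.U.ι ≫ q)) (t : Z ⟶ i.U.toScheme),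
      s ≫ pullback.snd _ _ = t ≫ X.homOfLE (LocalGen.le_U h) →
      ∃ m : Z ⟶ pullback Gm.str (i.U.ι ≫ q), m ≫ transition q h = s ∧ m ≫ pullback.snd _ _ = t := by
    intro Z s t hst
    have hs : s ≫ pullback.fst _ _ ≫ Gm.str = t ≫ i.U.ι ≫ q := by
      rw [pullback.condition, reassoc_of% hst, Scheme.homOfLE_ι_assoc]
    let m : Z ⟶ pullback Gm.str (i.U.ι ≫ q) := pullback.lift
      (pullback.lift (s ≫ pullback.fst _ _)
        (toGm (t ≫ i.U.ι ≫ q) (isUnit_ratioOn h t).unit⁻¹)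
        (by rw [toGm_str, Category.assoc, hs]) ≫ Gm.mul) t
      (by rw [Category.assoc, Gm.mul_str, pullback.lift_fst_assoc, Category.assoc, hs])
    have hm : m ≫ pullback.snd _ _ = t := pullback.lift_snd _ _ _
    refine ⟨m, pullback_Gm_hom_ext ?_ ?_, hm⟩
    · rw [Category.assoc, transition_snd, ← Category.assoc, hm, hst]
    · rw [Category.assoc, coord_transition, hm, pullback.lift_fst, Gm.coord_lift_mul, coord_toGm,
        mul_assoc, IsUnit.val_inv_mul, mul_one]
  refine ⟨⟨transition_snd q h⟩, ⟨PullbackCone.IsLimit.mk _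
    (fun s => (key s.fst s.snd s.condition).choose)
    (fun s => (key s.fst s.snd s.condition).choose_spec.1)
    (fun s => (key s.fst s.snd s.condition).choose_spec.2) fun s m h1 h2 => ?_⟩⟩
  obtain ⟨h3, h4⟩ := (key s.fst s.snd s.condition).choose_spec
  generalize (key s.fst s.snd s.condition).choose = n at h3 h4
  refine pullback_Gm_hom_ext (h2.trans h4.symm) ?_
  have e1 := coord_transition q h m
  have e2 := coord_transition q h n
  rw [← Category.assoc, h1, h2] at e1
  rw [← Category.assoc, h3, h4] at e2
  exact (isUnit_ratioOn h s.snd).mul_right_cancel (e1.symm.trans e2)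

/-- The gluing data for the scheme of frames of `L`. -/
def frameGluingData (hL : L.IsInvertible) : (LocalGen.cover hL).RelativeGluingData where
  functor :=
    { obj := fun i : LocalGen L => pullback Gm.str (i.U.ι ≫ q)
      map := fun f => transition q f.le
      map_id := transition_self q
      map_comp := fun f g => transition_trans q f.le g.le }
  natTrans :=
    { app := fun i : LocalGen L => pullback.snd Gm.str (i.U.ι ≫ q)
      naturality := fun _ _ f => transition_snd q f.le }
  equifibered := fun _ _ f => isPullback_transition q f.le

lemma exists_gluing (hL : L.IsInvertible) : ∃ (P : Scheme.{0}) (ρ : P ⟶ X)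
    (κ : ∀ i : LocalGen L, pullback Gm.str (i.U.ι ≫ q) ⟶ P),
    (∀ {i j : LocalGen L} (h : i ≤ j), transition q h ≫ κ j = κ i) ∧
    ∀ i : LocalGen L, IsPullback (pullback.snd Gm.str (i.U.ι ≫ q)) (κ i) i.U.ι ρ := by
  have : Small.{0} (LocalGen.cover hL).I₀ := inferInstanceAs (Small.{0} (LocalGen L))
  have : Quiver.IsThin (LocalGen.cover hL).I₀ := inferInstanceAs (Quiver.IsThin (LocalGen L))
  obtain ⟨P, ρ, κ, h1, h2⟩ := exists_gluing_of_relativeGluingData _ (frameGluingData q hL)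
  exact ⟨P, ρ, κ, fun {i j} h => h1 (i := i) (j := j) (homOfLE h), h2⟩

/-- Every invertible `L` has a universal frame. -/
theorem exists_universal_frame (hL : L.IsInvertible) : ∃ (P : Scheme.{0}) (ρ : P ⟶ X)
    (φ : Frame L ρ), ∀ i, IsIso (φ.chart q i) := by
  obtain ⟨P, ρ, κ, hκ, hpb⟩ := exists_gluing q hL
  let W : LocalGen L → P.Opens := fun i => ρ ⁻¹ᵁ i.U
  -- Both ρ⁻¹(U) and Gm × U are base changes of P to U; this morphism compares them.
  let e : ∀ i, (W i).toScheme ⟶ pullback Gm.str (i.U.ι ≫ q) := fun i =>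
    (hpb i).lift (ρ ∣_ i.U) (W i).ι (morphismRestrict_ι ρ i.U)
  have he1 : ∀ i, e i ≫ pullback.snd _ _ = ρ ∣_ i.U := fun i => (hpb i).lift_fst _ _ _
  have he2 : ∀ i, e i ≫ κ i = (W i).ι := fun i => (hpb i).lift_snd _ _ _
  have hiso : ∀ i, IsIso (e i) := fun i => by
    have h1 := isPullback_morphismRestrict ρ i.U
    refine ⟨h1.lift (pullback.snd _ _) (κ i) (hpb i).w, h1.hom_ext ?_ ?_, (hpb i).hom_ext ?_ ?_⟩
    · simp [he1]
    · rw [Category.assoc, h1.lift_snd, he2, Category.id_comp]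
    · simp [he1]
    · rw [Category.assoc, he2, Category.id_comp]
      exact h1.lift_snd _ _ _
  have hW : ∀ i, (⊤ : (W i).toScheme.Opens) ≤ (W i).ι ⁻¹ᵁ (W i) := fun i =>
    (W i).ι_preimage_self.ge
  have hbij : ∀ i, Function.Bijective ((W i).ι.appLE (W i) ⊤ (hW i)) := fun i =>
    ((ConcreteCategory.isIso_iff_bijective _).1
      (inferInstanceAs (IsIso ((W i).ι.appLE (W i) ⊤ _))))
  -- The units of the frame are the Gm-coordinates of the glued pieces; `htrans` below gives their
  -- compatibility.
  choose c hc using fun i => (hbij i).2 (Gm.coord (e i ≫ pullback.fst _ _) ⊤)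
  have hunit : ∀ i, IsUnit (c i) := fun i => by
    have h1 : IsUnit ((W i).ι.appLE (W i) ⊤ (hW i) (c i)) := by
      rw [hc]; exact Gm.isUnit_coord _ _
    exact (MulEquiv.isUnit_map (RingEquiv.ofBijective
      ((W i).ι.appLE (W i) ⊤ (hW i)).hom (hbij i))).1 h1
  have htrans : ∀ {i j : LocalGen L} (h : i ≤ j),
      P.homOfLE (ρ.preimage_mono (LocalGen.le_U h)) ≫ e j = e i ≫ transition q h := by
    intro i j h
    refine (hpb j).hom_ext ?_ ?_
    · rw [Category.assoc, Category.assoc, he1, transition_snd, ← Category.assoc (e i), he1,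
        ← cancel_mono j.U.ι, Category.assoc, Category.assoc, morphismRestrict_ι, Scheme.homOfLE_ι,
        morphismRestrict_ι, Scheme.homOfLE_ι_assoc]
    · rw [Category.assoc, Category.assoc, he2, hκ, he2, Scheme.homOfLE_ι]
  let φ : Frame L ρ :=
    { sec := c
      isUnit := hunit
      compat := fun {i j} h => by
        apply (hbij i).1
        rw [map_appLE_apply, map_mul, hc, app_eq_appLE_apply, appLE_appLE]
        have h1 := coord_transition q h (e i)
        rw [← Category.assoc, ← htrans, Category.assoc, ←
          Gm.appLE_coord (V := ⊤) _ _ (le_preimage_top _ _), ← hc, appLE_appLE, he1] at h1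
        refine (appLE_congr_hom (Scheme.homOfLE_ι _ _).symm _ _ _).trans (h1.trans ?_)
        rw [mul_comm]
        congr 1
        exact appLE_congr_hom (morphismRestrict_ι _ _) _ _ _ }
  refine ⟨P, ρ, φ, fun i => ?_⟩
  convert hiso i
  refine pullback_Gm_hom_ext ?_ ?_
  · rw [Frame.chart_snd, he1]
  · rw [Frame.chart_fst, coord_toGmOn _ _ _ _ _ (hW i)]
    exact hc i

end Transition

end UniversalFrame

/-! ### Functions on `Gm × U` for affine `U` -/

section Affine

lemma toSpec_appTop_apply {Y : Scheme.{0}} {R : Type} [CommRing R] (φ : R →+* Γ(Y, ⊤)) (r : R) :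
    (Y.toSpecΓ ≫ Spec.map (CommRingCat.ofHom φ)).appTop ((Scheme.ΓSpecIso (.of R)).inv r) =
      φ r := by
  have h : (Y.toSpecΓ ≫ Spec.map (CommRingCat.ofHom φ)).appTop =
      (Scheme.ΓSpecIso (.of R)).hom ≫ CommRingCat.ofHom φ := by
    rw [Scheme.Hom.comp_appTop, Scheme.toSpecΓ_appTop, Scheme.ΓSpecIso_naturality]
  rw [h, CommRingCat.comp_apply, ← CommRingCat.comp_apply (Scheme.ΓSpecIso (.of R)).inv,
    Iso.inv_hom_id]
  rfl

lemma isIso_toSpec_of_isAffineOpen {X : Scheme.{0}} {U : X.Opens} (hU : IsAffineOpen U) :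
    IsIso (U.toScheme.toSpecΓ ≫ Spec.map (CommRingCat.ofHom
      (U.ι.appLE U ⊤ U.ι_preimage_self.ge).hom)) := by
  have : IsAffine U.toScheme := hU
  have h : IsIso (U.toScheme.toSpecΓ ≫ Spec.map (U.ι.appLE U ⊤ U.ι_preimage_self.ge)) :=
    inferInstance
  exact h

lemma bijective_appTop {Y Z : Scheme.{0}} (f : Y ⟶ Z) (hf : IsIso f) :
    Function.Bijective f.appTop := by
  have h1 : f.appTop ≫ (inv f).appTop = 𝟙 _ := by
    rw [← Scheme.Hom.comp_appTop, IsIso.inv_hom_id, Scheme.Hom.id_appTop]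
  have h2 : (inv f).appTop ≫ f.appTop = 𝟙 _ := by
    rw [← Scheme.Hom.comp_appTop, IsIso.hom_inv_id, Scheme.Hom.id_appTop]
  have : IsIso f.appTop := ⟨_, h1, h2⟩
  exact (ConcreteCategory.isIso_iff_bijective _).1 this

/-- The hypothesis says that Y is the spectrum of R by way of φ; affine schemes enter the next
computations in this form. -/
lemma bijective_of_isIso_toSpec {Y : Scheme.{0}} {R : Type} [CommRing R] (φ : R →+* Γ(Y, ⊤))
    (h : IsIso (Y.toSpecΓ ≫ Spec.map (CommRingCat.ofHom φ))) : Function.Bijective φ := by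
  have h1 : Function.Bijective (Scheme.ΓSpecIso (.of R)).inv :=
    (ConcreteCategory.isIso_iff_bijective _).1 inferInstance
  have h2 := (bijective_appTop _ h).comp h1
  convert h2 using 1
  funext r
  exact (toSpec_appTop_apply φ r).symm

variable {Y : Scheme.{0}} (p : Y ⟶ Spec (.of ℂ)) {R : Type} [CommRing R] (ψ : R →+* Γ(Y, ⊤))

/-- Laurent polynomials as functions on `Gm × Y`. -/
def laurentToGm : R[T;T⁻¹] →+* Γ(pullback Gm.str p, ⊤) :=
  LaurentPolynomial.eval₂ ((pullback.snd Gm.str p).appTop.hom.comp ψ)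
    (Gm.isUnit_coord (pullback.fst Gm.str p) ⊤).unit

lemma laurentToGm_C (a : R) : laurentToGm p ψ (LaurentPolynomial.C a) =
    (pullback.snd Gm.str p).appTop (ψ a) := LaurentPolynomial.eval₂_C _ _ a

lemma laurentToGm_T : laurentToGm p ψ (LaurentPolynomial.T 1) =
    Gm.coord (pullback.fst Gm.str p) ⊤ := by
  rw [laurentToGm, LaurentPolynomial.eval₂_T, zpow_one, IsUnit.unit_spec]

/-- If Y is the spectrum of R, then Gm × Y is the spectrum of R[T, T⁻¹]. The inverse α is the point
of Gm × Y with coordinate T over the projection to Spec R. -/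
lemma isIso_laurentToGm (hψ : IsIso (Y.toSpecΓ ≫ Spec.map (CommRingCat.ofHom ψ))) :
    IsIso ((pullback Gm.str p).toSpecΓ ≫ Spec.map (CommRingCat.ofHom (laurentToGm p ψ))) := by
  set ε := Y.toSpecΓ ≫ Spec.map (CommRingCat.ofHom ψ) with hε
  set β := (pullback Gm.str p).toSpecΓ ≫ Spec.map (CommRingCat.ofHom (laurentToGm p ψ)) with hβ
  let s : Spec (.of R[T;T⁻¹]) ⟶ Y :=
    Spec.map (CommRingCat.ofHom (LaurentPolynomial.C (R := R))) ≫ inv ε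
  have hsε : s ≫ ε = Spec.map (CommRingCat.ofHom (LaurentPolynomial.C (R := R))) := by simp [s]
  have hβs : β ≫ s = pullback.snd _ _ := by
    rw [← cancel_mono ε, Category.assoc, hsε, hβ, Category.assoc, ← Spec.map_comp,
      ← CommRingCat.ofHom_comp]
    have : (laurentToGm p ψ).comp LaurentPolynomial.C =
        (pullback.snd Gm.str p).appTop.hom.comp ψ := by
      ext a; exact laurentToGm_C p ψ a
    rw [this, CommRingCat.ofHom_comp, Spec.map_comp, CommRingCat.ofHom_hom,
      ← Scheme.toSpecΓ_naturality_assoc]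
  let u : Γ(Spec (.of R[T;T⁻¹]), ⊤)ˣ :=
    ((LaurentPolynomial.isUnit_T 1).map (Scheme.ΓSpecIso (.of R[T;T⁻¹])).inv.hom).unit
  let α : Spec (.of R[T;T⁻¹]) ⟶ pullback Gm.str p :=
    pullback.lift (toGm (s ≫ p) u) s (toGm_str _ _)
  have hα1 : α ≫ pullback.fst _ _ = toGm (s ≫ p) u := pullback.lift_fst _ _ _
  have hα2 : α ≫ pullback.snd _ _ = s := pullback.lift_snd _ _ _
  refine ⟨α, pullback_Gm_hom_ext ?_ ?_, ?_⟩
  · rw [Category.assoc, hα2, hβs, Category.id_comp]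
  · rw [Category.assoc, hα1, Category.id_comp, ←
      Gm.appLE_coord (V := ⊤) _ _ (le_preimage_top _ _), coord_toGm, appLE_top, hβ,
      IsUnit.unit_spec]
    exact (toSpec_appTop_apply _ _).trans (laurentToGm_T p ψ)
  · apply ext_to_Spec
    apply CommRingCat.hom_ext
    apply laurent_ringHom_ext
    · intro a
      have e1 : β.appTop ((Scheme.ΓSpecIso (.of R[T;T⁻¹])).inv (LaurentPolynomial.C a)) =
          (pullback.snd Gm.str p).appTop (ψ a) :=
        (toSpec_appTop_apply _ _).trans (laurentToGm_C p ψ a)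
      have e2 : ε.appTop ((Scheme.ΓSpecIso (.of R)).inv a) = ψ a := toSpec_appTop_apply _ _
      have e3 : α ≫ pullback.snd Gm.str p ≫ ε =
          Spec.map (CommRingCat.ofHom (LaurentPolynomial.C (R := R))) := by
        rw [reassoc_of% hα2, hsε]
      have e4 : (Spec.map (CommRingCat.ofHom (LaurentPolynomial.C (R := R)))).appTop
          ((Scheme.ΓSpecIso (.of R)).inv a) =
          (Scheme.ΓSpecIso (.of R[T;T⁻¹])).inv (LaurentPolynomial.C a) := by
        rw [← CommRingCat.comp_apply, ← Scheme.ΓSpecIso_inv_naturality]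
        rfl
      rw [← e3, Scheme.Hom.comp_appTop, Scheme.Hom.comp_appTop, CommRingCat.comp_apply,
        CommRingCat.comp_apply, e2, ← e1, ← CommRingCat.comp_apply,
        ← Scheme.Hom.comp_appTop] at e4
      exact e4
    · have e1 : β.appTop ((Scheme.ΓSpecIso (.of R[T;T⁻¹])).inv (LaurentPolynomial.T 1)) =
          Gm.coord (pullback.fst Gm.str p) ⊤ :=
        (toSpec_appTop_apply _ _).trans (laurentToGm_T p ψ)
      have e2 : (α ≫ β).appTop
          ((Scheme.ΓSpecIso (.of R[T;T⁻¹])).inv (LaurentPolynomial.T 1)) = u := by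
        rw [Scheme.Hom.comp_appTop, CommRingCat.comp_apply, e1, ← appLE_top α (le_preimage_top _ _),
          Gm.appLE_coord, hα1, coord_toGm]
      exact e2

end Affine

/-! ### Charts and affine open subsets -/

section Chart

variable {X : Scheme.{0}} [IsIntegral X] {L : RatSubsheaf X} {P : Scheme.{0}} {ρ : P ⟶ X}
  (q : X ⟶ Spec (.of ℂ)) (φ : Frame L ρ)

namespace Frame

/-- On coordinates this is the compatibility of the frame with the ratio of the two generators. -/
lemma homOfLE_chart {i j : LocalGen L} (h : i ≤ j) :
    P.homOfLE (ρ.preimage_mono (LocalGen.le_U h)) ≫ φ.chart q j =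
      φ.chart q i ≫ transition q h := by
  have hW : ∀ i : LocalGen L, (⊤ : (ρ ⁻¹ᵁ i.U).toScheme.Opens) ≤ (ρ ⁻¹ᵁ i.U).ι ⁻¹ᵁ (ρ ⁻¹ᵁ i.U) :=
    fun i => (ρ ⁻¹ᵁ i.U).ι_preimage_self.ge
  refine pullback_Gm_hom_ext ?_ ?_
  · rw [Category.assoc, Category.assoc, chart_snd, transition_snd, ← Category.assoc (φ.chart q i),
      chart_snd, ← cancel_mono j.U.ι, Category.assoc, Category.assoc, morphismRestrict_ι,
      Scheme.homOfLE_ι, morphismRestrict_ι, Scheme.homOfLE_ι_assoc]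
  · rw [Category.assoc, Category.assoc, coord_transition, chart_fst, chart_fst, chart_snd,
      coord_toGmOn _ _ _ _ _ (hW i), ← Gm.appLE_coord (V := ⊤) _ _ (le_preimage_top _ _),
      coord_toGmOn _ _ _ _ _ (hW j), appLE_appLE]
    have h1 := congrArg ((ρ ⁻¹ᵁ i.U).ι.appLE (ρ ⁻¹ᵁ i.U) ⊤ (hW i)) (φ.compat h)
    rw [map_appLE_apply, map_mul, app_eq_appLE_apply, appLE_appLE] at h1
    refine (appLE_congr_hom (Scheme.homOfLE_ι _ _) _ _ _).trans (h1.trans ?_)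
    rw [mul_comm]
    congr 1
    exact appLE_congr_hom (morphismRestrict_ι _ _).symm _ _ _

/-- The source and the target of the smaller chart are both base changes of Gm × V, for V the larger
open subset, and the chart is the comparison between them. -/
lemma isIso_chart_of_le {i j : LocalGen L} (h : i ≤ j) (hj : IsIso (φ.chart q j)) :
    IsIso (φ.chart q i) := by
  have h1 : IsPullback (P.homOfLE (ρ.preimage_mono (LocalGen.le_U h)) ≫ φ.chart q j)
      (ρ ∣_ i.U) (pullback.snd Gm.str (j.U.ι ≫ q)) (X.homOfLE (LocalGen.le_U h)) := by
    have h2 : IsPullback (P.homOfLE (ρ.preimage_mono (LocalGen.le_U h)))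
      (ρ ∣_ i.U) (ρ ∣_ j.U) (X.homOfLE (LocalGen.le_U h)) := by
      refine IsPullback.of_right (t := (isPullback_morphismRestrict ρ j.U).flip) ?_ ?_
      · rw [Scheme.homOfLE_ι, Scheme.homOfLE_ι]
        exact (isPullback_morphismRestrict ρ i.U).flip
      · rw [← cancel_mono j.U.ι, Category.assoc, Category.assoc, morphismRestrict_ι,
          Scheme.homOfLE_ι, morphismRestrict_ι, Scheme.homOfLE_ι_assoc]
    refine h2.of_iso (Iso.refl _) (asIso (φ.chart q j)) (Iso.refl _) (Iso.refl _) ?_ ?_ ?_ ?_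
    · simp
    · simp
    · simp [chart_snd]
    · simp
  have h3 := isPullback_transition q h
  refine ⟨h1.lift (transition q h) (pullback.snd _ _) (transition_snd q h),
    h1.hom_ext ?_ ?_, h3.hom_ext ?_ ?_⟩
  · rw [Category.assoc, h1.lift_fst, Category.id_comp, homOfLE_chart]
  · rw [Category.assoc, h1.lift_snd, Category.id_comp, chart_snd]
  · rw [Category.assoc, ← homOfLE_chart, h1.lift_fst, Category.id_comp]
  · rw [Category.assoc, chart_snd, h1.lift_snd, Category.id_comp]

/-- Laurent polynomials as functions on `ρ⁻¹(U)`. -/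
def laurent (i : LocalGen L) : Γ(X, i.U)[T;T⁻¹] →+* Γ(P, ρ ⁻¹ᵁ i.U) :=
  LaurentPolynomial.eval₂ (ρ.app i.U).hom (φ.isUnit i).unit

variable {q φ}

/-- The chart replaces ρ⁻¹(U) by Gm × U, whose functions are Laurent polynomials for affine U. The
square `key` commutes because the coordinate pulls back to the unit of the frame. -/
lemma bijective_laurent {i : LocalGen L} (hi : IsIso (φ.chart q i)) (hU : IsAffineOpen i.U) :
    Function.Bijective (φ.laurent i) := by
  have hW : (⊤ : (ρ ⁻¹ᵁ i.U).toScheme.Opens) ≤ (ρ ⁻¹ᵁ i.U).ι ⁻¹ᵁ (ρ ⁻¹ᵁ i.U) :=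
    (ρ ⁻¹ᵁ i.U).ι_preimage_self.ge
  have hUU : (⊤ : i.U.toScheme.Opens) ≤ i.U.ι ⁻¹ᵁ i.U := i.U.ι_preimage_self.ge
  have h1 := bijective_of_isIso_toSpec _
    (isIso_laurentToGm (i.U.ι ≫ q) _ (isIso_toSpec_of_isAffineOpen hU))
  have h2 : Function.Bijective (φ.chart q i).appTop :=
    bijective_appTop _ hi
  have h3 : Function.Bijective ((ρ ⁻¹ᵁ i.U).ι.appLE (ρ ⁻¹ᵁ i.U) ⊤ hW) :=
    (ConcreteCategory.isIso_iff_bijective _).1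
      (inferInstanceAs (IsIso ((ρ ⁻¹ᵁ i.U).ι.appLE (ρ ⁻¹ᵁ i.U) ⊤ _)))
  have key : ((ρ ⁻¹ᵁ i.U).ι.appLE (ρ ⁻¹ᵁ i.U) ⊤ hW).hom.comp (φ.laurent i) =
      (φ.chart q i).appTop.hom.comp (laurentToGm (i.U.ι ≫ q) (i.U.ι.appLE i.U ⊤ hUU).hom) := by
    apply laurent_ringHom_ext
    · intro a
      rw [RingHom.comp_apply, RingHom.comp_apply, laurentToGm_C]
      have e1 : φ.laurent i (LaurentPolynomial.C a) = ρ.app i.U a :=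
        LaurentPolynomial.eval₂_C _ _ a
      rw [e1, app_eq_appLE_apply]
      have e2 : (φ.chart q i).appTop ((pullback.snd Gm.str (i.U.ι ≫ q)).appTop
          (i.U.ι.appLE i.U ⊤ hUU a)) =
          (φ.chart q i ≫ pullback.snd _ _).appLE ⊤ ⊤ (le_preimage_top _ _)
            (i.U.ι.appLE i.U ⊤ hUU a) := by
        rw [appLE_top, Scheme.Hom.comp_appTop, CommRingCat.comp_apply]
      refine (appLE_appLE _ _ _ _ _).trans (Eq.trans ?_ e2.symm)
      refine Eq.trans ?_ (appLE_appLE _ _ _ _ _).symm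
      refine appLE_congr_hom ?_ _ _ _
      rw [chart_snd, morphismRestrict_ι]
    · rw [RingHom.comp_apply, RingHom.comp_apply, laurentToGm_T]
      have e1 : φ.laurent i (LaurentPolynomial.T 1) = φ.sec i := by
        rw [laurent, LaurentPolynomial.eval₂_T, zpow_one, IsUnit.unit_spec]
      rw [e1]
      have e2 := coord_toGmOn (ρ ≫ q) _ (φ.sec i) (φ.isUnit i) ⊤ hW
      rw [← chart_fst, ← Gm.appLE_coord (V := ⊤) _ _ (le_preimage_top _ _), appLE_top] at e2
      exact e2.symm
  have h4 : Function.Bijective (((ρ ⁻¹ᵁ i.U).ι.appLE (ρ ⁻¹ᵁ i.U) ⊤ hW).hom.comp (φ.laurent i)) := by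
    rw [key]
    exact h2.comp h1
  exact (Function.Bijective.of_comp_iff' h3 _).1 h4

lemma isAffineOpen_preimage {i : LocalGen L} (hi : IsIso (φ.chart q i)) (hU : IsAffineOpen i.U) :
    IsAffineOpen (ρ ⁻¹ᵁ i.U) := by
  have h1 := isIso_laurentToGm (i.U.ι ≫ q) _ (isIso_toSpec_of_isAffineOpen hU)
  have h2 : IsAffine (pullback Gm.str (i.U.ι ≫ q)) := IsAffine.of_isIso
    ((pullback Gm.str (i.U.ι ≫ q)).toSpecΓ ≫ Spec.map (CommRingCat.ofHom
      (laurentToGm (i.U.ι ≫ q) (i.U.ι.appLE i.U ⊤ i.U.ι_preimage_self.ge).hom)))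
  exact IsAffine.of_isIso (φ.chart q i)

lemma isIntegral_preimage {i : LocalGen L} (hi : IsIso (φ.chart q i)) (hU : IsAffineOpen i.U) :
    IsIntegral (ρ ⁻¹ᵁ i.U).toScheme := by
  have h1 := isIso_laurentToGm (i.U.ι ≫ q) _ (isIso_toSpec_of_isAffineOpen hU)
  have : IsDomain Γ(X, i.U)[T;T⁻¹] := inferInstance
  have h2 : IsIntegral (pullback Gm.str (i.U.ι ≫ q)) := IsIntegral.of_isIso
    (inv ((pullback Gm.str (i.U.ι ≫ q)).toSpecΓ ≫ Spec.map (CommRingCat.ofHom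
      (laurentToGm (i.U.ι ≫ q) (i.U.ι.appLE i.U ⊤ i.U.ι_preimage_self.ge).hom))))
  exact IsIntegral.of_isIso (inv (φ.chart q i))

end Frame

end Chart

/-! ### Integrality and finiteness of schemes with a universal frame -/

/-- Reducedness is local. For irreducibility, the integral pieces meet pairwise because X is
irreducible and π is surjective, so any two nonempty open subsets can be linked through two pieces.
-/
lemma isIntegral_of_cover {X Y : Scheme.{0}} [IrreducibleSpace X] (π : Y ⟶ X)
    (hπ : Function.Surjective π)
    (h : ∀ x : X, ∃ U : X.Opens, x ∈ U ∧ IsIntegral (π ⁻¹ᵁ U).toScheme) : IsIntegral Y := by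
  choose U hU hint using h
  have hne : ∀ x y, ((π ⁻¹ᵁ U x ⊓ π ⁻¹ᵁ U y : Y.Opens) : Set Y).Nonempty := fun x y => by
    obtain ⟨z, hz⟩ := nonempty_preirreducible_inter (U x).isOpen (U y).isOpen
      ⟨x, hU x⟩ ⟨y, hU y⟩
    obtain ⟨w, rfl⟩ := hπ z
    exact ⟨w, hz⟩
  have hmeet : ∀ (W : Y.Opens), IsIntegral W.toScheme → ∀ A B : Y.Opens,
      ((W ⊓ A : Y.Opens) : Set Y).Nonempty → ((W ⊓ B : Y.Opens) : Set Y).Nonempty →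
      ((W ⊓ A ⊓ B : Y.Opens) : Set Y).Nonempty := by
    rintro W hW A B ⟨a, ha, ha'⟩ ⟨b, hb, hb'⟩
    obtain ⟨c, hc, hc'⟩ := nonempty_preirreducible_inter (W.ι ⁻¹ᵁ A).isOpen (W.ι ⁻¹ᵁ B).isOpen
      ⟨⟨a, ha⟩, ha'⟩ ⟨⟨b, hb⟩, hb'⟩
    exact ⟨W.ι c, ⟨c.2, hc⟩, hc'⟩
  have hred : IsReduced Y := by
    have hcov : TopologicalSpace.IsOpenCover fun x => π ⁻¹ᵁ U x := by
      rw [TopologicalSpace.IsOpenCover, eq_top_iff]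
      exact fun y _ => TopologicalSpace.Opens.mem_iSup.2 ⟨π y, hU (π y)⟩
    have : ∀ i, IsReduced ((Y.openCoverOfIsOpenCover _ hcov).X i) := fun i =>
      have := hint i
      inferInstanceAs (IsReduced (π ⁻¹ᵁ U i).toScheme)
    exact IsReduced.of_openCover Y (Y.openCoverOfIsOpenCover _ hcov)
  have hnonempty : Nonempty Y := by
    obtain ⟨x⟩ := (inferInstance : Nonempty X)
    exact ⟨(hπ x).choose⟩
  have hirr : IrreducibleSpace Y := by
    refine { toPreirreducibleSpace := ⟨?_⟩, toNonempty := hnonempty }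
    rintro A B hA hB ⟨a, -, ha⟩ ⟨b, -, hb⟩
    -- Inside the piece around a, the set A meets the piece around b; inside the latter, A then
    -- meets B.
    have h1 := hmeet _ (hint (π a)) ⟨A, hA⟩ (π ⁻¹ᵁ U (π b)) ⟨a, hU _, ha⟩ (hne _ _)
    have h2 := hmeet _ (hint (π b)) ⟨A, hA⟩ ⟨B, hB⟩ (by
      obtain ⟨c, ⟨-, hc⟩, hc'⟩ := h1
      exact ⟨c, hc', hc⟩) ⟨b, hU _, hb⟩
    obtain ⟨c, ⟨-, hc⟩, hc'⟩ := h2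
    exact ⟨c, trivial, hc, hc'⟩
  exact isIntegral_of_irreducibleSpace_of_isReduced Y

lemma surjective_snd_Gm {Y : Scheme.{0}} (p : Y ⟶ Spec (.of ℂ)) :
    Function.Surjective (pullback.snd Gm.str p) := fun y => by
  refine ⟨pullback.lift (p ≫ Gm.one) (𝟙 Y)
    (by rw [Category.assoc, Gm.one_str, Category.comp_id, Category.id_comp]) y, ?_⟩
  rw [← Scheme.Hom.comp_apply, pullback.lift_snd]
  rfl

instance : LocallyOfFiniteType Gm.str := by
  unfold Gm.str
  rw [HasRingHomProperty.Spec_iff (P := @LocallyOfFiniteType)]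
  change (algebraMap ℂ ℂ[T;T⁻¹]).FiniteType
  rw [RingHom.finiteType_algebraMap]
  infer_instance

instance : QuasiCompact Gm.str := by
  unfold Gm.str
  infer_instance

section

variable {X : Scheme.{0}} [IsIntegral X] {L : RatSubsheaf X} {P : Scheme.{0}} {ρ : P ⟶ X}
  {q : X ⟶ Spec (.of ℂ)} {φ : Frame L ρ}

namespace Frame.IsUniversal

lemma exists_isAffineOpen (hφ : φ.IsUniversal q) (x : X) {V : X.Opens} (hx : x ∈ V) :
    ∃ i : LocalGen L, x ∈ i.U ∧ i.U ≤ V ∧ IsAffineOpen i.U ∧ IsIso (φ.chart q i) := by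
  obtain ⟨i, hi, hiso⟩ := hφ x
  obtain ⟨W, hW, hxW, hWU⟩ := exists_isAffineOpen_mem_and_subset (U := i.U ⊓ V) ⟨hi, hx⟩
  have : Nonempty W := ⟨⟨x, hxW⟩⟩
  exact ⟨i.restrict W (hWU.trans inf_le_left), hxW, hWU.trans inf_le_right, hW,
    isIso_chart_of_le q φ (i.restrict_le W _) hiso⟩

lemma surjective (hφ : φ.IsUniversal q) : Function.Surjective ρ := fun x => by
  obtain ⟨i, hi, hiso⟩ := hφ x
  obtain ⟨y, hy⟩ := surjective_snd_Gm (i.U.ι ≫ q) ⟨x, hi⟩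
  refine ⟨(inv (φ.chart q i) ≫ (ρ ⁻¹ᵁ i.U).ι) y, ?_⟩
  have h1 : (inv (φ.chart q i) ≫ (ρ ⁻¹ᵁ i.U).ι) ≫ ρ = pullback.snd _ _ ≫ i.U.ι := by
    rw [Category.assoc, IsIso.inv_comp_eq, ← Category.assoc, chart_snd, morphismRestrict_ι]
  rw [← Scheme.Hom.comp_apply, h1, Scheme.Hom.comp_apply, hy]
  rfl

lemma isIntegral (hφ : φ.IsUniversal q) : IsIntegral P :=
  isIntegral_of_cover ρ hφ.surjective fun x => by
    obtain ⟨i, hi, -, haff, hiso⟩ := hφ.exists_isAffineOpen x (V := ⊤) trivial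
    exact ⟨i.U, hi, isIntegral_preimage hiso haff⟩

/-- The property is local on the target, and over a chart ρ is an isomorphism followed by a base
change of `Gm.str`. The same argument gives quasi-compactness. -/
lemma locallyOfFiniteType (hφ : φ.IsUniversal q) : LocallyOfFiniteType ρ := by
  refine @IsZariskiLocalAtTarget.of_forall_exists_morphismRestrict @LocallyOfFiniteType
    (@HasRingHomProperty.instIsZariskiLocalAtTarget _ _
      instHasRingHomPropertyLocallyOfFiniteTypeFiniteType) _ _ ρ fun x => ?_
  obtain ⟨i, hi, hiso⟩ := hφ x
  refine ⟨i.U, hi, ?_⟩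
  rw [← chart_snd q φ i]
  infer_instance

lemma quasiCompact (hφ : φ.IsUniversal q) : QuasiCompact ρ := by
  refine @IsZariskiLocalAtTarget.of_forall_exists_morphismRestrict @QuasiCompact
    (@HasAffineProperty.instIsZariskiLocalAtTarget _ _
      instHasAffinePropertyQuasiCompactCompactSpaceCarrierCarrierCommRingCat) _ _ ρ fun x => ?_
  obtain ⟨i, hi, hiso⟩ := hφ x
  refine ⟨i.U, hi, ?_⟩
  rw [← chart_snd q φ i]
  infer_instance

end Frame.IsUniversal

end

/-! ### Expansions of functions as Laurent polynomials -/

section Scale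

variable {R S : Type*} [CommRing R] [CommRing S]

lemma coeff_C_mul_T (a : R) (n m : ℤ) :
    (LaurentPolynomial.C a * LaurentPolynomial.T n : R[T;T⁻¹]).coeff m = if n = m then a else 0 := by
  rw [← LaurentPolynomial.single_eq_C_mul_T, AddMonoidAlgebra.coeff_single, Finsupp.single_apply]

lemma sum_coeff_C_mul_T (p : R[T;T⁻¹]) :
    ∑ n ∈ p.coeff.support, LaurentPolynomial.C (p.coeff n) * LaurentPolynomial.T n = p := by
  ext m
  rw [AddMonoidAlgebra.coeff_sum, Finsupp.finsetSum_apply]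
  simp only [coeff_C_mul_T]
  rw [Finset.sum_ite_eq']
  split_ifs with h
  · rfl
  · exact (Finsupp.notMem_support_iff.1 h).symm

/-- The homomorphism `∑ aₙ Tⁿ ↦ ∑ ψ(aₙ) uⁿ Tⁿ`. -/
def scaleMap (ψ : R →+* S) (u : Sˣ) : R[T;T⁻¹] →+* S[T;T⁻¹] :=
  LaurentPolynomial.eval₂ (LaurentPolynomial.C.comp ψ)
    (Units.map (LaurentPolynomial.C : S →+* S[T;T⁻¹]) u * (LaurentPolynomial.isUnit_T 1).unit)

variable (ψ : R →+* S) (u : Sˣ)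

lemma scaleMap_C (a : R) : scaleMap ψ u (LaurentPolynomial.C a) = LaurentPolynomial.C (ψ a) :=
  LaurentPolynomial.eval₂_C _ _ a

lemma C_mul_T_zpow (u : Sˣ) (n : ℤ) :
    ((Units.map (LaurentPolynomial.C : S →+* S[T;T⁻¹]) u * (LaurentPolynomial.isUnit_T 1).unit) ^ n :
      (S[T;T⁻¹])ˣ) = (LaurentPolynomial.C ((u ^ n : Sˣ) : S) * LaurentPolynomial.T n : S[T;T⁻¹]) := by
  rw [mul_zpow, Units.val_mul, ← map_zpow]
  congr 1
  have key : ∀ n : ℕ, (((LaurentPolynomial.isUnit_T (R := S) 1).unit ^ n : (S[T;T⁻¹])ˣ) : S[T;T⁻¹]) =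
      LaurentPolynomial.T n := fun n => by
    rw [Units.val_pow_eq_pow_val, IsUnit.unit_spec, LaurentPolynomial.T_pow, mul_one]
  obtain ⟨k, rfl | rfl⟩ := n.eq_nat_or_neg
  · rw [zpow_natCast, key]
  · rw [zpow_neg, zpow_natCast, Units.inv_eq_of_mul_eq_one_right]
    rw [key, ← LaurentPolynomial.T_add, add_neg_cancel, LaurentPolynomial.T_zero]

lemma scaleMap_T (n : ℤ) : scaleMap ψ u (LaurentPolynomial.T n) =
    LaurentPolynomial.C ((u ^ n : Sˣ) : S) * LaurentPolynomial.T n := by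
  rw [scaleMap, LaurentPolynomial.eval₂_T, C_mul_T_zpow]

lemma coeff_scaleMap (p : R[T;T⁻¹]) (n : ℤ) :
    (scaleMap ψ u p).coeff n = ψ (p.coeff n) * (u ^ n : Sˣ) := by
  induction p using LaurentPolynomial.induction_on' with
  | add p q hp hq => rw [map_add, AddMonoidAlgebra.coeff_add, AddMonoidAlgebra.coeff_add,
      Finsupp.add_apply, Finsupp.add_apply, hp, hq, map_add, add_mul]
  | C_mul_T k a =>
    rw [map_mul, scaleMap_C, scaleMap_T, ← mul_assoc, ← map_mul, coeff_C_mul_T, coeff_C_mul_T]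
    split_ifs with h
    · rw [h]
    · rw [map_zero, zero_mul]

variable {ψ} in
lemma scaleMap_injective (hψ : Function.Injective ψ) : Function.Injective (scaleMap ψ u) := by
  intro p q hpq
  ext n
  have := congrArg (fun p : S[T;T⁻¹] => p.coeff n) hpq
  simp only [coeff_scaleMap] at this
  exact hψ ((u ^ n).isUnit.mul_right_cancel this)

lemma mem_range_scaleMap (p : S[T;T⁻¹]) :
    p ∈ (scaleMap ψ u).range ↔ ∀ n, p.coeff n * ((u ^ n)⁻¹ : Sˣ) ∈ ψ.range := by
  constructor
  · rintro ⟨p, rfl⟩ n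
    exact ⟨p.coeff n, by rw [coeff_scaleMap, Units.mul_inv_cancel_right]⟩
  · intro h
    choose a ha using h
    refine ⟨∑ n ∈ p.coeff.support, LaurentPolynomial.C (a n) * LaurentPolynomial.T n, ?_⟩
    rw [map_sum]
    refine Eq.trans (Finset.sum_congr rfl fun n _ => ?_) (sum_coeff_C_mul_T p)
    rw [map_mul, scaleMap_C, scaleMap_T, ← mul_assoc, ← map_mul, ha, Units.inv_mul_cancel_right]

end Scale

lemma map_homOfLE_apply {Y : Scheme.{0}} {U V W : Y.Opens} (h : V ≤ U) (h' : W ≤ V) (f : Γ(Y, U)) :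
    Y.presheaf.map (homOfLE h').op (Y.presheaf.map (homOfLE h).op f) =
      Y.presheaf.map (homOfLE (h'.trans h)).op f := by
  rw [← CommRingCat.comp_apply, ← Functor.map_comp]
  rfl

section Expansion

variable {X : Scheme.{0}} [IsIntegral X] {L : RatSubsheaf X} {P : Scheme.{0}} {ρ : P ⟶ X}
  {q : X ⟶ Spec (.of ℂ)} {φ : Frame L ρ}

/-- The homomorphism `∑ aₙ Tⁿ ↦ ∑ aₙ gⁿ Tⁿ` for a generator `g` of `L`. -/
def LocalGen.scale (i : LocalGen L) : Γ(X, i.U)[T;T⁻¹] →+* X.functionField[T;T⁻¹] :=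
  scaleMap (X.germToFunctionField i.U).hom (Units.mk0 i.g i.gen.1)

lemma LocalGen.scale_C (i : LocalGen L) (a : Γ(X, i.U)) : i.scale (LaurentPolynomial.C a) =
    LaurentPolynomial.C (X.germToFunctionField i.U a) := scaleMap_C _ _ a

lemma LocalGen.scale_T (i : LocalGen L) (n : ℤ) : i.scale (LaurentPolynomial.T n) =
    LaurentPolynomial.C (i.g ^ n) * LaurentPolynomial.T n := by
  rw [LocalGen.scale, scaleMap_T, Units.val_zpow_eq_zpow_val, Units.val_mk0]

lemma LocalGen.scale_injective (i : LocalGen L) : Function.Injective i.scale :=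
  scaleMap_injective _ (X.germToFunctionField_injective i.U)

/-- Since gⁿ generates L^n on U, a coefficient belongs to L^n exactly when its quotient by gⁿ is
regular. This identifies Laurent polynomials in gT over Γ(U) with the sections of ⨁ L^n. -/
lemma LocalGen.mem_range_scale (i : LocalGen L) (p : X.functionField[T;T⁻¹]) :
    p ∈ i.scale.range ↔ ∀ n : ℤ, p.coeff n ∈ (L.zpow n).sections i.U := by
  rw [scale, mem_range_scaleMap]
  refine forall_congr' fun n => ?_
  rw [(i.gen.zpow n).2 i.U le_rfl, ← zpow_neg, ← zpow_neg, Units.val_zpow_eq_zpow_val,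
    Units.val_mk0]
  rfl

namespace Frame

lemma laurent_C (i : LocalGen L) (a : Γ(X, i.U)) :
    φ.laurent i (LaurentPolynomial.C a) = ρ.app i.U a := LaurentPolynomial.eval₂_C _ _ a

lemma laurent_T (i : LocalGen L) (n : ℤ) :
    φ.laurent i (LaurentPolynomial.T n) = ((φ.isUnit i).unit ^ n : Γ(P, ρ ⁻¹ᵁ i.U)ˣ) := by
  rw [laurent, LaurentPolynomial.eval₂_T]

lemma laurent_T_one (i : LocalGen L) :
    φ.laurent i (LaurentPolynomial.T 1) = φ.sec i := by
  rw [laurent_T, zpow_one, IsUnit.unit_spec]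

/-- The expansion of functions on `ρ⁻¹(U)` as Laurent polynomials, for a suitable generator
on `U`. -/
def localExpansion {i : LocalGen L} (hi : Function.Bijective (φ.laurent i)) :
    Γ(P, ρ ⁻¹ᵁ i.U) →+* X.functionField[T;T⁻¹] :=
  i.scale.comp (RingEquiv.ofBijective _ hi).symm.toRingHom

lemma localExpansion_laurent {i : LocalGen L} (hi : Function.Bijective (φ.laurent i))
    (p : Γ(X, i.U)[T;T⁻¹]) : localExpansion hi (φ.laurent i p) = i.scale p :=
  congrArg i.scale ((RingEquiv.ofBijective _ hi).symm_apply_apply p)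

lemma localExpansion_injective {i : LocalGen L} (hi : Function.Bijective (φ.laurent i)) :
    Function.Injective (localExpansion hi) :=
  i.scale_injective.comp (RingEquiv.ofBijective _ hi).symm.injective

/-- The unit at j restricts to g_j/g_i times the unit at i, and this expands to (g_j/g_i) g_i T =
g_j T. The choice of generator cancels. -/
lemma localExpansion_res {i j : LocalGen L} (h : i ≤ j) (hi : Function.Bijective (φ.laurent i))
    (hj : Function.Bijective (φ.laurent j)) (f : Γ(P, ρ ⁻¹ᵁ j.U)) :
    localExpansion hi (P.presheaf.map (homOfLE (ρ.preimage_mono (LocalGen.le_U h))).op f) =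
      localExpansion hj f := by
  obtain ⟨p, rfl⟩ := hj.2 f
  rw [localExpansion_laurent]
  have key : ((localExpansion hi).comp
      (P.presheaf.map (homOfLE (ρ.preimage_mono (LocalGen.le_U h))).op).hom).comp (φ.laurent j) =
      j.scale := by
    apply laurent_ringHom_ext
    · intro a
      rw [RingHom.comp_apply, RingHom.comp_apply, laurent_C, LocalGen.scale_C]
      have e1 : P.presheaf.map (homOfLE (ρ.preimage_mono (LocalGen.le_U h))).op (ρ.app j.U a) =
          φ.laurent i (LaurentPolynomial.C (X.presheaf.map (homOfLE (LocalGen.le_U h)).op a)) := by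
        rw [laurent_C, app_eq_appLE_apply, app_eq_appLE_apply, appLE_map_apply, map_appLE_apply]
      refine (congrArg (localExpansion hi) e1).trans ?_
      rw [localExpansion_laurent, LocalGen.scale_C]
      exact congrArg _ (germToFunctionField_res _ a)
    · rw [RingHom.comp_apply, RingHom.comp_apply, laurent_T_one, LocalGen.scale_T]
      have e1 : P.presheaf.map (homOfLE (ρ.preimage_mono (LocalGen.le_U h))).op (φ.sec j) =
          φ.laurent i (LaurentPolynomial.C (LocalGen.ratio h) * LaurentPolynomial.T 1) := by
        rw [map_mul, laurent_C, laurent_T_one, φ.compat h]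
      refine (congrArg (localExpansion hi) e1).trans ?_
      rw [localExpansion_laurent, map_mul, LocalGen.scale_C, LocalGen.scale_T, ← mul_assoc,
        ← map_mul, zpow_one, zpow_one]
      congr 2
      exact (congrArg (· * i.g) (LocalGen.germ_ratio h)).trans (inv_mul_cancel_right₀ i.gen.1 _)
  exact congrArg (fun f => f p) key

namespace IsUniversal

lemma exists_bijective_laurent (hφ : φ.IsUniversal q) (x : X) {V : X.Opens} (hx : x ∈ V) :
    ∃ i : LocalGen L, x ∈ i.U ∧ i.U ≤ V ∧ Function.Bijective (φ.laurent i) := by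
  obtain ⟨i, h1, h2, h3, h4⟩ := hφ.exists_isAffineOpen x hx
  exact ⟨i, h1, h2, bijective_laurent h4 h3⟩

lemma exists_bijective_laurent' (hφ : φ.IsUniversal q) (U : X.Opens) [hU : Nonempty U] :
    ∃ i : LocalGen L, i.U ≤ U ∧ Function.Bijective (φ.laurent i) := by
  obtain ⟨x⟩ := hU
  obtain ⟨i, -, h⟩ := hφ.exists_bijective_laurent x.1 x.2
  exact ⟨i, h⟩

/-- Irreducibility of X provides a third trivializing open subset inside both, on which the
expansions are compared. -/
lemma localExpansion_eq (hφ : φ.IsUniversal q) {U : X.Opens} {i j : LocalGen L}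
    (hi : Function.Bijective (φ.laurent i)) (hj : Function.Bijective (φ.laurent j))
    (hiU : i.U ≤ U) (hjU : j.U ≤ U) (f : Γ(P, ρ ⁻¹ᵁ U)) :
    localExpansion hi (P.presheaf.map (homOfLE (ρ.preimage_mono hiU)).op f) =
      localExpansion hj (P.presheaf.map (homOfLE (ρ.preimage_mono hjU)).op f) := by
  obtain ⟨x, hx⟩ := nonempty_preirreducible_inter i.U.isOpen j.U.isOpen
    (Set.nonempty_coe_sort.1 i.nonempty) (Set.nonempty_coe_sort.1 j.nonempty)
  obtain ⟨k, -, hk, hk'⟩ := hφ.exists_bijective_laurent x (V := i.U ⊓ j.U) hx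
  have hki : k ≤ i := hk.trans inf_le_left
  have hkj : k ≤ j := hk.trans inf_le_right
  rw [← localExpansion_res hki hk', ← localExpansion_res hkj hk', map_homOfLE_apply,
    map_homOfLE_apply]

/-- The expansion of functions on `ρ⁻¹(U)` as Laurent polynomials. -/
def toLaurent (hφ : φ.IsUniversal q) (U : X.Opens) [Nonempty U] :
    Γ(P, ρ ⁻¹ᵁ U) →+* X.functionField[T;T⁻¹] :=
  (localExpansion (hφ.exists_bijective_laurent' U).choose_spec.2).comp
    (P.presheaf.map (homOfLE (ρ.preimage_mono
      (hφ.exists_bijective_laurent' U).choose_spec.1)).op).hom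

lemma toLaurent_eq (hφ : φ.IsUniversal q) {U : X.Opens} [Nonempty U] {i : LocalGen L}
    (h : i.U ≤ U) (hi : Function.Bijective (φ.laurent i)) (f : Γ(P, ρ ⁻¹ᵁ U)) :
    hφ.toLaurent U f =
      localExpansion hi (P.presheaf.map (homOfLE (ρ.preimage_mono h)).op f) :=
  hφ.localExpansion_eq _ _ (hφ.exists_bijective_laurent' U).choose_spec.1 h f

lemma toLaurent_eq_scale (hφ : φ.IsUniversal q) {i : LocalGen L}
    (hi : Function.Bijective (φ.laurent i)) (p : Γ(X, i.U)[T;T⁻¹]) :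
    hφ.toLaurent i.U (φ.laurent i p) = i.scale p := by
  rw [hφ.toLaurent_eq (le_refl i.U) hi, localExpansion_res (le_refl i) hi hi,
    localExpansion_laurent]

lemma toLaurent_res (hφ : φ.IsUniversal q) {U V : X.Opens} [Nonempty U] [Nonempty V] (hVU : V ≤ U)
    (f : Γ(P, ρ ⁻¹ᵁ U)) :
    hφ.toLaurent V (P.presheaf.map (homOfLE (ρ.preimage_mono hVU)).op f) = hφ.toLaurent U f := by
  obtain ⟨i, hiV, hi⟩ := hφ.exists_bijective_laurent' V
  rw [hφ.toLaurent_eq hiV hi, hφ.toLaurent_eq (hiV.trans hVU) hi, map_homOfLE_apply]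

lemma section_ext (hφ : φ.IsUniversal q) {U : X.Opens} {f g : Γ(P, ρ ⁻¹ᵁ U)}
    (h : ∀ (i : LocalGen L) (hi : i.U ≤ U), Function.Bijective (φ.laurent i) →
      P.presheaf.map (homOfLE (ρ.preimage_mono hi)).op f =
        P.presheaf.map (homOfLE (ρ.preimage_mono hi)).op g) : f = g := by
  refine P.IsSheaf.section_ext fun y hy => ?_
  obtain ⟨i, hy, hi, hi'⟩ := hφ.exists_bijective_laurent (ρ y) (V := U) hy
  exact ⟨ρ ⁻¹ᵁ i.U, ρ.preimage_mono hi, hy, h i hi hi'⟩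

lemma toLaurent_injective (hφ : φ.IsUniversal q) (U : X.Opens) [Nonempty U] :
    Function.Injective (hφ.toLaurent U) := fun f g hfg => by
  refine hφ.section_ext fun i hi hi' => localExpansion_injective hi' ?_
  rwa [← hφ.toLaurent_eq hi, ← hφ.toLaurent_eq hi]

lemma toLaurent_base (hφ : φ.IsUniversal q) (U : X.Opens) [Nonempty U] (a : Γ(X, U)) :
    hφ.toLaurent U (ρ.app U a) = LaurentPolynomial.C (X.germToFunctionField U a) := by
  obtain ⟨i, hi, hi'⟩ := hφ.exists_bijective_laurent' U
  rw [hφ.toLaurent_eq hi hi', app_eq_appLE_apply, appLE_map_apply, ← map_appLE_apply ρ hi le_rfl,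
    ← app_eq_appLE_apply, ← laurent_C, localExpansion_laurent, LocalGen.scale_C]
  exact congrArg _ (germToFunctionField_res hi a)

lemma toLaurent_sec (hφ : φ.IsUniversal q) (i : LocalGen L) : hφ.toLaurent i.U (φ.sec i) =
    LaurentPolynomial.C i.g * LaurentPolynomial.T 1 := by
  obtain ⟨x, hx⟩ := i.nonempty
  obtain ⟨k, -, hk, hk'⟩ := hφ.exists_bijective_laurent x hx
  have hki : k ≤ i := hk
  rw [hφ.toLaurent_eq hk hk', φ.compat hki, map_mul, ← laurent_C, ← laurent_T_one,
    localExpansion_laurent, localExpansion_laurent, LocalGen.scale_C, LocalGen.scale_T, ← mul_assoc,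
    ← map_mul, zpow_one]
  congr 2
  exact (congrArg (· * k.g) (LocalGen.germ_ratio hki)).trans (inv_mul_cancel_right₀ k.gen.1 _)

lemma mem_range_toLaurent_iff (hφ : φ.IsUniversal q) (U : X.Opens) [Nonempty U]
    (p : X.functionField[T;T⁻¹]) :
    p ∈ (hφ.toLaurent U).range ↔ ∀ m : ℤ, p.coeff m ∈ (L.zpow m).sections U := by
  constructor
  · rintro ⟨f, rfl⟩ m
    refine (L.zpow m).glue U _ fun x hx => ?_
    obtain ⟨i, hxi, hi, hi'⟩ := hφ.exists_bijective_laurent x hx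
    refine ⟨i.U, i.nonempty, hxi, hi, ?_⟩
    rw [hφ.toLaurent_eq hi hi']
    exact (i.mem_range_scale _).1 ⟨_, rfl⟩ m
  · intro h
    have hloc : ∀ x : U, ∃ (V : X.Opens) (_ : Nonempty V), x.1 ∈ V ∧ V ≤ U ∧
        ∃ f : Γ(P, ρ ⁻¹ᵁ V), hφ.toLaurent V f = p := fun x => by
      obtain ⟨i, hxi, hi, hi'⟩ := hφ.exists_bijective_laurent x.1 x.2
      obtain ⟨r, hr⟩ := (i.mem_range_scale p).2 fun n => (L.zpow n).res hi (h n)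
      exact ⟨i.U, i.nonempty, hxi, hi, φ.laurent i r, (hφ.toLaurent_eq_scale hi' r).trans hr⟩
    choose V hV hxV hVU f hf using hloc
    -- The local preimages of p glue, because expansion is injective on overlaps and they all expand
    -- to p.
    obtain ⟨b, hb, -⟩ := TopCat.Sheaf.existsUnique_gluing' P.sheaf (fun x => ρ ⁻¹ᵁ V x) (ρ ⁻¹ᵁ U)
      (fun x => homOfLE (ρ.preimage_mono (hVU x)))
      (fun y hy => TopologicalSpace.Opens.mem_iSup.2 ⟨⟨ρ y, hy⟩, hxV ⟨ρ y, hy⟩⟩) f (by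
        intro x y
        have : Nonempty (V x ⊓ V y : X.Opens) := by
          obtain ⟨z, hz⟩ := nonempty_preirreducible_inter (V x).isOpen (V y).isOpen
            ⟨x.1, hxV x⟩ ⟨y.1, hxV y⟩
          exact ⟨z, hz⟩
        apply hφ.toLaurent_injective (V x ⊓ V y)
        exact (hφ.toLaurent_res inf_le_left (f x)).trans
          (((hf x).trans (hf y).symm).trans (hφ.toLaurent_res inf_le_right (f y)).symm))
    obtain ⟨x⟩ := (inferInstance : Nonempty U)
    have := hV x
    refine ⟨b, ?_⟩
    rw [← hf x, ← hb x]
    exact (hφ.toLaurent_res (hVU x) b).symm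

end IsUniversal

end Frame

end Expansion

/-! ### Weights -/

namespace CircleTorsor

variable {C : RealVariety} (P : CircleTorsor C)

lemma act_le (U : C.X.Opens) : pullback.snd Gm.str P.str ⁻¹ᵁ P.proj ⁻¹ᵁ U ≤
    P.action.act ⁻¹ᵁ P.proj ⁻¹ᵁ U := by
  rw [← Scheme.Hom.comp_preimage, ← Scheme.Hom.comp_preimage, P.act_proj]

/-- The coordinate of `Gm` as a unit on `Gm × ρ⁻¹(U)`. -/
def coordUnit (U : C.X.Opens) :
    Γ(pullback Gm.str P.str, pullback.snd Gm.str P.str ⁻¹ᵁ P.proj ⁻¹ᵁ U)ˣ :=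
  (Gm.isUnit_coord (pullback.fst Gm.str P.str) _).unit

lemma coordUnit_val (U : C.X.Opens) : (P.coordUnit U : Γ(pullback Gm.str P.str,
    pullback.snd Gm.str P.str ⁻¹ᵁ P.proj ⁻¹ᵁ U)) = Gm.coord (pullback.fst Gm.str P.str) _ :=
  IsUnit.unit_spec _

variable {P}

lemma isWeight_iff {m : ℤ} {U : C.X.Opens} {f : Γ(P.X, P.proj ⁻¹ᵁ U)} : P.IsWeight m U f ↔
    P.action.act.appLE _ _ (P.act_le U) f = (pullback.snd Gm.str P.str).app _ f *
      ((P.coordUnit U ^ m : _ˣ) : Γ(pullback Gm.str P.str, _)) := by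
  rw [← Gm.appLE_T (pullback.fst Gm.str P.str) _ m (P.coordUnit U) (P.coordUnit_val U).symm]
  rfl

lemma isWeight_one_iff {U : C.X.Opens} {f : Γ(P.X, P.proj ⁻¹ᵁ U)} : P.IsWeight 1 U f ↔
    P.action.act.appLE _ _ (P.act_le U) f = (pullback.snd Gm.str P.str).app _ f *
      Gm.coord (pullback.fst Gm.str P.str) _ := by
  rw [isWeight_iff, zpow_one, coordUnit_val]

lemma IsWeight.mul {m n : ℤ} {U : C.X.Opens} {f g : Γ(P.X, P.proj ⁻¹ᵁ U)}
    (hf : P.IsWeight m U f) (hg : P.IsWeight n U g) : P.IsWeight (m + n) U (f * g) := by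
  rw [isWeight_iff] at *
  rw [map_mul, map_mul, hf, hg, zpow_add, Units.val_mul]
  ring

lemma isWeight_base (U : C.X.Opens) (a : Γ(C.X, U)) : P.IsWeight 0 U (P.proj.app U a) := by
  rw [isWeight_iff, zpow_zero, Units.val_one, mul_one, app_eq_appLE_apply, app_eq_appLE_apply]
  exact (appLE_appLE _ _ _ _ _).trans ((appLE_congr_hom P.act_proj _ _ _).trans
    (appLE_appLE _ _ _ _ _).symm)

lemma isWeight_unit_zpow {m : ℤ} {U : C.X.Opens} {f : Γ(P.X, P.proj ⁻¹ᵁ U)ˣ}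
    (hf : P.IsWeight m U f) (n : ℤ) : P.IsWeight (m * n) U (f ^ n : Γ(P.X, P.proj ⁻¹ᵁ U)ˣ) := by
  rw [isWeight_iff] at *
  have h1 : Units.map (P.action.act.appLE _ _ (P.act_le U)).hom.toMonoidHom f =
      Units.map ((pullback.snd Gm.str P.str).app (P.proj ⁻¹ᵁ U)).hom.toMonoidHom f *
        P.coordUnit U ^ m := Units.ext hf
  have h2 := congrArg (· ^ n) h1
  simp only [← map_zpow, mul_zpow, ← zpow_mul] at h2
  exact congrArg Units.val h2

lemma act_map {U V : C.X.Opens} (h : V ≤ U) (f : Γ(P.X, P.proj ⁻¹ᵁ U)) :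
    P.action.act.appLE _ _ (P.act_le V) (P.X.presheaf.map (homOfLE (P.proj.preimage_mono h)).op f) =
      (pullback Gm.str P.str).presheaf.map (homOfLE ((pullback.snd Gm.str P.str).preimage_mono
        (P.proj.preimage_mono h))).op (P.action.act.appLE _ _ (P.act_le U) f) := by
  rw [map_appLE_apply, appLE_map_apply]

lemma snd_mul_coord_map {m : ℤ} {U V : C.X.Opens} (h : V ≤ U) (f : Γ(P.X, P.proj ⁻¹ᵁ U)) :
    (pullback.snd Gm.str P.str).app _
      (P.X.presheaf.map (homOfLE (P.proj.preimage_mono h)).op f) *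
      ((P.coordUnit V ^ m : _ˣ) : Γ(pullback Gm.str P.str, _)) =
    (pullback Gm.str P.str).presheaf.map (homOfLE ((pullback.snd Gm.str P.str).preimage_mono
        (P.proj.preimage_mono h))).op ((pullback.snd Gm.str P.str).app _ f *
      ((P.coordUnit U ^ m : _ˣ) : Γ(pullback Gm.str P.str, _))) := by
  rw [map_mul, app_eq_appLE_apply, app_eq_appLE_apply, map_appLE_apply, appLE_map_apply]
  congr 1
  have : P.coordUnit V = Units.map ((pullback Gm.str P.str).presheaf.map
      (homOfLE ((pullback.snd Gm.str P.str).preimage_mono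
        (P.proj.preimage_mono h))).op).hom.toMonoidHom (P.coordUnit U) :=
    Units.ext (by
      rw [coordUnit_val]
      have e1 := Gm.map_coord (pullback.fst Gm.str P.str)
        ((pullback.snd Gm.str P.str).preimage_mono (P.proj.preimage_mono h))
      rw [← coordUnit_val] at e1
      exact e1.symm)
  rw [this, ← map_zpow]
  rfl

lemma IsWeight.res {m : ℤ} {U V : C.X.Opens} {f : Γ(P.X, P.proj ⁻¹ᵁ U)}
    (hf : P.IsWeight m U f) (h : V ≤ U) :
    P.IsWeight m V (P.X.presheaf.map (homOfLE (P.proj.preimage_mono h)).op f) := by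
  rw [isWeight_iff] at *
  rw [act_map h, snd_mul_coord_map h, hf]

lemma isWeight_of_cover {m : ℤ} {U : C.X.Opens} {f : Γ(P.X, P.proj ⁻¹ᵁ U)}
    (h : ∀ x ∈ U, ∃ (V : C.X.Opens) (hV : V ≤ U), x ∈ V ∧
      P.IsWeight m V (P.X.presheaf.map (homOfLE (P.proj.preimage_mono hV)).op f)) :
    P.IsWeight m U f := by
  rw [isWeight_iff]
  refine (pullback Gm.str P.str).IsSheaf.section_ext fun y hy => ?_
  obtain ⟨V, hV, hyV, hf⟩ := h (P.proj (pullback.snd Gm.str P.str y)) hy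
  rw [isWeight_iff, act_map hV, snd_mul_coord_map hV] at hf
  exact ⟨_, _, hyV, hf⟩

variable {L : RatSubsheaf C.X} {φ : Frame L P.proj}

/-- Write c for the unit of the frame. As c has weight one and base functions have weight zero, the
coaction sends ∑ aₙcⁿ to ∑ aₙcⁿTⁿ. Weight m for f says that this equals f Tᵐ. -/
lemma scaleMap_eq_of_isWeight (h1 : ∀ i, P.IsWeight 1 i.U (φ.sec i)) {i : LocalGen L}
    (hi : IsIso (φ.chart C.str i)) (hU : IsAffineOpen i.U) {m : ℤ} {p : Γ(C.X, i.U)[T;T⁻¹]}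
    (hp : P.IsWeight m i.U (φ.laurent i p)) :
    scaleMap (P.proj.app i.U).hom (φ.isUnit i).unit p =
      LaurentPolynomial.C (φ.laurent i p) * LaurentPolynomial.T m := by
  have hW : IsAffineOpen (P.proj ⁻¹ᵁ i.U) := Frame.isAffineOpen_preimage hi hU
  set W := P.proj ⁻¹ᵁ i.U with hWdef
  have hW' : (⊤ : W.toScheme.Opens) ≤ W.ι ⁻¹ᵁ W := W.ι_preimage_self.ge
  let ψ : Γ(P.X, W) →+* Γ(W.toScheme, ⊤) := (W.ι.appLE W ⊤ hW').hom
  -- As W is affine, functions on Gm × W are Laurent polynomials over Γ(W), so an equality of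
  -- coactions is one of Laurent polynomials.
  have hbij : Function.Bijective (laurentToGm (W.ι ≫ P.str) ψ) :=
    bijective_of_isIso_toSpec _ (isIso_laurentToGm (W.ι ≫ P.str) _ (isIso_toSpec_of_isAffineOpen hW))
  apply hbij.1
  let κ : pullback Gm.str (W.ι ≫ P.str) ⟶ pullback Gm.str P.str :=
    pullback.lift (pullback.fst _ _) (pullback.snd _ _ ≫ W.ι)
      (by rw [pullback.condition, Category.assoc])
  have hκ1 : κ ≫ pullback.fst _ _ = pullback.fst _ _ := pullback.lift_fst _ _ _
  have hκ2 : κ ≫ pullback.snd _ _ = pullback.snd _ _ ≫ W.ι := pullback.lift_snd _ _ _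
  have hκ : (⊤ : (pullback Gm.str (W.ι ≫ P.str)).Opens) ≤
      κ ⁻¹ᵁ (pullback.snd Gm.str P.str ⁻¹ᵁ W) := by
    rw [← Scheme.Hom.comp_preimage, hκ2]
    exact fun x _ => (pullback.snd Gm.str (W.ι ≫ P.str) x).2
  have hsnd : ∀ f : Γ(P.X, W), κ.appLE _ ⊤ hκ ((pullback.snd Gm.str P.str).app W f) =
      laurentToGm (W.ι ≫ P.str) ψ (LaurentPolynomial.C f) := fun f => by
    rw [laurentToGm_C, app_eq_appLE_apply]
    refine (appLE_appLE _ _ _ _ _).trans ((appLE_congr_hom hκ2 _ ?_ _).trans ?_)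
    · exact fun x _ => (pullback.snd Gm.str (W.ι ≫ P.str) x).2
    rw [← appLE_top _ (le_preimage_top _ _)]
    exact (appLE_appLE _ _ _ _ _).symm
  have hT : κ.appLE _ ⊤ hκ (P.coordUnit i.U) =
      laurentToGm (W.ι ≫ P.str) ψ (LaurentPolynomial.T 1) := by
    rw [laurentToGm_T, coordUnit_val, Gm.appLE_coord, hκ1]
  have hTm : κ.appLE _ ⊤ hκ ((P.coordUnit i.U ^ m : _ˣ) : Γ(pullback Gm.str P.str, _)) =
      laurentToGm (W.ι ≫ P.str) ψ (LaurentPolynomial.T m) := by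
    have e1 : Units.map (κ.appLE _ ⊤ hκ).hom.toMonoidHom (P.coordUnit i.U) =
      Units.map (laurentToGm (W.ι ≫ P.str) ψ).toMonoidHom (LaurentPolynomial.isUnit_T 1).unit :=
      Units.ext hT
    have e2 := congrArg (· ^ m) e1
    simp only [← map_zpow] at e2
    refine (congrArg Units.val e2).trans (congrArg (laurentToGm (W.ι ≫ P.str) ψ) ?_)
    have := C_mul_T_zpow (1 : Γ(P.X, W)ˣ) m
    simpa using this
  rw [map_mul, ← hsnd, ← hTm, ← map_mul]
  refine Eq.trans ?_ (congrArg (κ.appLE _ ⊤ hκ) (isWeight_iff.1 hp))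
  have key : (laurentToGm (W.ι ≫ P.str) ψ).comp (scaleMap (P.proj.app i.U).hom (φ.isUnit i).unit) =
      ((κ.appLE _ ⊤ hκ).hom.comp (P.action.act.appLE _ _ (P.act_le i.U)).hom).comp
        (φ.laurent i) := by
    apply laurent_ringHom_ext
    · intro a
      rw [RingHom.comp_apply, RingHom.comp_apply, RingHom.comp_apply, scaleMap_C,
        Frame.laurent_C]
      refine (hsnd _).symm.trans (congrArg (κ.appLE _ ⊤ hκ) ?_)
      have := isWeight_iff.1 (isWeight_base (P := P) i.U a)
      rw [zpow_zero, Units.val_one, mul_one] at this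
      exact this.symm
    · rw [RingHom.comp_apply, RingHom.comp_apply, RingHom.comp_apply, scaleMap_T,
        Frame.laurent_T_one, map_mul, zpow_one, IsUnit.unit_spec, ← hT, ← hsnd]
      refine (map_mul (κ.appLE _ ⊤ hκ).hom _ _).symm.trans (congrArg (κ.appLE _ ⊤ hκ) ?_)
      have := isWeight_iff.1 (h1 i)
      rw [zpow_one] at this
      exact this.symm
  exact congrArg (fun f => f p) key

/-- Comparing the coefficients of Tⁿ for n ≠ m gives aₙcⁿ = 0. As c is a unit, only the term of
index m survives. -/
lemma exists_laurent_eq_of_isWeight (h1 : ∀ i, P.IsWeight 1 i.U (φ.sec i)) {i : LocalGen L}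
    (hi : IsIso (φ.chart C.str i)) (hU : IsAffineOpen i.U) {m : ℤ} {f : Γ(P.X, P.proj ⁻¹ᵁ i.U)}
    (hf : P.IsWeight m i.U f) : ∃ a : Γ(C.X, i.U),
      f = φ.laurent i (LaurentPolynomial.C a * LaurentPolynomial.T m) := by
  have hbij := Frame.bijective_laurent hi hU
  obtain ⟨p, rfl⟩ := hbij.2 f
  have h2 := scaleMap_eq_of_isWeight h1 hi hU hf
  refine ⟨p.coeff m, congrArg _ ?_⟩
  ext n
  rw [coeff_C_mul_T]
  split_ifs with h
  · rw [h]
  · have h3 := congrArg (fun p : Γ(P.X, P.proj ⁻¹ᵁ i.U)[T;T⁻¹] => p.coeff n) h2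
    simp only [coeff_scaleMap, coeff_C_mul_T, if_neg h, Units.mul_left_eq_zero] at h3
    have h4 : φ.laurent i (LaurentPolynomial.C (p.coeff n)) = φ.laurent i (LaurentPolynomial.C 0) := by
      rw [Frame.laurent_C, map_zero, map_zero]
      exact h3
    simpa using congrArg (fun p : Γ(C.X, i.U)[T;T⁻¹] => p.coeff 0) (hbij.1 h4)

lemma isWeight_iff_toLaurent (hφ : φ.IsUniversal C.str) (h1 : ∀ i, P.IsWeight 1 i.U (φ.sec i))
    (U : C.X.Opens) [Nonempty U] (m : ℤ) (f : Γ(P.X, P.proj ⁻¹ᵁ U)) :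
    P.IsWeight m U f ↔ ∃ s : C.X.functionField, hφ.toLaurent U f =
      LaurentPolynomial.C s * LaurentPolynomial.T m := by
  constructor
  · intro hf
    -- A single chart suffices, because the expansion over U can be computed on any trivializing
    -- open subset of U.
    obtain ⟨x⟩ := (inferInstance : Nonempty U)
    obtain ⟨i, -, hi, haff, hiso⟩ := hφ.exists_isAffineOpen x.1 x.2
    obtain ⟨a, ha⟩ := exists_laurent_eq_of_isWeight h1 hiso haff (hf.res hi)
    refine ⟨C.X.germToFunctionField i.U a * i.g ^ m, ?_⟩
    rw [hφ.toLaurent_eq hi (Frame.bijective_laurent hiso haff), ha, Frame.localExpansion_laurent,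
      map_mul, LocalGen.scale_C, LocalGen.scale_T, ← mul_assoc, ← map_mul]
  · rintro ⟨s, hs⟩
    refine isWeight_of_cover fun x hx => ?_
    obtain ⟨i, hxi, hi, hi'⟩ := hφ.exists_bijective_laurent x hx
    refine ⟨i.U, hi, hxi, ?_⟩
    rw [hφ.toLaurent_eq hi hi'] at hs
    generalize P.X.presheaf.map (homOfLE (P.proj.preimage_mono hi)).op f = f' at hs
    obtain ⟨p, rfl⟩ := hi'.2 f'
    rw [Frame.localExpansion_laurent] at hs
    have hp : p = LaurentPolynomial.C (p.coeff m) * LaurentPolynomial.T m := by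
      ext n
      rw [coeff_C_mul_T]
      split_ifs with h
      · rw [h]
      · have h3 := congrArg (fun p : C.X.functionField[T;T⁻¹] => p.coeff n) hs
        simp only [LocalGen.scale, coeff_scaleMap, coeff_C_mul_T, if_neg h,
          Units.mul_left_eq_zero] at h3
        exact C.X.germToFunctionField_injective i.U (h3.trans (map_zero _).symm)
    rw [hp, map_mul, Frame.laurent_C, Frame.laurent_T, ← zero_add m]
    refine (isWeight_base i.U _).mul ?_
    rw [zero_add]
    have := isWeight_unit_zpow (f := (φ.isUnit i).unit) (h1 i) m
    rwa [one_mul] at this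

end CircleTorsor

/-! ### Presentations from universal frames -/

/-- The local generator `(h τ^* g)⁻¹` on `τ⁻¹(U)` attached to a local generator `g` on `U`. -/
def LocalGen.conj {C : RealVariety} {L : RatSubsheaf C.X} {h : C.X.functionField}
    (hL : IsCirclePair C L h) (i : LocalGen L) : LocalGen L :=
  ⟨C.conj ⁻¹ᵁ i.U, inferInstance, (h * C.ratConj i.g)⁻¹, hL.isGen_conj i.gen⟩

/-- The unit of a frame attached to the generator `(h τ^* g)⁻¹`. -/
def Frame.conjSec {C : RealVariety} {L : RatSubsheaf C.X} {h : C.X.functionField}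
    {Y : Scheme.{0}} {π : Y ⟶ C.X} (φ : Frame L π) (hL : IsCirclePair C L h) (i : LocalGen L) :
    Γ(Y, π ⁻¹ᵁ C.conj ⁻¹ᵁ i.U) := φ.sec (i.conj hL)

namespace CircleTorsor

variable {C : RealVariety} {P : CircleTorsor C} {L : RatSubsheaf C.X} {h : C.X.functionField}
  {φ : Frame L P.proj}

lemma conj_le (P : CircleTorsor C) (U : C.X.Opens) :
    P.proj ⁻¹ᵁ C.conj ⁻¹ᵁ U ≤ P.conj ⁻¹ᵁ P.proj ⁻¹ᵁ U := by
  rw [← Scheme.Hom.comp_preimage, ← Scheme.Hom.comp_preimage, P.proj_real]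

lemma conjComorphism_apply (U : C.X.Opens) (f : Γ(P.X, P.proj ⁻¹ᵁ U)) : P.conjComorphism U f =
    P.conj.appLE _ _ (P.conj_le U) f := rfl

lemma conj_preimage_mono {U V : C.X.Opens} (hVU : V ≤ U) : C.conj ⁻¹ᵁ V ≤ C.conj ⁻¹ᵁ U :=
  C.conj.preimage_mono hVU

lemma conjComorphism_res {U V : C.X.Opens} (hVU : V ≤ U) (f : Γ(P.X, P.proj ⁻¹ᵁ U)) :
    P.conjComorphism V (P.X.presheaf.map (homOfLE (P.proj.preimage_mono hVU)).op f) =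
      P.X.presheaf.map (homOfLE (P.proj.preimage_mono (conj_preimage_mono hVU))).op
        (P.conjComorphism U f) := by
  rw [conjComorphism_apply, conjComorphism_apply, map_appLE_apply, appLE_map_apply]

lemma conjComorphism_base (U : C.X.Opens) (a : Γ(C.X, U)) :
    P.conjComorphism U (P.proj.app U a) = P.proj.app (C.conj ⁻¹ᵁ U) (C.conj.app U a) := by
  rw [conjComorphism_apply, app_eq_appLE_apply, app_eq_appLE_apply, app_eq_appLE_apply,
    appLE_appLE, appLE_appLE]
  exact appLE_congr_hom P.proj_real _ _ _

/-- The homomorphism `∑ sₘ Tᵐ ↦ ∑ hᵐ τ^*sₘ T⁻ᵐ`. -/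
def conjLaurent (h : C.X.functionField) (hh : h ≠ 0) :
    C.X.functionField[T;T⁻¹] →+* C.X.functionField[T;T⁻¹] :=
  (LaurentPolynomial.invert (R := C.X.functionField) :
    C.X.functionField[T;T⁻¹] →+* C.X.functionField[T;T⁻¹]).comp
      (scaleMap C.ratConj (Units.mk0 h hh))

lemma conjLaurent_C_mul_T (hh : h ≠ 0) (s : C.X.functionField) (m : ℤ) :
    conjLaurent h hh (LaurentPolynomial.C s * LaurentPolynomial.T m) =
      LaurentPolynomial.C (h ^ m * C.ratConj s) * LaurentPolynomial.T (-m) := by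
  rw [conjLaurent, RingHom.comp_apply, map_mul (scaleMap _ _), scaleMap_C, scaleMap_T, ← mul_assoc,
    ← map_mul, Units.val_zpow_eq_zpow_val, Units.val_mk0, mul_comm (C.ratConj s)]
  simp

/-- Both sides are ring homomorphisms in the function, so base functions and the unit c(g) of the
frame suffice. -/
lemma toLaurent_conjComorphism (hL : IsCirclePair C L h) (hφ : φ.IsUniversal C.str)
    (hconj : ∀ i, P.conjComorphism i.U (φ.sec i) * φ.conjSec hL i = 1)
    (U : C.X.Opens) [Nonempty U] (f : Γ(P.X, P.proj ⁻¹ᵁ U)) :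
    hφ.toLaurent (C.conj ⁻¹ᵁ U) (P.conjComorphism U f) =
      conjLaurent h hL.ne_zero (hφ.toLaurent U f) := by
  obtain ⟨i, hi, hi'⟩ := hφ.exists_bijective_laurent' U
  rw [← hφ.toLaurent_res (conj_preimage_mono hi) (P.conjComorphism U f), ← conjComorphism_res hi, ← hφ.toLaurent_res hi f]
  generalize P.X.presheaf.map (homOfLE (P.proj.preimage_mono hi)).op f = f'
  obtain ⟨p, rfl⟩ := hi'.2 f'
  rw [hφ.toLaurent_eq_scale hi']
  have key : ((hφ.toLaurent (C.conj ⁻¹ᵁ i.U)).comp (P.conjComorphism i.U)).comp (φ.laurent i) =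
      (conjLaurent h hL.ne_zero).comp i.scale := by
    apply laurent_ringHom_ext
    · intro a
      simp only [RingHom.comp_apply]
      rw [Frame.laurent_C, conjComorphism_base, hφ.toLaurent_base, LocalGen.scale_C]
      have := conjLaurent_C_mul_T hL.ne_zero (C.X.germToFunctionField i.U a) 0
      rw [LaurentPolynomial.T_zero, neg_zero, LaurentPolynomial.T_zero, mul_one, mul_one, zpow_zero,
        one_mul, C.ratConj_germ] at this
      exact this.symm
    · simp only [RingHom.comp_apply]
      rw [Frame.laurent_T_one, LocalGen.scale_T, conjLaurent_C_mul_T, zpow_one, zpow_one]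
      have h1 := congrArg (hφ.toLaurent (C.conj ⁻¹ᵁ i.U)) (hconj i)
      have h2 : hφ.toLaurent (C.conj ⁻¹ᵁ i.U) (φ.conjSec hL i) =
          LaurentPolynomial.C (i.conj hL).g * LaurentPolynomial.T 1 :=
        hφ.toLaurent_sec (i.conj hL)
      rw [map_mul, map_one] at h1
      -- The hypothesis `hconj` makes σ^*c(g) the inverse of c((h τ^*g)⁻¹), which expands to (h
      -- τ^*g)⁻¹T. So σ^*c(g) must expand to h τ^*g T⁻¹.
      refine (LaurentPolynomial.isUnit_T 1).mul_right_cancel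
        ((isUnit_iff_ne_zero.2 (i.conj hL).gen.1).map LaurentPolynomial.C |>.mul_right_cancel ?_)
      rw [mul_assoc, mul_comm (LaurentPolynomial.T 1), ← h2]
      refine h1.trans ?_
      rw [mul_assoc, mul_assoc, ← mul_assoc (LaurentPolynomial.T _), ← LaurentPolynomial.T_add,
        neg_add_cancel, LaurentPolynomial.T_zero, one_mul, ← map_mul, ← map_one LaurentPolynomial.C]
      exact congrArg _ (mul_inv_cancel₀ (mul_ne_zero hL.ne_zero (ratConj_ne_zero i.gen.1))).symm
  exact congrArg (fun f => f p) key

/-- A universal frame of weight one that is compatible with the real structures gives a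
presentation. -/
theorem isDeterminedBy_of_frame (hL : IsCirclePair C L h) (hφ : φ.IsUniversal C.str)
    (h1 : ∀ i, P.IsWeight 1 i.U (φ.sec i))
    (hconj : ∀ i, P.conjComorphism i.U (φ.sec i) * φ.conjSec hL i = 1) :
    P.IsDeterminedBy L h :=
  ⟨{ toLaurent := hφ.toLaurent
     injective := hφ.toLaurent_injective
     mem_range_iff := hφ.mem_range_toLaurent_iff
     restrict := hφ.toLaurent_res
     base := hφ.toLaurent_base
     weight := isWeight_iff_toLaurent hφ h1
     conj := fun U _ m f s hs => by
       rw [toLaurent_conjComorphism hL hφ hconj, hs, conjLaurent_C_mul_T] }⟩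

end CircleTorsor

/-! ### Operations on frames -/

namespace Frame

section Smul

variable {X : Scheme.{0}} [IsIntegral X] {L : RatSubsheaf X} {Y Z : Scheme.{0}} {π : Y ⟶ X}

/-- The multiplication of a frame by a morphism to `Gm`. -/
def smul (φ : Frame L π) (F : Y ⟶ Gm) : Frame L π where
  sec i := Gm.coord F _ * φ.sec i
  isUnit i := (Gm.isUnit_coord F _).mul (φ.isUnit i)
  compat {i j} h := by
    rw [map_mul, Gm.map_coord, φ.compat h, mul_left_comm]

lemma smul_sec (φ : Frame L π) (F : Y ⟶ Gm) (i : LocalGen L) :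
    (φ.smul F).sec i = Gm.coord F _ * φ.sec i := rfl

lemma pull_smul (φ : Frame L π) (F : Y ⟶ Gm) (n : Z ⟶ Y) {κ : Z ⟶ X} (hn : n ≫ π = κ) :
    (φ.smul F).pull n hn = (φ.pull n hn).smul (n ≫ F) := by
  apply Frame.ext
  funext i
  refine (map_mul (n.appLE _ _ (preimage_le_of_comp hn i.U)).hom _ _).trans ?_
  exact congrArg (· * _) (Gm.appLE_coord n F (preimage_le_of_comp hn i.U))

lemma smul_one (φ : Frame L π) (p : Y ⟶ Spec (.of ℂ)) : φ.smul (p ≫ Gm.one) = φ := by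
  apply Frame.ext
  funext i
  rw [smul_sec, Gm.coord_one, one_mul]

lemma smul_lift_mul (φ : Frame L π) (F G : Y ⟶ Gm) (h : F ≫ Gm.str = G ≫ Gm.str) :
    φ.smul (pullback.lift F G h ≫ Gm.mul) = (φ.smul G).smul F := by
  apply Frame.ext
  funext i
  rw [smul_sec, smul_sec, smul_sec, Gm.coord_lift_mul, mul_assoc]

lemma pull_sec (φ : Frame L π) (n : Z ⟶ Y) {κ : Z ⟶ X} (hn : n ≫ π = κ) (i : LocalGen L) :
    (φ.pull n hn).sec i = n.appLE _ _ (preimage_le_of_comp hn i.U) (φ.sec i) := rfl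

lemma pull_id (φ : Frame L π) : φ.pull (𝟙 Y) (Category.id_comp π) = φ := by
  apply Frame.ext
  funext i
  have := map_eq_appLE (le_refl (π ⁻¹ᵁ i.U)) (φ.sec i)
  refine this.symm.trans ?_
  have h2 : (homOfLE (le_refl (π ⁻¹ᵁ i.U))).op = 𝟙 _ := rfl
  rw [h2, CategoryTheory.Functor.map_id]
  rfl

end Smul

section Conj

variable {C : RealVariety} {L : RatSubsheaf C.X} {h : C.X.functionField}
  {Y Z : Scheme.{0}} {π : Y ⟶ C.X}

lemma isUnit_conjSec (φ : Frame L π) (hL : IsCirclePair C L h) (i : LocalGen L) :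
    IsUnit (φ.conjSec hL i) := φ.isUnit (i.conj hL)

/-- The assignment g ↦ (h τ^*g)⁻¹ inverts ratios besides conjugating them. This is why the conjugate
frame takes inverses of units: linearity in g is restored, relative to the projection followed by τ.
-/
lemma conjSec_compat (φ : Frame L π) (hL : IsCirclePair C L h) {i j : LocalGen L} (hij : i ≤ j) :
    ∃ c : Γ(C.X, C.conj ⁻¹ᵁ i.U), c * C.conj.app i.U (LocalGen.ratio hij) = 1 ∧
      Y.presheaf.map (homOfLE (π.preimage_mono (C.conj.preimage_mono (LocalGen.le_U hij)))).op
        (φ.conjSec hL j) = π.app _ c * φ.conjSec hL i := by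
  have hc : i.conj hL ≤ j.conj hL := C.conj.preimage_mono (LocalGen.le_U hij)
  obtain ⟨c, hc1, hc2⟩ : ∃ c : Γ(C.X, C.conj ⁻¹ᵁ i.U),
      C.X.germToFunctionField (C.conj ⁻¹ᵁ i.U) c =
        (h * C.ratConj j.g)⁻¹ * (h * C.ratConj i.g)⁻¹⁻¹ ∧
      Y.presheaf.map (homOfLE (π.preimage_mono (C.conj.preimage_mono (LocalGen.le_U hij)))).op
        (φ.conjSec hL j) = π.app _ c * φ.conjSec hL i :=
    ⟨LocalGen.ratio hc, LocalGen.germ_ratio hc, φ.compat hc⟩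
  refine ⟨c, ?_, hc2⟩
  apply C.X.germToFunctionField_injective (C.conj ⁻¹ᵁ i.U)
  rw [map_mul, map_one, hc1]
  have e1 : C.X.germToFunctionField (C.conj ⁻¹ᵁ i.U) (C.conj.app i.U (LocalGen.ratio hij)) =
      C.ratConj (j.g * i.g⁻¹) :=
    (C.ratConj_germ _ _).symm.trans (congrArg _ (LocalGen.germ_ratio hij))
  rw [e1]
  have h1 := ratConj_ne_zero i.gen.1
  have h2 := ratConj_ne_zero j.gen.1
  have h3 := hL.ne_zero
  simp only [map_mul, map_inv₀]
  field_simp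

/-- The inverse of the unit of a frame attached to the generator `(h τ^* g)⁻¹`. -/
def conjInv (φ : Frame L π) (hL : IsCirclePair C L h) (i : LocalGen L) :
    Γ(Y, π ⁻¹ᵁ C.conj ⁻¹ᵁ i.U) := ((φ.isUnit_conjSec hL i).unit⁻¹ : _ˣ)

lemma conjSec_mul_conjInv (φ : Frame L π) (hL : IsCirclePair C L h) (i : LocalGen L) :
    φ.conjSec hL i * φ.conjInv hL i = 1 := by
  have hi := (φ.isUnit_conjSec hL i).unit.mul_inv
  rw [IsUnit.unit_spec] at hi
  exact hi

lemma conjInv_eq (φ : Frame L π) (hL : IsCirclePair C L h) (i : LocalGen L)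
    {c : Γ(Y, π ⁻¹ᵁ C.conj ⁻¹ᵁ i.U)} (hc : φ.conjSec hL i * c = 1) : φ.conjInv hL i = c :=
  (φ.isUnit_conjSec hL i).mul_left_cancel ((φ.conjSec_mul_conjInv hL i).trans hc.symm)

lemma conjInv_compat (φ : Frame L π) (hL : IsCirclePair C L h) {i j : LocalGen L} (hij : i ≤ j) :
    Y.presheaf.map (homOfLE (π.preimage_mono (C.conj.preimage_mono (LocalGen.le_U hij)))).op
        (φ.conjInv hL j) =
      π.app _ (C.conj.app i.U (LocalGen.ratio hij)) * φ.conjInv hL i := by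
  obtain ⟨c, hc, hcij⟩ := φ.conjSec_compat hL hij
  have hi := φ.conjSec_mul_conjInv hL i
  have hj := congrArg (Y.presheaf.map (homOfLE (π.preimage_mono
    (C.conj.preimage_mono (LocalGen.le_U hij)))).op) (φ.conjSec_mul_conjInv hL j)
  rw [map_mul, map_one, hcij] at hj
  have hc' := congrArg (π.app (C.conj ⁻¹ᵁ i.U)) hc
  rw [map_mul, map_one] at hc'
  have key : ∀ {R : Type} [CommRing R] (c c' A B r : R), c * A * r = 1 → c * c' = 1 → A * B = 1 →
      r = c' * B := fun c c' A B r h1 h2 h3 => by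
    linear_combination c' * B * h1 - r * A * B * h2 - r * h3
  exact key _ _ _ _ _ hj hc' hi

/-- The conjugate of a frame. -/
def conjFrame (φ : Frame L π) (hL : IsCirclePair C L h) : Frame L (π ≫ C.conj) where
  sec i := φ.conjInv hL i
  isUnit i := ((φ.isUnit_conjSec hL i).unit⁻¹).isUnit
  compat {i j} hij := by
    refine (φ.conjInv_compat hL hij).trans ?_
    rw [Scheme.Hom.comp_app]
    rfl

lemma ext_conjFrame {φ : Frame L π} {hL : IsCirclePair C L h} {ψ : Frame L (π ≫ C.conj)}
    (hψ : ∀ i, φ.conjInv hL i = ψ.sec i) : φ.conjFrame hL = ψ :=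
  Frame.ext (funext hψ)

lemma pull_conjFrame (φ : Frame L π) (hL : IsCirclePair C L h) (n : Z ⟶ Y) {κ : Z ⟶ C.X}
    (hn : n ≫ π = κ) (hn' : n ≫ π ≫ C.conj = κ ≫ C.conj) :
    (φ.conjFrame hL).pull n hn' = (φ.pull n hn).conjFrame hL := by
  refine (ext_conjFrame fun i => ?_).symm
  have e1 : ((φ.conjFrame hL).pull n hn').sec i =
      n.appLE _ _ (preimage_le_of_comp hn (C.conj ⁻¹ᵁ i.U)) (φ.conjInv hL i) := rfl
  have e2 : (φ.pull n hn).conjSec hL i =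
      n.appLE _ _ (preimage_le_of_comp hn (C.conj ⁻¹ᵁ i.U)) (φ.conjSec hL i) := rfl
  have e3 := congrArg (n.appLE _ _ (preimage_le_of_comp hn (C.conj ⁻¹ᵁ i.U)))
    (φ.conjSec_mul_conjInv hL i)
  rw [map_mul, map_one, ← e2] at e3
  exact (conjInv_eq _ hL i e3).trans e1.symm

/-- Inverting the units of the frame turns the factor u into u⁻¹, which is the coordinate after σ₀.
This becomes the axiom σ ∘ μ = μ ∘ (σ₀ × σ). -/
lemma smul_conjFrame (φ : Frame L π) (hL : IsCirclePair C L h) (F : Y ⟶ Gm) :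
    (φ.smul F).conjFrame hL = (φ.conjFrame hL).smul (F ≫ Gm.circleConj) := by
  refine ext_conjFrame fun i => ?_
  let u : Γ(Y, π ⁻¹ᵁ C.conj ⁻¹ᵁ i.U)ˣ := (Gm.isUnit_coord F (π ⁻¹ᵁ C.conj ⁻¹ᵁ i.U)).unit
  have h2 : Gm.coord F (π ⁻¹ᵁ C.conj ⁻¹ᵁ i.U) = u := (IsUnit.unit_spec _).symm
  have h1 := Gm.coord_circleConj F _ u h2
  have h4 : (φ.smul F).conjSec hL i = u * φ.conjSec hL i := congrArg (· * _) h2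
  refine Eq.trans (conjInv_eq (c := ((u⁻¹ : _ˣ) : Γ(Y, π ⁻¹ᵁ C.conj ⁻¹ᵁ i.U)) * φ.conjInv hL i)
    _ hL i ?_) (congrArg (· * φ.conjInv hL i) h1.symm)
  rw [h4]
  have key : ∀ {R : Type} [CommRing R] (u v A B : R), u * v = 1 → A * B = 1 →
      u * A * (v * B) = 1 := fun u v A B h1 h2 => by
    linear_combination A * B * h1 + h2
  exact key _ _ _ _ u.mul_inv (φ.conjSec_mul_conjInv hL i)

/-- Applying g ↦ (h τ^*g)⁻¹ twice returns g because τ^*h = h, and the two inversions of units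
cancel. This becomes σ ∘ σ = 1. -/
lemma conjFrame_conjFrame (φ : Frame L π) (hL : IsCirclePair C L h) :
    (φ.conjFrame hL).conjFrame hL = φ.pull (𝟙 Y)
      (by rw [Category.id_comp, Category.assoc, C.conj_conj, Category.comp_id]) := by
  refine ext_conjFrame fun i => ?_
  have hi : (i.conj hL).conj hL ≤ i := fun x hx => by
    have hx' : (C.conj ≫ C.conj) x ∈ i.U := hx
    rw [C.conj_conj] at hx'
    exact hx'
  have h1 : LocalGen.ratio hi = 1 := by
    apply C.X.germToFunctionField_injective ((i.conj hL).conj hL).U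
    rw [map_one]
    refine (LocalGen.germ_ratio hi).trans ?_
    change i.g * ((h * C.ratConj (h * C.ratConj i.g)⁻¹)⁻¹)⁻¹ = 1
    have e1 := hL.ne_zero
    have e2 := i.gen.1
    rw [map_inv₀, map_mul, C.ratConj_ratConj, hL.real]
    field_simp
  have h2 := φ.compat hi
  rw [h1, map_one, one_mul] at h2
  have h3 := φ.conjSec_mul_conjInv hL (i.conj hL)
  have h5 : φ.conjSec hL (i.conj hL) = φ.sec ((i.conj hL).conj hL) := rfl
  have h4 : (φ.conjFrame hL).conjSec hL i = φ.conjInv hL (i.conj hL) := rfl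
  refine (conjInv_eq (c := φ.conjSec hL (i.conj hL)) _ hL i ?_).trans ?_
  · exact (mul_comm _ _).trans h3
  · exact h2.symm.trans (map_eq_appLE _ _)

end Conj

end Frame

/-! ### The torsor of a pair -/

section

variable {C : RealVariety} {L : RatSubsheaf C.X} {h : C.X.functionField} {P : CircleTorsor C}
  {φ : Frame L P.proj}

/-- Like `conjComorphism_sec_iff`, this turns a condition on sections into an equality of frames,
the form to which universality applies. -/
lemma CircleTorsor.isWeight_sec_iff : (∀ i, P.IsWeight 1 i.U (φ.sec i)) ↔
    φ.pull P.action.act P.act_proj =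
      (φ.pull (pullback.snd Gm.str P.str) rfl).smul (pullback.fst Gm.str P.str) := by
  refine ⟨fun h1 => Frame.ext (funext fun i => ?_), fun h1 i => ?_⟩
  · have h2 := CircleTorsor.isWeight_one_iff.1 (h1 i)
    rw [mul_comm, app_eq_appLE_apply] at h2
    exact h2
  · rw [CircleTorsor.isWeight_one_iff, mul_comm, app_eq_appLE_apply]
    exact congrArg (fun ψ => ψ.sec i) h1

lemma CircleTorsor.conjComorphism_sec_iff (hL : IsCirclePair C L h) :
    (∀ i, P.conjComorphism i.U (φ.sec i) * φ.conjSec hL i = 1) ↔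
      φ.pull P.conj P.proj_real = φ.conjFrame hL := by
  refine ⟨fun h1 => (Frame.ext_conjFrame fun i => ?_).symm, fun h1 i => ?_⟩
  · have e := Frame.conjInv_eq φ hL i ((mul_comm _ _).trans (h1 i))
    exact e
  have h2 : P.conjComorphism i.U (φ.sec i) = φ.conjInv hL i := congrArg (fun ψ => ψ.sec i) h1
  rw [h2, mul_comm, Frame.conjSec_mul_conjInv]

end

lemma exists_eq_pullback_map {X Y S X' Y' S' : Scheme.{0}} (f : X ⟶ S) (g : Y ⟶ S) (f' : X' ⟶ S')
    (g' : Y' ⟶ S') (a : X ⟶ X') (b : Y ⟶ Y') (c : S ⟶ S') (h : f ≫ c = a ≫ f')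
    (h' : g ≫ c = b ≫ g') : ∃ m, m = pullback.map f g f' g' a b c h h' ∧
      m ≫ pullback.fst _ _ = pullback.fst _ _ ≫ a ∧ m ≫ pullback.snd _ _ = pullback.snd _ _ ≫ b :=
  ⟨_, rfl, pullback.lift_fst _ _ _, pullback.lift_snd _ _ _⟩

lemma Frame.pull_inv_chart_sec {X P : Scheme.{0}} [IsIntegral X] {L : RatSubsheaf X} {ρ : P ⟶ X}
    {q : X ⟶ Spec (.of ℂ)} {φ : Frame L ρ} {i : LocalGen L} (hi : IsIso (φ.chart q i))
    {π : pullback Gm.str (i.U.ι ≫ q) ⟶ X}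
    (hπ : (inv (φ.chart q i) ≫ (ρ ⁻¹ᵁ i.U).ι) ≫ ρ = π) :
    (φ.pull (inv (φ.chart q i) ≫ (ρ ⁻¹ᵁ i.U).ι) hπ).sec i = Gm.coord (pullback.fst _ _) _ := by
  have h1 : pullback.fst Gm.str (i.U.ι ≫ q) = inv (φ.chart q i) ≫
      toGmOn (ρ ≫ q) (ρ ⁻¹ᵁ i.U) (φ.sec i) (φ.isUnit i) := by
    rw [← chart_fst, IsIso.inv_hom_id_assoc]
  have h2 : (⊤ : (ρ ⁻¹ᵁ i.U).toScheme.Opens) ≤ (ρ ⁻¹ᵁ i.U).ι ⁻¹ᵁ (ρ ⁻¹ᵁ i.U) :=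
    (ρ ⁻¹ᵁ i.U).ι_preimage_self.ge
  rw [h1, ← Gm.appLE_coord (V := ⊤) _ _ (le_preimage_top _ _), coord_toGmOn _ _ _ _ _ h2,
    appLE_appLE]
  rfl

/-- The universal frame φ defines all the structure. Each axiom equates two morphisms to P over the
same morphism to C, and is proved by checking that they pull φ back to the same frame. -/
theorem exists_torsor_of_isCirclePair {C : RealVariety} {L : RatSubsheaf C.X}
    {h : C.X.functionField} (hL : IsCirclePair C L h) :
    ∃ P : CircleTorsor C, P.IsDeterminedBy L h := by
  obtain ⟨P, ρ, φ, hiso⟩ := exists_universal_frame C.str hL.invertible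
  have hφ : φ.IsUniversal C.str := fun x => by
    obtain ⟨U, hxU, g, hg⟩ := RatSubsheaf.isInvertible_iff.1 hL.invertible x
    exact ⟨⟨U, ⟨⟨x, hxU⟩⟩, g, hg⟩, hxU, hiso _⟩
  have hint := hφ.isIntegral
  have hft := hφ.locallyOfFiniteType
  have hqc := hφ.quasiCompact
  -- The conjugate frame lives over ρ followed by τ, so the morphism that it defines lifts τ.
  obtain ⟨σ, hσρ, hσ⟩ := hφ.exists_pull_eq (φ.conjFrame hL)
  set str := ρ ≫ C.str with hstr
  obtain ⟨act, hactρ, hact⟩ := hφ.exists_pull_eq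
    ((φ.pull (pullback.snd Gm.str str) rfl).smul (pullback.fst Gm.str str))
  have hσσ : σ ≫ σ = 𝟙 P := by
    have e1 : (σ ≫ σ) ≫ ρ = (ρ ≫ C.conj) ≫ C.conj := by
      rw [Category.assoc, hσρ, reassoc_of% hσρ, Category.assoc]
    refine hφ.hom_ext (π := (ρ ≫ C.conj) ≫ C.conj) e1
      (by rw [Category.id_comp, Category.assoc, C.conj_conj, Category.comp_id]) ?_
    rw [← Frame.conjFrame_conjFrame φ hL, ← hσ, ← Frame.pull_conjFrame φ hL σ hσρ
      (by rw [← Category.assoc, hσρ]), ← hσ]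
    exact (Frame.pull_pull φ σ hσρ σ _).symm
  let V : RealVariety :=
    { X := P
      str := str
      locallyOfFiniteType := by rw [hstr]; infer_instance
      quasiCompact := by rw [hstr]; infer_instance
      conj := σ
      conj_conj := hσσ
      conj_str := by rw [hstr, reassoc_of% hσρ, Category.assoc, C.conj_str] }
  -- The rule for computing with points: the frame at s·p is s times the frame at p.
  have hmulact : ∀ {Z : Scheme.{0}} (m : Z ⟶ pullback Gm.str str) {κ : Z ⟶ C.X}
      (hm : m ≫ act ≫ ρ = κ) (hm' : m ≫ pullback.snd _ _ ≫ ρ = κ),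
      φ.pull (m ≫ act) (by rw [Category.assoc, hm]) =
        (φ.pull (m ≫ pullback.snd _ _) (by rw [Category.assoc, hm'])).smul
          (m ≫ pullback.fst _ _) := by
    intro Z m κ hm hm'
    rw [← Frame.pull_pull φ act hactρ m hm', hact, Frame.pull_smul, Frame.pull_pull]
  have hactstr : act ≫ str = pullback.snd _ _ ≫ str := by
    have e : act ≫ ρ ≫ C.str = pullback.snd Gm.str str ≫ ρ ≫ C.str := by rw [reassoc_of% hactρ]
    exact e
  have hone : pullback.lift (str ≫ Gm.one) (𝟙 P)
      (by rw [Category.assoc, Gm.one_str, Category.comp_id, Category.id_comp]) ≫ act = 𝟙 P := by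
    refine hφ.hom_ext (π := ρ) (by rw [Category.assoc, hactρ, pullback.lift_snd_assoc,
      Category.id_comp]) (Category.id_comp _) ?_
    rw [hmulact _ (by rw [hactρ, pullback.lift_snd_assoc, Category.id_comp])
      (by rw [pullback.lift_snd_assoc, Category.id_comp])]
    rw [Frame.pull_congr φ (pullback.lift_snd _ _ _) _ (Category.id_comp _), pullback.lift_fst,
      Frame.smul_one]
  have hmul : Gm.translate str ≫ act =
      pullback.map Gm.str (pullback.snd Gm.str str ≫ str) Gm.str str (𝟙 Gm) act (𝟙 _)
        (by simp) (by rw [hactstr, Category.comp_id]) ≫ act := by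
    have e0 : Gm.translate str ≫ pullback.snd _ _ = pullback.snd _ _ ≫ pullback.snd _ _ :=
      pullback.lift_snd _ _ _
    have e1 : Gm.translate str ≫ pullback.fst _ _ = pullback.lift (pullback.fst _ _)
        (pullback.snd _ _ ≫ pullback.fst _ _)
        (by rw [pullback.condition, Category.assoc, pullback.condition]) ≫ Gm.mul :=
      pullback.lift_fst _ _ _
    obtain ⟨m, hm, hm1, hm2⟩ := exists_eq_pullback_map Gm.str (pullback.snd Gm.str str ≫ str) Gm.str
      str (𝟙 Gm) act (𝟙 _) (by simp) (by rw [hactstr, Category.comp_id])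
    rw [Category.comp_id] at hm1
    rw [← hm]
    have e2 : Gm.translate str ≫ act ≫ ρ = pullback.snd _ _ ≫ pullback.snd _ _ ≫ ρ := by
      rw [hactρ, reassoc_of% e0]
    have e3' : m ≫ pullback.snd _ _ ≫ ρ = pullback.snd _ _ ≫ pullback.snd _ _ ≫ ρ := by
      rw [reassoc_of% hm2, hactρ]
    have e3 : m ≫ act ≫ ρ = pullback.snd _ _ ≫ pullback.snd _ _ ≫ ρ := by
      rw [hactρ, e3']
    have e4 : (pullback.snd Gm.str (pullback.snd Gm.str str ≫ str) ≫ act) ≫ ρ =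
        pullback.snd _ _ ≫ pullback.snd _ _ ≫ ρ := by rw [Category.assoc, hactρ]
    refine hφ.hom_ext (π := pullback.snd _ _ ≫ pullback.snd _ _ ≫ ρ)
      (by rw [Category.assoc, e2]) (by rw [Category.assoc, e3]) ?_
    rw [hmulact _ e2 (by rw [reassoc_of% e0]), hmulact m e3 e3', e1,
      Frame.smul_lift_mul, hm1, Frame.pull_congr φ hm2 _ e4,
      hmulact (pullback.snd _ _) (by rw [hactρ]) rfl,
      Frame.pull_congr φ e0 _ (Category.assoc _ _ _)]
  have hreal : act ≫ σ =
      pullback.map Gm.str str Gm.str str Gm.circleConj σ specConj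
        Gm.circleConj_str.symm V.conj_str.symm ≫ act := by
    obtain ⟨m, hm, hm1, hm2⟩ := exists_eq_pullback_map Gm.str str Gm.str str Gm.circleConj σ specConj
      Gm.circleConj_str.symm V.conj_str.symm
    rw [← hm]
    have e2 : act ≫ ρ ≫ C.conj = (pullback.snd _ _ ≫ ρ) ≫ C.conj := by
      rw [reassoc_of% hactρ, Category.assoc]
    have e3' : m ≫ pullback.snd _ _ ≫ ρ = (pullback.snd _ _ ≫ ρ) ≫ C.conj := by
      rw [reassoc_of% hm2, hσρ, Category.assoc]
    have e3 : m ≫ act ≫ ρ = (pullback.snd _ _ ≫ ρ) ≫ C.conj := by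
      rw [hactρ, e3']
    have e4 : (pullback.snd Gm.str str ≫ σ) ≫ ρ = (pullback.snd _ _ ≫ ρ) ≫ C.conj := by
      rw [Category.assoc, hσρ, Category.assoc]
    refine hφ.hom_ext (π := (pullback.snd _ _ ≫ ρ) ≫ C.conj)
      (by rw [Category.assoc, hσρ, e2]) (by rw [Category.assoc, e3]) ?_
    rw [hmulact m e3 e3', hm1, Frame.pull_congr φ hm2 _ e4,
      ← Frame.pull_pull φ σ hσρ act e2, hσ, Frame.pull_conjFrame φ hL act hactρ, hact,
      Frame.smul_conjFrame, ← Frame.pull_conjFrame φ hL _ rfl (Category.assoc _ _ _).symm, ← hσ,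
      Frame.pull_pull]
  let A : CircleAction V :=
    { act := act
      act_str := hactstr
      one_act := hone
      mul_act := hmul
      real := hreal }
  let T : CircleTorsor C :=
    { toRealVariety := V
      action := A
      proj := ρ
      proj_str := rfl
      proj_real := hσρ
      act_proj := hactρ
      locally_trivial := fun x => by
        obtain ⟨i, hxi, hi⟩ := hφ x
        -- The trivialization is the inverse chart. Everything lies over U, so frames need only be
        -- compared at the generator i, where the unit is the coordinate of Gm.
        refine ⟨i.U, hxi, (asIso (φ.chart C.str i)).symm, ?_⟩
        obtain ⟨k, hk⟩ : ∃ k, k = inv (φ.chart C.str i) ≫ (ρ ⁻¹ᵁ i.U).ι := ⟨_, rfl⟩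
        have hkρ : k ≫ ρ = pullback.snd _ _ ≫ i.U.ι := by
          rw [hk, Category.assoc, IsIso.inv_comp_eq, ← Category.assoc, Frame.chart_snd,
            morphismRestrict_ι]
        have hkstr : k ≫ str = pullback.snd _ _ ≫ i.U.ι ≫ C.str := by
          rw [hstr, reassoc_of% hkρ]
        have hksec : (φ.pull k hkρ).sec i = Gm.coord (pullback.fst _ _) _ := by
          subst hk
          exact Frame.pull_inv_chart_sec hi hkρ
        have key : Gm.translate (i.U.ι ≫ C.str) ≫ k =
            pullback.map Gm.str (pullback.snd Gm.str (i.U.ι ≫ C.str) ≫ i.U.ι ≫ C.str) Gm.str str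
            (𝟙 Gm) k (𝟙 _) (by simp) (by rw [hkstr, Category.comp_id]) ≫ act := by
          obtain ⟨m, hm, hm1, hm2⟩ := exists_eq_pullback_map Gm.str
            (pullback.snd Gm.str (i.U.ι ≫ C.str) ≫ i.U.ι ≫ C.str) Gm.str str
            (𝟙 Gm) k (𝟙 _) (by simp) (by rw [hkstr, Category.comp_id])
          rw [Category.comp_id] at hm1
          rw [← hm]
          have e0 : Gm.translate (i.U.ι ≫ C.str) ≫ pullback.snd _ _ =
              pullback.snd _ _ ≫ pullback.snd _ _ := pullback.lift_snd _ _ _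
          have e1 : Gm.translate (i.U.ι ≫ C.str) ≫ pullback.fst _ _ =
              pullback.lift (pullback.fst _ _) (pullback.snd _ _ ≫ pullback.fst _ _)
              (by rw [pullback.condition, Category.assoc, pullback.condition]) ≫ Gm.mul :=
            pullback.lift_fst _ _ _
          have e2 : Gm.translate (i.U.ι ≫ C.str) ≫ pullback.snd _ _ ≫ i.U.ι =
              pullback.snd _ _ ≫ pullback.snd _ _ ≫ i.U.ι := by rw [reassoc_of% e0]
          have e3' : m ≫ pullback.snd _ _ ≫ ρ = pullback.snd _ _ ≫ pullback.snd _ _ ≫ i.U.ι := by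
            rw [reassoc_of% hm2, hkρ]
          have e3 : m ≫ act ≫ ρ = pullback.snd _ _ ≫ pullback.snd _ _ ≫ i.U.ι := by
            rw [hactρ, e3']
          have e4 : (pullback.snd Gm.str (pullback.snd Gm.str (i.U.ι ≫ C.str) ≫ i.U.ι ≫ C.str) ≫
              k) ≫ ρ = pullback.snd _ _ ≫ pullback.snd _ _ ≫ i.U.ι := by
            rw [Category.assoc, hkρ]
          refine hφ.hom_ext (π := pullback.snd _ _ ≫ pullback.snd _ _ ≫ i.U.ι)
            (by rw [Category.assoc, hkρ, e2]) (by rw [Category.assoc, e3]) ?_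
          rw [hmulact m e3 e3', hm1, Frame.pull_congr φ hm2 _ e4, ← Frame.pull_pull φ k hkρ _ e2,
            ← Frame.pull_pull φ k hkρ _ rfl]
          refine Frame.ext_of_cover fun y => ⟨i, ?_, ?_⟩
          · exact (pullback.snd Gm.str (i.U.ι ≫ C.str) (pullback.snd Gm.str
              (pullback.snd Gm.str (i.U.ι ≫ C.str) ≫ i.U.ι ≫ C.str) y)).2
          · rw [Frame.smul_sec, Frame.pull_sec (φ.pull k hkρ), Frame.pull_sec (φ.pull k hkρ), hksec, Gm.appLE_coord,
              Gm.appLE_coord, e1, Gm.coord_lift_mul]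
        subst hk
        exact ⟨(Category.assoc _ _ _).symm.trans hkρ, hkstr, key⟩ }
  exact ⟨T, CircleTorsor.isDeterminedBy_of_frame (P := T) hL hφ
    (CircleTorsor.isWeight_sec_iff.2 hact) ((CircleTorsor.conjComorphism_sec_iff hL).2 hσ)⟩

/-! ### Weights on points, and functions of weight zero -/

namespace CircleTorsor

variable {C : RealVariety} {P : CircleTorsor C}

section Points

variable {Z : Scheme.{0}} (s : Z ⟶ Gm) (p : Z ⟶ P.X) (hs : s ≫ Gm.str = p ≫ P.str)

/-- The action on points. -/
def actPt : Z ⟶ P.X := pullback.lift s p hs ≫ P.action.act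

lemma actPt_proj : P.actPt s p hs ≫ P.proj = p ≫ P.proj := by
  rw [actPt, Category.assoc, P.act_proj, pullback.lift_snd_assoc]

lemma actPt_le {V : C.X.Opens} (hV : ⊤ ≤ p ⁻¹ᵁ P.proj ⁻¹ᵁ V) :
    ⊤ ≤ P.actPt s p hs ⁻¹ᵁ P.proj ⁻¹ᵁ V := by
  rw [← Scheme.Hom.comp_preimage, actPt_proj, Scheme.Hom.comp_preimage]
  exact hV

lemma comp_actPt {W : Scheme.{0}} (n : W ⟶ Z) : n ≫ P.actPt s p hs =
    P.actPt (n ≫ s) (n ≫ p) (by rw [Category.assoc, hs, Category.assoc]) := by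
  rw [actPt, actPt, ← Category.assoc]
  congr 1
  apply pullback.hom_ext
  · rw [Category.assoc, pullback.lift_fst, pullback.lift_fst]
  · rw [Category.assoc, pullback.lift_snd, pullback.lift_snd]

lemma actPt_conj : P.actPt s p hs ≫ P.conj = P.actPt (s ≫ Gm.circleConj) (p ≫ P.conj)
    (by rw [Category.assoc, Gm.circleConj_str, reassoc_of% hs, Category.assoc, P.conj_str]) := by
  rw [actPt, actPt, Category.assoc, P.action.real]
  obtain ⟨m, hm, hm1, hm2⟩ := exists_eq_pullback_map Gm.str P.str Gm.str P.str Gm.circleConj P.conj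
      specConj Gm.circleConj_str.symm P.conj_str.symm
  rw [← hm, ← Category.assoc]
  congr 1
  apply pullback.hom_ext
  · rw [Category.assoc, hm1, pullback.lift_fst_assoc, pullback.lift_fst]
  · rw [Category.assoc, hm2, pullback.lift_snd_assoc, pullback.lift_snd]

lemma IsWeight.actPt {m : ℤ} {V : C.X.Opens} {f : Γ(P.X, P.proj ⁻¹ᵁ V)} (hf : P.IsWeight m V f)
    (hV : ⊤ ≤ p ⁻¹ᵁ P.proj ⁻¹ᵁ V) : (P.actPt s p hs).appLE _ ⊤ (actPt_le s p hs hV) f =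
      p.appLE _ ⊤ hV f * (((Gm.isUnit_coord s ⊤).unit ^ m : Γ(Z, ⊤)ˣ) : Γ(Z, ⊤)) := by
  have hN : ⊤ ≤ pullback.lift s p hs ⁻¹ᵁ (pullback.snd Gm.str P.str ⁻¹ᵁ P.proj ⁻¹ᵁ V) := by
    rw [← Scheme.Hom.comp_preimage, pullback.lift_snd]
    exact hV
  have h1 := congrArg ((pullback.lift s p hs).appLE _ ⊤ hN) (isWeight_iff.1 hf)
  rw [appLE_appLE, map_mul, app_eq_appLE_apply, appLE_appLE] at h1
  refine h1.trans (congrArg₂ (· * ·) (appLE_congr_hom (pullback.lift_snd _ _ _) _ _ _) ?_)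
  have e1 : Units.map ((pullback.lift s p hs).appLE _ ⊤ hN).hom.toMonoidHom (P.coordUnit V) =
      (Gm.isUnit_coord s ⊤).unit := Units.ext (by
    rw [IsUnit.unit_spec]
    refine (congrArg ((pullback.lift s p hs).appLE _ ⊤ hN) (P.coordUnit_val V)).trans ?_
    rw [Gm.appLE_coord, pullback.lift_fst])
  rw [← e1, ← map_zpow]
  rfl

end Points

/-- The definition of weight is the case of the universal pair (s, p), with Z the open subset Gm ×
ρ⁻¹(V). -/
lemma isWeight_of_actPt {m : ℤ} {V : C.X.Opens} {f : Γ(P.X, P.proj ⁻¹ᵁ V)}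
    (h : ∀ {Z : Scheme.{0}} (s : Z ⟶ Gm) (p : Z ⟶ P.X) (hs : s ≫ Gm.str = p ≫ P.str)
      (hV : ⊤ ≤ p ⁻¹ᵁ P.proj ⁻¹ᵁ V), (P.actPt s p hs).appLE _ ⊤ (actPt_le s p hs hV) f =
      p.appLE _ ⊤ hV f * (((Gm.isUnit_coord s ⊤).unit ^ m : Γ(Z, ⊤)ˣ) : Γ(Z, ⊤))) :
    P.IsWeight m V f := by
  rw [isWeight_iff]
  obtain ⟨N, hN⟩ : ∃ N, N = pullback.snd Gm.str P.str ⁻¹ᵁ P.proj ⁻¹ᵁ V := ⟨_, rfl⟩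
  have hNN : (⊤ : N.toScheme.Opens) ≤ N.ι ⁻¹ᵁ (pullback.snd Gm.str P.str ⁻¹ᵁ P.proj ⁻¹ᵁ V) := by
    rw [← hN]
    exact N.ι_preimage_self.ge
  have hinj : Function.Injective (N.ι.appLE (pullback.snd Gm.str P.str ⁻¹ᵁ P.proj ⁻¹ᵁ V) ⊤ hNN) := by
    subst hN
    exact opens_ι_appLE_injective _ hNN rfl
  apply hinj
  have h1 := h (N.ι ≫ pullback.fst _ _) (N.ι ≫ pullback.snd _ _)
    (by rw [Category.assoc, pullback.condition, Category.assoc])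
    (by rw [Scheme.Hom.comp_preimage]; exact hNN)
  rw [appLE_appLE, map_mul, app_eq_appLE_apply, appLE_appLE]
  refine Eq.trans (appLE_congr_hom ?_ _ _ _) (h1.trans (congrArg₂ (· * ·) rfl ?_))
  · rw [actPt]
    congr 1
    apply pullback.hom_ext
    · rw [pullback.lift_fst]
    · rw [pullback.lift_snd]
  · have e1 : Units.map (N.ι.appLE _ ⊤ hNN).hom.toMonoidHom (P.coordUnit V) =
      (Gm.isUnit_coord (N.ι ≫ pullback.fst Gm.str P.str) ⊤).unit := Units.ext (by
        rw [IsUnit.unit_spec]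
        refine (congrArg (N.ι.appLE _ ⊤ hNN) (P.coordUnit_val V)).trans ?_
        rw [Gm.appLE_coord])
    rw [← e1, ← map_zpow]
    rfl

/-- One has σ(s·p) = σ₀(s)·σ(p), and σ₀ inverts the coordinate. -/
lemma IsWeight.conjComorphism {m : ℤ} {V : C.X.Opens} {f : Γ(P.X, P.proj ⁻¹ᵁ V)}
    (hf : P.IsWeight m V f) : P.IsWeight (-m) (C.conj ⁻¹ᵁ V) (P.conjComorphism V f) := by
  refine isWeight_of_actPt fun {Z} s p hs hV => ?_
  have hV' : ⊤ ≤ (p ≫ P.conj) ⁻¹ᵁ P.proj ⁻¹ᵁ V :=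
    hV.trans (by
      rw [Scheme.Hom.comp_preimage]
      exact p.preimage_mono (P.conj_le V))
  have h1 := hf.actPt (s ≫ Gm.circleConj) (p ≫ P.conj)
    (by rw [Category.assoc, Gm.circleConj_str, reassoc_of% hs, Category.assoc, P.conj_str]) hV'
  rw [conjComorphism_apply]
  refine (appLE_appLE _ _ _ _ _).trans ((appLE_congr_hom (actPt_conj s p hs) _ _ _).trans
    (h1.trans (congrArg₂ (· * ·) (appLE_appLE _ _ _ _ _).symm ?_)))
  have e1 : (Gm.isUnit_coord (s ≫ Gm.circleConj) ⊤).unit = (Gm.isUnit_coord s ⊤).unit⁻¹ :=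
    Units.ext (by
      rw [IsUnit.unit_spec]
      exact Gm.coord_circleConj s ⊤ _ (IsUnit.unit_spec _).symm)
  rw [e1, inv_zpow', zpow_neg]

variable (P) in
/-- A local trivialization of a torsor over an open subset. -/
structure Trivialization where
  /-- the open subset -/
  U : C.X.Opens
  /-- the morphism from the trivial torsor -/
  k : pullback Gm.str (U.ι ≫ C.str) ⟶ P.X
  /-- the inverse morphism -/
  inv : (P.proj ⁻¹ᵁ U).toScheme ⟶ pullback Gm.str (U.ι ≫ C.str)
  mono : Mono k
  inv_k : inv ≫ k = (P.proj ⁻¹ᵁ U).ι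
  k_proj : k ≫ P.proj = pullback.snd _ _ ≫ U.ι
  actPt_k {Z : Scheme.{0}} (s : Z ⟶ Gm) (z : Z ⟶ pullback Gm.str (U.ι ≫ C.str))
    (h : s ≫ Gm.str = (z ≫ k) ≫ P.str) (h' : s ≫ Gm.str = (z ≫ pullback.fst _ _) ≫ Gm.str) :
    P.actPt s (z ≫ k) h = pullback.lift (pullback.lift s (z ≫ pullback.fst _ _) h' ≫ Gm.mul)
      (z ≫ pullback.snd _ _) (by
        rw [Category.assoc, Gm.mul_str, pullback.lift_fst_assoc, h', Category.assoc,
          pullback.condition, Category.assoc]) ≫ k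

lemma exists_trivialization (x : C.X) : ∃ t : P.Trivialization, x ∈ t.U := by
  obtain ⟨U, hx, e, h1, h2, h3⟩ := P.locally_trivial x
  refine ⟨⟨U, e.hom ≫ (P.proj ⁻¹ᵁ U).ι, e.inv, inferInstance, by simp,
    by rw [Category.assoc, h1], ?_⟩, hx⟩
  intro Z s z h h'
  obtain ⟨m, hm, hm1, hm2⟩ := exists_eq_pullback_map Gm.str
    (pullback.snd Gm.str (U.ι ≫ C.str) ≫ U.ι ≫ C.str) Gm.str P.str (𝟙 Gm)
    (e.hom ≫ (P.proj ⁻¹ᵁ U).ι) (𝟙 _) (by simp) (by rw [h2, Category.comp_id])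
  rw [← hm] at h3
  rw [Category.comp_id] at hm1
  let w : Z ⟶ pullback Gm.str (pullback.snd Gm.str (U.ι ≫ C.str) ≫ U.ι ≫ C.str) :=
    pullback.lift s z (by rw [h, Category.assoc, h2])
  have hw1 : w ≫ pullback.fst _ _ = s := pullback.lift_fst _ _ _
  have hw2 : w ≫ pullback.snd _ _ = z := pullback.lift_snd _ _ _
  have e1 : pullback.lift s (z ≫ e.hom ≫ (P.proj ⁻¹ᵁ U).ι) h = w ≫ m := by
    apply pullback.hom_ext
    · rw [Category.assoc, hm1, pullback.lift_fst, pullback.lift_fst]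
    · rw [Category.assoc, hm2, pullback.lift_snd, pullback.lift_snd_assoc]
  rw [actPt, e1, Category.assoc, ← h3, ← Category.assoc]
  congr 1
  apply pullback.hom_ext
  · rw [Category.assoc, Gm.translate, pullback.lift_fst, pullback.lift_fst, ← Category.assoc]
    congr 1
    apply pullback.hom_ext
    · rw [Category.assoc, pullback.lift_fst]
      exact hw1.trans (pullback.lift_fst _ _ _).symm
    · rw [Category.assoc, pullback.lift_snd, pullback.lift_snd, reassoc_of% hw2]
  · rw [Category.assoc, Gm.translate, pullback.lift_snd, pullback.lift_snd, reassoc_of% hw2]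

namespace Trivialization

variable (t : P.Trivialization)

lemma k_str : t.k ≫ P.str = pullback.fst _ _ ≫ Gm.str := by
  rw [← P.proj_str, reassoc_of% t.k_proj, pullback.condition]

/-- The section of the torsor defined by a trivialization. -/
def sect : t.U.toScheme ⟶ P.X :=
  pullback.lift ((t.U.ι ≫ C.str) ≫ Gm.one) (𝟙 _)
    (by rw [Category.assoc, Gm.one_str, Category.comp_id, Category.id_comp]) ≫ t.k

lemma sect_proj : t.sect ≫ P.proj = t.U.ι := by
  rw [sect, Category.assoc, t.k_proj, pullback.lift_snd_assoc, Category.id_comp]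

/-- A point (s, u) of the trivial torsor is the translate by s of (1, u), which lies on the section.
-/
lemma comp_k {Z : Scheme.{0}} (z : Z ⟶ pullback Gm.str (t.U.ι ≫ C.str)) :
    z ≫ t.k = P.actPt (z ≫ pullback.fst _ _) ((z ≫ pullback.snd _ _) ≫ t.sect)
      (by rw [Category.assoc, pullback.condition, ← P.proj_str, Category.assoc, Category.assoc,
        reassoc_of% t.sect_proj]) := by
  have h1 : (z ≫ pullback.snd _ _) ≫ t.sect = pullback.lift
      ((z ≫ pullback.snd _ _) ≫ (t.U.ι ≫ C.str) ≫ Gm.one) (z ≫ pullback.snd _ _)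
      (by simp only [Category.assoc, Gm.one_str, Category.comp_id]) ≫ t.k := by
    rw [sect, ← Category.assoc]
    congr 1
    apply pullback.hom_ext
    · rw [Category.assoc, pullback.lift_fst, pullback.lift_fst]
    · rw [Category.assoc, pullback.lift_snd, pullback.lift_snd, Category.comp_id]
  simp only [h1]
  rw [t.actPt_k _ _ _ (by simp only [Category.assoc, Gm.one_str, Category.comp_id,
    pullback.lift_fst, pullback.condition])]
  congr 1
  refine pullback_Gm_hom_ext ?_ ?_
  · rw [pullback.lift_snd, pullback.lift_snd]
  · rw [pullback.lift_fst, Gm.coord_lift_mul, pullback.lift_fst, ← Category.assoc, Gm.coord_one,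
      mul_one]

end Trivialization

end CircleTorsor

/-! ### Splittings of torsors and functions of weight zero -/

lemma opens_ι_appLE_bijective {Y : Scheme.{0}} (W : Y.Opens) (h : ⊤ ≤ W.ι ⁻¹ᵁ W) :
    Function.Bijective (W.ι.appLE W ⊤ h) :=
  (ConcreteCategory.isIso_iff_bijective _).1
    (inferInstanceAs (IsIso (W.ι.appLE W ⊤ W.ι_preimage_self.ge)))

namespace CircleTorsor

variable {C : RealVariety} {P : CircleTorsor C}

lemma actPt_congr {Z : Scheme.{0}} {s s' : Z ⟶ Gm} {p p' : Z ⟶ P.X} (h1 : s = s') (h2 : p = p')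
    (hs : s ≫ Gm.str = p ≫ P.str) (hs' : s' ≫ Gm.str = p' ≫ P.str) :
    P.actPt s p hs = P.actPt s' p' hs' := by
  subst h1 h2; rfl

lemma toGmOn_eq {W : P.X.Opens} {c : Γ(P.X, W)} {hc : IsUnit c} {Z : Scheme.{0}}
    {n : Z ⟶ W.toScheme} {s : Z ⟶ Gm} (hs : s ≫ Gm.str = (n ≫ W.ι) ≫ P.str)
    (hV : ⊤ ≤ (n ≫ W.ι) ⁻¹ᵁ W)
    (h : Gm.coord s ⊤ = (n ≫ W.ι).appLE W ⊤ hV c) : n ≫ toGmOn P.str W c hc = s := by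
  refine Gm.hom_ext (by rw [Category.assoc, toGmOn_str, hs, Category.assoc]) ?_
  rw [h, ← Gm.appLE_coord (V := ⊤) _ _ (le_preimage_top _ _),
    coord_toGmOn _ _ _ _ _ W.ι_preimage_self.ge]
  exact appLE_appLE _ _ _ _ _

variable (P) in
/-- A section of a torsor over an open subset together with the function of weight one that it
defines. -/
structure Splitting (U : C.X.Opens) where
  /-- the section -/
  sect : U.toScheme ⟶ P.X
  sect_proj : sect ≫ P.proj = U.ι
  /-- the function of weight one -/
  unit : Γ(P.X, P.proj ⁻¹ᵁ U)
  isUnit : IsUnit unit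
  isWeight : P.IsWeight 1 U unit
  -- On points this reads p = c(p)·s(ρ(p)), with c the unit and s the section; it reduces functions
  -- with a weight to their values on the section.
  ι_eq : (P.proj ⁻¹ᵁ U).ι = P.actPt (toGmOn P.str (P.proj ⁻¹ᵁ U) unit isUnit)
    (P.proj ∣_ U ≫ sect) (by
      rw [toGmOn_str, ← P.proj_str, Category.assoc, reassoc_of% sect_proj,
        morphismRestrict_ι_assoc])

/-- The section is t = 1, and the unit is the Gm-coordinate of the trivialization, which
translations multiply by their parameter. -/
lemma Trivialization.exists_splitting (t : P.Trivialization) : Nonempty (P.Splitting t.U) := by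
  have hmono := t.mono
  have hW : ⊤ ≤ (P.proj ⁻¹ᵁ t.U).ι ⁻¹ᵁ (P.proj ⁻¹ᵁ t.U) := (P.proj ⁻¹ᵁ t.U).ι_preimage_self.ge
  obtain ⟨c, hc⟩ := (opens_ι_appLE_bijective _ hW).2 (Gm.coord (t.inv ≫ pullback.fst _ _) ⊤)
  have hunit : IsUnit c := by
    obtain ⟨u, hu⟩ := (Gm.isUnit_coord (t.inv ≫ pullback.fst _ _) ⊤).exists_right_inv
    obtain ⟨d, rfl⟩ := (opens_ι_appLE_bijective _ hW).2 u
    rw [← hc, ← map_mul, ← map_one ((P.proj ⁻¹ᵁ t.U).ι.appLE _ ⊤ hW).hom] at hu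
    exact .of_mul_eq_one _ ((opens_ι_appLE_bijective _ hW).1 hu)
  have hlift : ∀ {Z : Scheme.{0}} (p : Z ⟶ P.X) (_ : ⊤ ≤ p ⁻¹ᵁ P.proj ⁻¹ᵁ t.U),
      ∃ q : Z ⟶ (P.proj ⁻¹ᵁ t.U).toScheme, q ≫ (P.proj ⁻¹ᵁ t.U).ι = p := fun p hp =>
    ⟨IsOpenImmersion.lift (P.proj ⁻¹ᵁ t.U).ι p (by
      rw [Scheme.Opens.range_ι]
      rintro _ ⟨z, rfl⟩
      exact hp trivial), IsOpenImmersion.lift_fac _ _ _⟩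
  have key : ∀ {Z : Scheme.{0}} (n : Z ⟶ pullback Gm.str (t.U.ι ≫ C.str))
      (hn : ⊤ ≤ (n ≫ t.k) ⁻¹ᵁ P.proj ⁻¹ᵁ t.U),
      (n ≫ t.k).appLE _ ⊤ hn c = Gm.coord (n ≫ pullback.fst _ _) ⊤ := by
    intro Z n hn
    obtain ⟨q, hq⟩ := hlift _ hn
    have hqn : q ≫ t.inv = n := by
      rw [← cancel_mono t.k, Category.assoc, t.inv_k, hq]
    have h1 := congrArg (q.appLE ⊤ ⊤ (le_preimage_top _ _)) hc
    rw [appLE_appLE, Gm.appLE_coord] at h1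
    refine (appLE_congr_hom hq.symm _ _ _).trans (h1.trans ?_)
    rw [reassoc_of% hqn]
  refine ⟨⟨t.sect, t.sect_proj, c, hunit, ?_, ?_⟩⟩
  · refine isWeight_of_actPt fun {Z} s p hs hV => ?_
    obtain ⟨q, rfl⟩ := hlift p hV
    have hp : q ≫ (P.proj ⁻¹ᵁ t.U).ι = (q ≫ t.inv) ≫ t.k := by rw [Category.assoc, t.inv_k]
    have hs' : s ≫ Gm.str = ((q ≫ t.inv) ≫ pullback.fst _ _) ≫ Gm.str := by
      rw [hs, hp, Category.assoc, t.k_str]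
      simp only [Category.assoc]
    have e := (actPt_congr rfl hp hs (by rw [hs, hp])).trans
      (t.actPt_k s (q ≫ t.inv) (by rw [hs, hp]) hs')
    refine (appLE_congr_hom e _ (by rw [← e]; exact actPt_le s _ hs hV) _).trans ?_
    rw [key, pullback.lift_fst, Gm.coord_lift_mul, zpow_one, IsUnit.unit_spec, mul_comm]
    congr 1
    rw [← key _ (by rw [← hp]; exact hV)]
    exact appLE_congr_hom hp.symm _ _ _
  · refine t.inv_k.symm.trans ((t.comp_k t.inv).trans (actPt_congr ?_ ?_ _ _))
    · rw [← Category.id_comp (toGmOn _ _ _ _)]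
      refine (toGmOn_eq ?_ ?_ ?_).symm
      · rw [Category.id_comp, ← t.inv_k, Category.assoc, Category.assoc, t.k_str]
      · rw [Category.id_comp]
        exact hW
      · rw [← hc]
        exact appLE_congr_hom (Category.id_comp _).symm _ _ _
    · congr 1
      rw [← cancel_mono t.U.ι, morphismRestrict_ι, Category.assoc, ← t.k_proj,
        reassoc_of% t.inv_k]

namespace Splitting

variable {U : C.X.Opens} (t : P.Splitting U)

/-- The restriction of a splitting. -/
def restrict {V : C.X.Opens} (h : V ≤ U) : P.Splitting V where
  sect := C.X.homOfLE h ≫ t.sect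
  sect_proj := by rw [Category.assoc, t.sect_proj, Scheme.homOfLE_ι]
  unit := P.X.presheaf.map (homOfLE (P.proj.preimage_mono h)).op t.unit
  isUnit := t.isUnit.map _
  isWeight := t.isWeight.res h
  ι_eq := by
    refine (P.X.homOfLE_ι (P.proj.preimage_mono h)).symm.trans
      ((congrArg (_ ≫ ·) t.ι_eq).trans ((comp_actPt _ _ _ _).trans (actPt_congr ?_ ?_ _ _)))
    · refine toGmOn_eq ?_ ?_ ?_
      · rw [toGmOn_str, P.X.homOfLE_ι]
      · rw [P.X.homOfLE_ι]
        exact (P.proj ⁻¹ᵁ V).ι_preimage_self.ge.trans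
          ((P.proj ⁻¹ᵁ V).ι.preimage_mono (P.proj.preimage_mono h))
      · rw [coord_toGmOn _ _ _ _ _ (P.proj ⁻¹ᵁ V).ι_preimage_self.ge, map_appLE_apply]
        exact appLE_congr_hom (P.X.homOfLE_ι _).symm _ _ _
    · rw [← Category.assoc, ← Category.assoc]
      congr 1
      rw [← cancel_mono U.ι, Category.assoc, Category.assoc, morphismRestrict_ι,
        Scheme.homOfLE_ι_assoc, Scheme.homOfLE_ι, morphismRestrict_ι]

lemma app_injective (t : P.Splitting U) : Function.Injective (P.proj.app U) := by
  intro a b hab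
  apply (opens_ι_appLE_bijective U U.ι_preimage_self.ge).1
  have hle : ⊤ ≤ t.sect ⁻¹ᵁ P.proj ⁻¹ᵁ U := by
    rw [← Scheme.Hom.comp_preimage, t.sect_proj]
    exact U.ι_preimage_self.ge
  have key : ∀ a, U.ι.appLE U ⊤ U.ι_preimage_self.ge a =
      t.sect.appLE _ ⊤ hle (P.proj.app U a) := fun a => by
    rw [app_eq_appLE_apply, appLE_appLE]
    exact appLE_congr_hom t.sect_proj.symm _ _ _
  rw [key, key, hab]

/-- Evaluating at p = c(p)·s(ρ(p)) gives f(p) = c(p)ᵐ f(s(ρ(p))), so a is the pull-back of f by the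
section. -/
lemma exists_eq_app_mul (t : P.Splitting U) {m : ℤ} {f : Γ(P.X, P.proj ⁻¹ᵁ U)} (hf : P.IsWeight m U f) :
    ∃ a : Γ(C.X, U), f = P.proj.app U a * ((t.isUnit.unit ^ m : _ˣ) : Γ(P.X, P.proj ⁻¹ᵁ U)) := by
  have hle : ⊤ ≤ t.sect ⁻¹ᵁ P.proj ⁻¹ᵁ U := by
    rw [← Scheme.Hom.comp_preimage, t.sect_proj]
    exact U.ι_preimage_self.ge
  obtain ⟨a, ha⟩ := (opens_ι_appLE_bijective U U.ι_preimage_self.ge).2 (t.sect.appLE _ ⊤ hle f)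
  have hW : ⊤ ≤ (P.proj ⁻¹ᵁ U).ι ⁻¹ᵁ (P.proj ⁻¹ᵁ U) := (P.proj ⁻¹ᵁ U).ι_preimage_self.ge
  have hV : ⊤ ≤ (P.proj ∣_ U ≫ t.sect) ⁻¹ᵁ P.proj ⁻¹ᵁ U := by
    rw [← Scheme.Hom.comp_preimage, Category.assoc, t.sect_proj, morphismRestrict_ι]
    exact hW
  refine ⟨a, (opens_ι_appLE_bijective _ hW).1 ?_⟩
  refine (appLE_congr_hom t.ι_eq _ (actPt_le _ _ _ hV) _).trans ?_
  refine (hf.actPt _ _ _ hV).trans (Eq.trans (congrArg₂ (· * ·) ?_ ?_) (map_mul _ _ _).symm)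
  · have e1 := appLE_appLE (P.proj ∣_ U) t.sect hle (le_preimage_top (P.proj ∣_ U) ⊤) f
    have e2 := appLE_appLE (P.proj ∣_ U) U.ι U.ι_preimage_self.ge
      (le_preimage_top (P.proj ∣_ U) ⊤) a
    rw [ha] at e2
    refine e1.symm.trans (e2.trans ((appLE_congr_hom (morphismRestrict_ι _ _) _ hW _).trans ?_))
    rw [app_eq_appLE_apply]
    exact (appLE_appLE _ _ _ _ _).symm
  · have e1 : (Gm.isUnit_coord (toGmOn P.str (P.proj ⁻¹ᵁ U) t.unit t.isUnit) ⊤).unit =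
        Units.map ((P.proj ⁻¹ᵁ U).ι.appLE _ ⊤ hW).hom.toMonoidHom t.isUnit.unit := Units.ext (by
      rw [IsUnit.unit_spec, coord_toGmOn _ _ _ _ _ hW]
      rfl)
    rw [e1, ← map_zpow]
    rfl

end Splitting

end CircleTorsor

/-! ### Descent of functions of weight zero and universality of frames of weight one -/

namespace CircleTorsor

variable {C : RealVariety} {P : CircleTorsor C}

variable (P) in
lemma exists_splitting (x : C.X) : ∃ U : C.X.Opens, x ∈ U ∧ Nonempty (P.Splitting U) := by
  obtain ⟨t, ht⟩ := P.exists_trivialization x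
  exact ⟨t.U, ht, t.exists_splitting⟩

lemma app_injective (V : C.X.Opens) : Function.Injective (P.proj.app V) := by
  intro a b hab
  refine C.X.IsSheaf.section_ext fun x hx => ?_
  obtain ⟨U, hxU, ⟨t⟩⟩ := P.exists_splitting x
  refine ⟨U ⊓ V, inf_le_right, ⟨hxU, hx⟩, (t.restrict inf_le_left).app_injective ?_⟩
  have h := congrArg (P.X.presheaf.map (homOfLE (P.proj.preimage_mono
    (inf_le_right (a := U) (b := V)))).op) hab
  rw [app_eq_appLE_apply, app_eq_appLE_apply, appLE_map_apply, appLE_map_apply] at h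
  rw [app_eq_appLE_apply, app_eq_appLE_apply, map_appLE_apply, map_appLE_apply]
  exact h

lemma app_map_apply {V W : C.X.Opens} (h : W ≤ V) (a : Γ(C.X, V)) :
    P.X.presheaf.map (homOfLE (P.proj.preimage_mono h)).op (P.proj.app V a) =
      P.proj.app W (C.X.presheaf.map (homOfLE h).op a) := by
  rw [app_eq_appLE_apply, app_eq_appLE_apply, appLE_map_apply, map_appLE_apply]

/-- Functions of weight zero come from the base. -/
lemma exists_app_eq {V : C.X.Opens} {f : Γ(P.X, P.proj ⁻¹ᵁ V)} (hf : P.IsWeight 0 V f) :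
    ∃ a : Γ(C.X, V), P.proj.app V a = f := by
  have hloc : ∀ x : V, ∃ (W : C.X.Opens) (hW : W ≤ V) (_ : x.1 ∈ W) (a : Γ(C.X, W)),
      P.proj.app W a = P.X.presheaf.map (homOfLE (P.proj.preimage_mono hW)).op f := by
    intro x
    obtain ⟨U, hxU, ⟨t⟩⟩ := P.exists_splitting x.1
    obtain ⟨a, ha⟩ := (t.restrict (inf_le_left (b := V))).exists_eq_app_mul (hf.res inf_le_right)
    refine ⟨U ⊓ V, inf_le_right, ⟨hxU, x.2⟩, a, ?_⟩
    rw [ha, zpow_zero, Units.val_one, mul_one]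
  choose W hW hxW a ha using hloc
  obtain ⟨b, hb, -⟩ := TopCat.Sheaf.existsUnique_gluing' C.X.sheaf W V (fun x => homOfLE (hW x))
    (fun x hx => TopologicalSpace.Opens.mem_iSup.2 ⟨⟨x, hx⟩, hxW ⟨x, hx⟩⟩) a (by
      intro x y
      have key : ∀ (x : V) (W' : C.X.Opens) (h : W' ≤ W x),
          P.proj.app W' (C.X.presheaf.map (homOfLE h).op (a x)) =
          P.X.presheaf.map (homOfLE (P.proj.preimage_mono (h.trans (hW x)))).op f := by
        intro x W' h
        rw [← app_map_apply, ha, map_homOfLE_apply]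
      exact app_injective (P := P) (W x ⊓ W y) ((key x _ inf_le_left).trans
        (key y _ inf_le_right).symm))
  refine ⟨b, P.X.IsSheaf.section_ext fun p hp => ?_⟩
  refine ⟨P.proj ⁻¹ᵁ W ⟨P.proj p, hp⟩, P.proj.preimage_mono (hW _), hxW ⟨P.proj p, hp⟩, ?_⟩
  exact (app_map_apply _ b).trans ((congrArg _ (hb _)).trans (ha _))

/-- The quotient d/c has weight zero, so it descends to the base. -/
lemma isWeight_one_inv_mul {V : C.X.Opens} {c d : Γ(P.X, P.proj ⁻¹ᵁ V)} (hc : P.IsWeight 1 V c)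
    (hd : P.IsWeight 1 V d) (hc' : IsUnit c) : ∃ a : Γ(C.X, V), d = P.proj.app V a * c := by
  obtain ⟨u, rfl⟩ := hc'
  have h := hd.mul (isWeight_unit_zpow hc (-1))
  obtain ⟨a, ha⟩ := exists_app_eq (by simpa using h)
  exact ⟨a, by rw [ha]; simp⟩

/-- Let s be the section and b the pull-back by s of the frame's unit. At the point r·s(x) this unit
has value r b(x), so the chart is inverted by (t, x) ↦ (t/b(x))·s(x). -/
lemma isIso_chart {L : RatSubsheaf C.X} {φ : Frame L P.proj} {i : LocalGen L}
    (h1 : P.IsWeight 1 i.U (φ.sec i)) (t : P.Splitting i.U) : IsIso (φ.chart C.str i) := by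
  have hW : ⊤ ≤ (P.proj ⁻¹ᵁ i.U).ι ⁻¹ᵁ (P.proj ⁻¹ᵁ i.U) := (P.proj ⁻¹ᵁ i.U).ι_preimage_self.ge
  have hle : ⊤ ≤ t.sect ⁻¹ᵁ P.proj ⁻¹ᵁ i.U := by
    rw [← Scheme.Hom.comp_preimage, t.sect_proj]
    exact i.U.ι_preimage_self.ge
  obtain ⟨b, hb⟩ : ∃ b, b = t.sect.appLE _ ⊤ hle (φ.sec i) := ⟨_, rfl⟩
  have hbu : IsUnit b := hb ▸ (φ.isUnit i).map _
  -- The morphism S is t/b(x), the parameter of the translation in the inverse chart.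
  obtain ⟨S, hSstr, hS⟩ : ∃ S : pullback Gm.str (i.U.ι ≫ C.str) ⟶ Gm,
      S ≫ Gm.str = pullback.snd _ _ ≫ i.U.ι ≫ C.str ∧
      (pullback.snd Gm.str (i.U.ι ≫ C.str)).appLE ⊤ ⊤ (le_preimage_top _ _) b * Gm.coord S ⊤ =
        Gm.coord (pullback.fst _ _) ⊤ := by
    refine ⟨toGm (pullback.snd _ _ ≫ i.U.ι ≫ C.str)
      ((hbu.map ((pullback.snd Gm.str (i.U.ι ≫ C.str)).appLE ⊤ ⊤ (le_preimage_top _ _)).hom).unit⁻¹ *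
        (Gm.isUnit_coord (pullback.fst Gm.str (i.U.ι ≫ C.str)) ⊤).unit), toGm_str _ _, ?_⟩
    rw [coord_toGm, Units.val_mul, ← mul_assoc]
    exact (congrArg (· * _) (IsUnit.mul_val_inv _)).trans (one_mul _)
  have hSs : S ≫ Gm.str = (pullback.snd Gm.str (i.U.ι ≫ C.str) ≫ t.sect) ≫ P.str := by
    rw [hSstr, ← P.proj_str, Category.assoc, reassoc_of% t.sect_proj]
  have hmle : ⊤ ≤ (pullback.snd Gm.str (i.U.ι ≫ C.str) ≫ t.sect) ⁻¹ᵁ P.proj ⁻¹ᵁ i.U := by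
    rw [Scheme.Hom.comp_preimage]
    exact le_top.trans ((pullback.snd Gm.str (i.U.ι ≫ C.str)).preimage_mono hle)
  obtain ⟨q, hq⟩ : ∃ q : pullback Gm.str (i.U.ι ≫ C.str) ⟶ (P.proj ⁻¹ᵁ i.U).toScheme,
      q ≫ (P.proj ⁻¹ᵁ i.U).ι = P.actPt S (pullback.snd _ _ ≫ t.sect) hSs :=
    ⟨IsOpenImmersion.lift (P.proj ⁻¹ᵁ i.U).ι (P.actPt S (pullback.snd _ _ ≫ t.sect) hSs) (by
      rw [Scheme.Opens.range_ι]
      rintro _ ⟨z, rfl⟩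
      exact actPt_le S _ hSs hmle trivial), IsOpenImmersion.lift_fac _ _ _⟩
  have hsect : ∀ {Z : Scheme.{0}} (n : Z ⟶ i.U.toScheme) (h : ⊤ ≤ (n ≫ t.sect) ⁻¹ᵁ P.proj ⁻¹ᵁ i.U),
      (n ≫ t.sect).appLE _ ⊤ h (φ.sec i) = n.appLE ⊤ ⊤ (le_preimage_top _ _) b := by
    intro Z n h
    rw [hb]
    exact (appLE_appLE n t.sect hle (le_preimage_top _ _) _).symm
  refine ⟨q, ?_, ?_⟩
  · rw [← cancel_mono (P.proj ⁻¹ᵁ i.U).ι, Category.assoc, hq, Category.id_comp, comp_actPt]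
    refine Eq.trans (actPt_congr ?_ ?_ _ _) t.ι_eq.symm
    · refine Gm.hom_ext ?_ ?_
      · rw [Category.assoc, hSstr, toGmOn_str, ← Category.assoc, Frame.chart_snd,
          morphismRestrict_ι_assoc, P.proj_str]
      · have hV : ⊤ ≤ (P.proj ∣_ i.U ≫ t.sect) ⁻¹ᵁ P.proj ⁻¹ᵁ i.U := by
          rw [Scheme.Hom.comp_preimage]
          exact le_top.trans ((P.proj ∣_ i.U).preimage_mono hle)
        have e1 := congrArg ((φ.chart C.str i).appLE ⊤ ⊤ (le_preimage_top _ _)) hS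
        rw [map_mul, appLE_appLE, Gm.appLE_coord, Gm.appLE_coord, Frame.chart_fst,
          coord_toGmOn _ _ _ _ _ hW] at e1
        have e2 := (appLE_congr_hom t.ι_eq hW (actPt_le _ _ _ hV) (φ.sec i)).trans
          (h1.actPt _ _ _ hV)
        rw [hsect, zpow_one, IsUnit.unit_spec] at e2
        rw [e2, ← appLE_congr_hom (Frame.chart_snd C.str φ i).symm (le_preimage_top _ _)] at e1
        exact (hbu.map _).mul_left_cancel e1
    · rw [← Category.assoc, Frame.chart_snd]
  · refine pullback_Gm_hom_ext ?_ ?_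
    · rw [Category.assoc, Frame.chart_snd, ← cancel_mono i.U.ι, Category.assoc, morphismRestrict_ι,
        reassoc_of% hq, actPt_proj, Category.assoc, t.sect_proj, Category.id_comp]
    · rw [Category.assoc, Frame.chart_fst, Category.id_comp, ← hS,
        ← Gm.appLE_coord (V := ⊤) _ _ (le_preimage_top _ _), coord_toGmOn _ _ _ _ _ hW, appLE_appLE]
      refine (appLE_congr_hom hq _ (actPt_le S _ hSs hmle) _).trans ((h1.actPt _ _ _ hmle).trans ?_)
      rw [hsect, zpow_one, IsUnit.unit_spec]

/-- Frames that consist of functions of weight one are universal. -/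
lemma isUniversal_of_isWeight {L : RatSubsheaf C.X} (hL : L.IsInvertible) {φ : Frame L P.proj}
    (h1 : ∀ i, P.IsWeight 1 i.U (φ.sec i)) : φ.IsUniversal C.str := by
  intro x
  obtain ⟨U, hxU, g, hg⟩ := RatSubsheaf.isInvertible_iff.1 hL x
  obtain ⟨V, hxV, ⟨t⟩⟩ := P.exists_splitting x
  have hne : Nonempty (U ⊓ V : C.X.Opens) := ⟨⟨x, hxU, hxV⟩⟩
  let i : LocalGen L := ⟨U ⊓ V, hne, g, hg.res inf_le_left⟩
  exact ⟨i, ⟨hxU, hxV⟩, isIso_chart (h1 i) (t.restrict inf_le_right)⟩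

end CircleTorsor

/-! ### Rational functions on torsors -/

namespace CircleTorsor

variable {C : RealVariety} (P : CircleTorsor C)

lemma proj_surjective : Function.Surjective P.proj := fun x => by
  obtain ⟨U, hx, ⟨t⟩⟩ := P.exists_splitting x
  refine ⟨t.sect ⟨x, hx⟩, ?_⟩
  have h := Scheme.Hom.comp_apply t.sect P.proj ⟨x, hx⟩
  rw [t.sect_proj] at h
  exact h.symm

lemma proj_genericPoint : P.proj (genericPoint P.X) = genericPoint C.X := by
  have h := (genericPoint_spec P.X).image P.proj.continuous
  rw [Set.image_univ, P.proj_surjective.range_eq, closure_univ] at h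
  exact h.eq (genericPoint_spec C.X)

instance (V : C.X.Opens) [h : Nonempty V] : Nonempty (P.proj ⁻¹ᵁ V : P.X.Opens) := by
  obtain ⟨x⟩ := h
  obtain ⟨p, hp⟩ := P.proj_surjective x.1
  exact ⟨⟨p, show P.proj p ∈ V by rw [hp]; exact x.2⟩⟩

/-- The pull-back of rational functions to a torsor. -/
def ratPull : C.X.functionField →+* P.X.functionField :=
  (C.X.presheaf.stalkSpecializes (specializes_of_eq P.proj_genericPoint) ≫
    P.proj.stalkMap (genericPoint P.X)).hom

variable {P}

lemma ratPull_germ {V : C.X.Opens} [Nonempty V] (a : Γ(C.X, V)) :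
    P.ratPull (C.X.germToFunctionField V a) =
      P.X.germToFunctionField (P.proj ⁻¹ᵁ V) (P.proj.app V a) := by
  unfold ratPull Scheme.germToFunctionField
  rw [CommRingCat.hom_comp, RingHom.comp_apply]
  erw [TopCat.Presheaf.germ_stalkSpecializes_apply]
  exact Scheme.Hom.germ_stalkMap_apply P.proj V _ _ a

lemma ratConj_germ_conjComorphism {V : C.X.Opens} [Nonempty V] (f : Γ(P.X, P.proj ⁻¹ᵁ V)) :
    P.ratConj (P.X.germToFunctionField _ f) =
      P.X.germToFunctionField _ (P.conjComorphism V f) := by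
  rw [RealVariety.ratConj_germ]
  refine (germToFunctionField_res (P.conj_le V) _).symm.trans (congrArg _ ?_)
  rw [app_eq_appLE_apply]
  exact appLE_map_apply _ _ _ _

lemma exists_germ_eq {X : Scheme.{0}} [IsIntegral X] (s : X.functionField) :
    ∃ (U : X.Opens) (_ : Nonempty U) (a : Γ(X, U)), X.germToFunctionField U a = s := by
  obtain ⟨U, hU, a, ha⟩ := X.presheaf.exists_germ_eq s
  exact ⟨U, ⟨⟨_, hU⟩⟩, a, ha⟩

lemma ratConj_ratPull (s : C.X.functionField) :
    P.ratConj (P.ratPull s) = P.ratPull (C.ratConj s) := by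
  obtain ⟨V, _, a, rfl⟩ := exists_germ_eq s
  rw [ratPull_germ, ratConj_germ_conjComorphism, conjComorphism_base, C.ratConj_germ, ratPull_germ]

/-! ### The coefficient of a frame -/

variable {L : RatSubsheaf C.X}

/-- There is an invertible function of weight one on `ρ⁻¹(V)` whose quotient by the rational function
`θ` is `k`. -/
def IsUnitCoeff (P : CircleTorsor C) (θ : P.X.functionField) (V : C.X.Opens) [Nonempty V]
    (k : C.X.functionField) : Prop :=
  ∃ c : Γ(P.X, P.proj ⁻¹ᵁ V), IsUnit c ∧ P.IsWeight 1 V c ∧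
    P.X.germToFunctionField _ c = θ * P.ratPull k

/-- A rational function `θ` on the torsor that defines a frame: the products of `θ` with the local
generators of `L` are invertible functions of weight one. -/
def IsCoeff (P : CircleTorsor C) (L : RatSubsheaf C.X) (θ : P.X.functionField) : Prop :=
  ∀ i : LocalGen L, P.IsUnitCoeff θ i.U i.g

/-- The frame with a given coefficient. -/
def IsCoeff.frame {θ : P.X.functionField} (hθ : P.IsCoeff L θ) : Frame L P.proj where
  sec i := Exists.choose (hθ i)
  isUnit i := (Exists.choose_spec (hθ i)).1
  compat {i j} h := by
    apply P.X.germToFunctionField_injective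
    have hi := i.gen.1
    refine (germToFunctionField_res _ _).trans ((Exists.choose_spec (hθ j)).2.2.trans ?_)
    rw [map_mul, (Exists.choose_spec (hθ i)).2.2, ← ratPull_germ, LocalGen.germ_ratio, mul_left_comm,
      ← map_mul, inv_mul_cancel_right₀ hi]

lemma IsCoeff.isWeight {θ : P.X.functionField} (hθ : P.IsCoeff L θ) (i : LocalGen L) :
    P.IsWeight 1 i.U (hθ.frame.sec i) := (Exists.choose_spec (hθ i)).2.1

lemma IsCoeff.germ_sec {θ : P.X.functionField} (hθ : P.IsCoeff L θ) (i : LocalGen L) :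
    P.X.germToFunctionField _ (hθ.frame.sec i) = θ * P.ratPull i.g := (Exists.choose_spec (hθ i)).2.2

lemma nonempty_inf {X : Scheme.{0}} [IsIntegral X] (U V : X.Opens) [hU : Nonempty U]
    [hV : Nonempty V] : Nonempty (U ⊓ V : X.Opens) := by
  obtain ⟨x⟩ := hU
  obtain ⟨y⟩ := hV
  exact (nonempty_preirreducible_inter U.isOpen V.isOpen ⟨x.1, x.2⟩ ⟨y.1, y.2⟩).to_subtype

lemma germ_ne_zero_of_isUnit {X : Scheme.{0}} [IsIntegral X] {U : X.Opens} [Nonempty U]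
    {a : Γ(X, U)} (ha : IsUnit a) : X.germToFunctionField U a ≠ 0 :=
  (ha.map (X.germToFunctionField U).hom).ne_zero

/-- Frames have coefficients. -/
lemma _root_.CircleTorsors.Frame.exists_coeff (hL : L.IsInvertible) (φ : Frame L P.proj) :
    ∃ θ : P.X.functionField, θ ≠ 0 ∧
      ∀ i, P.X.germToFunctionField _ (φ.sec i) = θ * P.ratPull i.g := by
  obtain ⟨U, hxU, g, hg⟩ := RatSubsheaf.isInvertible_iff.1 hL (genericPoint C.X)
  obtain ⟨i⟩ : Nonempty (LocalGen L) := ⟨U, ⟨⟨_, hxU⟩⟩, g, hg⟩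
  have hne : ∀ j : LocalGen L, P.ratPull j.g ≠ 0 := fun j =>
    (map_ne_zero_iff _ P.ratPull.injective).2 j.gen.1
  refine ⟨P.X.germToFunctionField _ (φ.sec i) * (P.ratPull i.g)⁻¹,
    mul_ne_zero (germ_ne_zero_of_isUnit (φ.isUnit i)) (inv_ne_zero (hne i)), fun j => ?_⟩
  have := nonempty_inf i.U j.U
  let k : LocalGen L := i.restrict (i.U ⊓ j.U) inf_le_left
  -- The quotient of the unit by the generator does not change on passing to a smaller local
  -- generator, and i and j have a common one.
  have key : ∀ l : LocalGen L, k ≤ l → P.X.germToFunctionField _ (φ.sec l) * (P.ratPull l.g)⁻¹ =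
      P.X.germToFunctionField _ (φ.sec k) * (P.ratPull k.g)⁻¹ := by
    intro l hl
    have h1 := congrArg (P.X.germToFunctionField _) (φ.compat hl)
    rw [map_mul, ← ratPull_germ, LocalGen.germ_ratio] at h1
    have h2 := (germToFunctionField_res (P.proj.preimage_mono (LocalGen.le_U hl)) _).symm.trans h1
    rw [h2, map_mul, map_inv₀]
    have := hne l
    field_simp
  rw [key i (i.restrict_le _ inf_le_left), ← key j (inf_le_right (a := i.U) (b := j.U)), inv_mul_cancel_right₀ (hne j)]

/-- Rational functions that are locally of weight one and invertible differ by rational functions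
on the base. -/
lemma exists_germ_eq_ratPull_mul {U V : C.X.Opens} [Nonempty U] [Nonempty V]
    {c : Γ(P.X, P.proj ⁻¹ᵁ U)} {d : Γ(P.X, P.proj ⁻¹ᵁ V)} (hc : P.IsWeight 1 U c)
    (hd : P.IsWeight 1 V d) (hc' : IsUnit c) :
    ∃ f ∈ @regularOn C.X _ (U ⊓ V) (nonempty_inf U V), P.X.germToFunctionField _ d =
      P.ratPull f * P.X.germToFunctionField _ c := by
  have := nonempty_inf U V
  obtain ⟨a, ha⟩ := isWeight_one_inv_mul (hc.res (inf_le_left (b := V)))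
    (hd.res (inf_le_right (a := U))) (hc'.map _)
  refine ⟨_, germ_mem_regularOn a, ?_⟩
  have h1 := congrArg (P.X.germToFunctionField _) ha
  rw [map_mul, ← ratPull_germ] at h1
  exact (germToFunctionField_res _ _).symm.trans (h1.trans (congrArg _ (germToFunctionField_res _ _)))

/-- The action of the real structure on a frame, in terms of its coefficient. -/
lemma conjComorphism_mul_conjSec_iff {h : C.X.functionField} (hL : IsCirclePair C L h)
    {φ : Frame L P.proj} {θ : P.X.functionField}
    (hθ : ∀ i, P.X.germToFunctionField _ (φ.sec i) = θ * P.ratPull i.g) (i : LocalGen L) :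
    P.conjComorphism i.U (φ.sec i) * φ.conjSec hL i = 1 ↔ P.ratConj θ * θ = P.ratPull h := by
  have h1 : P.X.germToFunctionField _ (P.conjComorphism i.U (φ.sec i)) =
      P.ratConj θ * P.ratPull (C.ratConj i.g) := by
    rw [← ratConj_germ_conjComorphism, hθ, map_mul, ratConj_ratPull]
  have h2 : P.X.germToFunctionField _ (φ.conjSec hL i) =
      θ * P.ratPull (h * C.ratConj i.g)⁻¹ := hθ (i.conj hL)
  have hh : P.ratPull h ≠ 0 := (map_ne_zero_iff _ P.ratPull.injective).2 hL.ne_zero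
  have hg : P.ratPull (C.ratConj i.g) ≠ 0 :=
    (map_ne_zero_iff _ P.ratPull.injective).2 (ratConj_ne_zero i.gen.1)
  rw [← (P.X.germToFunctionField_injective _).eq_iff, map_mul, map_one]
  refine Iff.trans (Eq.congr_left (congrArg₂ (· * ·) h1 h2)) ?_
  simp only [map_inv₀, map_mul]
  constructor
  · intro e
    field_simp at e
    linear_combination e
  · intro e
    field_simp
    linear_combination e

end CircleTorsor

namespace CircleTorsor

variable {C : RealVariety} {P : CircleTorsor C}

/-! ### The invertible submodule of a torsor -/

variable {θ : P.X.functionField}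

lemma IsUnitCoeff.res {U V : C.X.Opens} [Nonempty U] [Nonempty V] {k : C.X.functionField}
    (hk : P.IsUnitCoeff θ U k) (h : V ≤ U) : P.IsUnitCoeff θ V k := by
  obtain ⟨c, hc, hc1, hck⟩ := hk
  exact ⟨_, hc.map _, hc1.res h, (germToFunctionField_res _ _).trans hck⟩

lemma IsUnitCoeff.ne_zero {V : C.X.Opens} [Nonempty V] {k : C.X.functionField}
    (hk : P.IsUnitCoeff θ V k) : k ≠ 0 := by
  obtain ⟨c, hc, -, hck⟩ := hk
  rintro rfl
  exact germ_ne_zero_of_isUnit hc (by rw [hck, map_zero, mul_zero])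

/-- The quotient of the weight-one functions θ k and θ k' descends to a regular function, which must
be k/k'. -/
lemma IsUnitCoeff.mul_inv_mem (hθ : θ ≠ 0) {V : C.X.Opens} [Nonempty V] {k k' : C.X.functionField}
    (hk : P.IsUnitCoeff θ V k) (hk' : P.IsUnitCoeff θ V k') : k * k'⁻¹ ∈ regularOn V := by
  have hk0 := hk'.ne_zero
  obtain ⟨c, hc, hc1, hck⟩ := hk
  obtain ⟨c', hc', hc1', hck'⟩ := hk'
  obtain ⟨a, ha⟩ := isWeight_one_inv_mul hc1' hc1 hc'
  have h := congrArg (P.X.germToFunctionField _) ha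
  rw [map_mul, ← ratPull_germ, hck, hck', mul_left_comm, ← map_mul] at h
  rw [P.ratPull.injective (mul_left_cancel₀ hθ h), mul_inv_cancel_right₀ hk0]
  exact germ_mem_regularOn a

lemma IsUnitCoeff.mul_germ {V : C.X.Opens} [Nonempty V] {k : C.X.functionField}
    (hk : P.IsUnitCoeff θ V k) {a : Γ(C.X, V)} (ha : IsUnit a) :
    P.IsUnitCoeff θ V (C.X.germToFunctionField V a * k) := by
  obtain ⟨c, hc, hc1, hck⟩ := hk
  refine ⟨P.proj.app V a * c, (ha.map (P.proj.app V).hom).mul hc, ?_, ?_⟩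
  · simpa using (isWeight_base V a).mul hc1
  · rw [map_mul, ← ratPull_germ, hck, map_mul, mul_left_comm]

variable (P θ) in
/-- The submodule of `𝒦` generated by the quotients by `θ` of the invertible functions of weight
one. -/
def ratSubsheaf : RatSubsheaf C.X where
  sections U _ :=
    { carrier := {s | ∀ (V : C.X.Opens) [Nonempty V], V ≤ U → ∀ k, P.IsUnitCoeff θ V k →
        s * k⁻¹ ∈ regularOn V}
      zero_mem' := fun V _ _ k _ => by rw [zero_mul]; exact zero_mem _
      add_mem' := fun {s t} hs ht V _ hV k hk => by
        rw [add_mul]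
        exact add_mem (hs V hV k hk) (ht V hV k hk)
      smul_mem' := fun a s hs V _ hV k hk => by
        change (C.X.germToFunctionField U a * s) * k⁻¹ ∈ _
        rw [mul_assoc]
        exact mul_mem (regularOn_res hV (germ_mem_regularOn a)) (hs V hV k hk) }
  res {U V} _ _ hVU {s} hs W _ hW k hk := hs W (hW.trans hVU) k hk
  glue U _ s hs V _ hV k hk := by
    refine regularOn_glue V _ fun x hx => ?_
    obtain ⟨W, hW, hxW, -, h⟩ := hs x (hV hx)
    have : Nonempty (W ⊓ V : C.X.Opens) := ⟨⟨x, hxW, hx⟩⟩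
    exact ⟨W ⊓ V, this, ⟨hxW, hx⟩, inf_le_right, h _ inf_le_left k (hk.res inf_le_right)⟩

/-- The submodule is cut out by conditions against every such k on every smaller open subset, which
makes gluing immediate. One k is enough because the quotients k/k' are regular. -/
lemma IsUnitCoeff.isGen (hθ : θ ≠ 0) {V : C.X.Opens} [Nonempty V] {k : C.X.functionField}
    (hk : P.IsUnitCoeff θ V k) : (P.ratSubsheaf θ).IsGen V k := by
  refine ⟨hk.ne_zero, fun W _ hW s => ⟨fun hs => hs W le_rfl k (hk.res hW),
    fun hs W' _ hW' k' hk' => ?_⟩⟩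
  have h := mul_mem (regularOn_res hW' hs) ((hk.res (hW'.trans hW)).mul_inv_mem hθ hk')
  rwa [mul_assoc, inv_mul_cancel_left₀ hk.ne_zero] at h

/-- Invertible functions of weight one can be glued. -/
lemma IsUnitCoeff.glue (hθ : θ ≠ 0) {V : C.X.Opens} [Nonempty V] {k : C.X.functionField}
    (h : ∀ x ∈ V, ∃ (W : C.X.Opens) (_ : Nonempty W), x ∈ W ∧ W ≤ V ∧ P.IsUnitCoeff θ W k) :
    P.IsUnitCoeff θ V k := by
  obtain ⟨c, hc⟩ := exists_germToFunctionField_eq (P.proj ⁻¹ᵁ V) (θ * P.ratPull k) (by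
    intro p hp
    obtain ⟨W, hW, hxW, hWV, c, -, -, hc⟩ := h (P.proj p) hp
    exact ⟨P.proj ⁻¹ᵁ W, inferInstance, hxW, P.proj.preimage_mono hWV, c, hc⟩)
  -- The local inverses are glued as well, so that c is invertible on all of ρ⁻¹(V).
  obtain ⟨d, hd⟩ := exists_germToFunctionField_eq (P.proj ⁻¹ᵁ V) (θ * P.ratPull k)⁻¹ (by
    intro p hp
    obtain ⟨W, hW, hxW, hWV, c, ⟨u, rfl⟩, -, hc⟩ := h (P.proj p) hp
    refine ⟨P.proj ⁻¹ᵁ W, inferInstance, hxW, P.proj.preimage_mono hWV, (u⁻¹ : _ˣ), ?_⟩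
    rw [← hc]
    refine eq_inv_of_mul_eq_one_left ?_
    rw [← map_mul, Units.inv_mul, map_one])
  have hk : θ * P.ratPull k ≠ 0 := by
    obtain ⟨x⟩ := (inferInstance : Nonempty V)
    obtain ⟨W, hW, -, -, hk⟩ := h x.1 x.2
    exact mul_ne_zero hθ ((map_ne_zero_iff _ P.ratPull.injective).2 hk.ne_zero)
  refine ⟨c, IsUnit.of_mul_eq_one d (P.X.germToFunctionField_injective _ ?_),
    isWeight_of_cover fun x hx => ?_, hc⟩
  · rw [map_mul, hc, hd, mul_inv_cancel₀ hk, map_one]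
  · obtain ⟨W, hW, hxW, hWV, c', -, hc1, hc'⟩ := h x hx
    refine ⟨W, hWV, hxW, ?_⟩
    have e : P.X.presheaf.map (homOfLE (P.proj.preimage_mono hWV)).op c = c' :=
      P.X.germToFunctionField_injective _
        ((germToFunctionField_res _ _).trans (hc.trans hc'.symm))
    rw [e]
    exact hc1

/-- The unit σ^*c has weight −1, so its inverse has weight one again. -/
lemma exists_unit_conj {V : C.X.Opens} [Nonempty V] {c : Γ(P.X, P.proj ⁻¹ᵁ V)} (hc : IsUnit c)
    (hc1 : P.IsWeight 1 V c) : ∃ d : Γ(P.X, P.proj ⁻¹ᵁ C.conj ⁻¹ᵁ V), IsUnit d ∧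
      P.IsWeight 1 (C.conj ⁻¹ᵁ V) d ∧
      P.X.germToFunctionField _ d * P.ratConj (P.X.germToFunctionField _ c) = 1 := by
  obtain ⟨u, hu⟩ : IsUnit (P.conjComorphism V c) := hc.map _
  have h1 := hc1.conjComorphism
  rw [← hu] at h1
  refine ⟨(u⁻¹ : _ˣ), Units.isUnit _, by simpa using isWeight_unit_zpow h1 (-1), ?_⟩
  rw [ratConj_germ_conjComorphism, ← hu, ← map_mul, Units.inv_mul, map_one]

variable (P) in
/-- Every torsor is determined by a pair. -/
theorem exists_isDeterminedBy : ∃ (L : RatSubsheaf C.X) (h : C.X.functionField),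
    IsCirclePair C L h ∧ P.IsDeterminedBy L h := by
  obtain ⟨U₀, hU₀, ⟨t₀⟩⟩ := P.exists_splitting (genericPoint C.X)
  have : Nonempty U₀ := ⟨⟨_, hU₀⟩⟩
  -- A unit of weight one near the generic point serves as a reference for all other units of weight
  -- one.
  obtain ⟨θ, hθdef⟩ : ∃ θ, θ = P.X.germToFunctionField _ t₀.unit := ⟨_, rfl⟩
  have hθ : θ ≠ 0 := hθdef ▸ germ_ne_zero_of_isUnit t₀.isUnit
  have hE : ∀ {k : C.X.functionField}, k ≠ 0 → P.ratPull k ≠ 0 := fun hk =>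
    (map_ne_zero_iff _ P.ratPull.injective).2 hk
  have hlocal : ∀ x : C.X, ∃ (V : C.X.Opens) (_ : Nonempty V) (k : C.X.functionField),
      x ∈ V ∧ P.IsUnitCoeff θ V k := by
    intro x
    obtain ⟨V, hxV, ⟨t⟩⟩ := P.exists_splitting x
    have : Nonempty V := ⟨⟨x, hxV⟩⟩
    obtain ⟨f, -, hf⟩ := exists_germ_eq_ratPull_mul t₀.isWeight t.isWeight t₀.isUnit
    exact ⟨V, this, f, hxV, t.unit, t.isUnit, t.isWeight, by rw [hf, hθdef, mul_comm]⟩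
  -- Both θ and (σ^*θ)⁻¹ are units of weight one over nonempty open subsets, so their quotient comes
  -- from the base.
  obtain ⟨h, hh⟩ : ∃ h, P.ratConj θ * θ = P.ratPull h := by
    obtain ⟨d, hd, hd1, hdc⟩ := exists_unit_conj t₀.isUnit t₀.isWeight
    obtain ⟨f, -, hf⟩ := exists_germ_eq_ratPull_mul hd1 t₀.isWeight hd
    refine ⟨f, ?_⟩
    rw [← hθdef] at hf hdc
    linear_combination P.ratConj θ * hf + P.ratPull f * hdc
  have hh0 : h ≠ 0 := by
    rintro rfl
    rw [map_zero] at hh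
    exact mul_ne_zero (ratConj_ne_zero hθ) hθ hh
  -- The inverse of σ^*(θ k) is θ·(h τ^*k)⁻¹, because σ^*θ·θ = h.
  have hconj : ∀ (V : C.X.Opens) [Nonempty V] (k : C.X.functionField), P.IsUnitCoeff θ V k →
      P.IsUnitCoeff θ (C.conj ⁻¹ᵁ V) (h * C.ratConj k)⁻¹ := by
    rintro V _ k hk
    have hk0 := hE (ratConj_ne_zero hk.ne_zero)
    obtain ⟨c, hc, hc1, hck⟩ := hk
    obtain ⟨d, hd, hd1, hdc⟩ := exists_unit_conj hc hc1
    refine ⟨d, hd, hd1, ?_⟩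
    rw [hck, map_mul, ratConj_ratPull] at hdc
    have hh1 := hE hh0
    rw [map_inv₀, map_mul]
    field_simp
    rw [← hh]
    linear_combination θ * hdc
  have hL : IsCirclePair C (P.ratSubsheaf θ) h :=
    { invertible := RatSubsheaf.isInvertible_iff.2 fun x => by
        obtain ⟨V, _, k, hxV, hk⟩ := hlocal x
        exact ⟨V, hxV, k, hk.isGen hθ⟩
      ne_zero := hh0
      real := by
        apply P.ratPull.injective
        rw [← ratConj_ratPull, ← hh, map_mul, P.ratConj_ratConj, mul_comm]
      tensor_eq := RatSubsheaf.ext_of_isGen fun x => by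
        -- Around τ(x), so that near x the generators (h τ^*k)⁻¹ of L and τ^*k of τ^*L are both
        -- available; their product is h⁻¹.
        obtain ⟨V, _, k, hxV, hk⟩ := hlocal (C.conj x)
        refine ⟨C.conj ⁻¹ᵁ V, hxV, h⁻¹, ?_, RatSubsheaf.isGen_principal (inv_ne_zero hh0) _⟩
        have h1 := ((hconj V k hk).isGen hθ).tensor (hk.isGen hθ).pullbackConj
        rwa [mul_inv, inv_mul_cancel_right₀ (ratConj_ne_zero hk.ne_zero)] at h1 }
  -- An arbitrary generator of L is locally a unit times some k, so θ times it is locally a unit of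
  -- weight one, and such units glue.
  have hcoeff : P.IsCoeff (P.ratSubsheaf θ) θ := fun i =>
    IsUnitCoeff.glue (P := P) (V := i.U) hθ fun x hx => by
      obtain ⟨V, _, k, hxV, hk⟩ := hlocal x
      have : Nonempty (V ⊓ i.U : C.X.Opens) := ⟨⟨x, hxV, hx⟩⟩
      have hk' : P.IsUnitCoeff θ (V ⊓ i.U) k := hk.res inf_le_left
      obtain ⟨a, ha, hak⟩ := LocalGen.exists_ratio
        (i := ⟨V ⊓ i.U, this, k, hk'.isGen hθ⟩) (j := i) (inf_le_right (a := V))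
      refine ⟨V ⊓ i.U, this, ⟨hxV, hx⟩, inf_le_right, ?_⟩
      have h1 := hk'.mul_germ ha
      rwa [hak, inv_mul_cancel_right₀ hk'.ne_zero] at h1
  exact ⟨_, h, hL, isDeterminedBy_of_frame hL (isUniversal_of_isWeight hL.invertible hcoeff.isWeight)
    hcoeff.isWeight fun i => (conjComorphism_mul_conjSec_iff hL hcoeff.germ_sec i).2 hh⟩

end CircleTorsor

/-! ### Isomorphic torsors -/

namespace RatSubsheaf

variable {X : Scheme.{0}} [IsIntegral X] {L M : RatSubsheaf X}

lemma IsInvertible.dual (hL : L.IsInvertible) : L.dual.IsInvertible :=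
  isInvertible_iff.2 fun x =>
    let ⟨U, hx, g, hg⟩ := isInvertible_iff.1 hL x
    ⟨U, hx, g⁻¹, hg.dual⟩

lemma dual_tensor_self (hL : L.IsInvertible) : L.dual.tensor L = principal 1 :=
  ext_of_isGen fun x =>
    let ⟨U, hx, _, hg⟩ := isInvertible_iff.1 hL x
    ⟨U, hx, 1, inv_mul_cancel₀ hg.1 ▸ hg.dual.tensor hg, isGen_principal one_ne_zero U⟩

/-- Two divisions: g yields the generator f⁻¹g⁻¹ of the dual, and this yields f g for L. -/
lemma IsGen.of_dual_tensor_eq {f g : X.functionField} (hf : f ≠ 0) (hL : L.IsInvertible)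
    (h : L.dual.tensor M = principal f⁻¹) {U : X.Opens} (hg : M.IsGen U g) :
    L.IsGen U (f * g) := by
  have h1 := IsGen.of_tensor_eq_principal (inv_ne_zero hf) ((tensor_comm _ _).trans h) hL.dual hg
  have h2 := IsGen.of_tensor_eq_principal one_ne_zero (dual_tensor_self hL) hL h1
  rwa [one_mul, mul_inv, inv_inv, inv_inv] at h2

end RatSubsheaf

namespace CircleTorsor

variable {C : RealVariety} {P Q : CircleTorsor C} {L : RatSubsheaf C.X} {h : C.X.functionField}

/-- The frame of a presentation. -/
lemma Presentation.exists_isCoeff (hL : IsCirclePair C L h) (Pr : P.Presentation L h) :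
    ∃ θ : P.X.functionField, P.IsCoeff L θ ∧ P.ratConj θ * θ = P.ratPull h := by
  have hsec : ∀ i : LocalGen L, ∃ c : Γ(P.X, P.proj ⁻¹ᵁ i.U), IsUnit c ∧
      Pr.toLaurent i.U c = LaurentPolynomial.C i.g * LaurentPolynomial.T 1 := by
    intro i
    -- The cases n = 1 and n = −1 produce the preimage of gT together with its inverse.
    have key : ∀ n : ℤ, LaurentPolynomial.C (i.g ^ n) * LaurentPolynomial.T n ∈
        (Pr.toLaurent i.U).range := fun n => (Pr.mem_range_iff _ _).2 fun m => by
      rw [coeff_C_mul_T]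
      split_ifs with hm
      · rw [hm]
        exact (i.gen.zpow m).self_mem le_rfl
      · exact zero_mem _
    obtain ⟨c, hc⟩ := key 1
    obtain ⟨d, hd⟩ := key (-1)
    have hg := i.gen.1
    refine ⟨c, IsUnit.of_mul_eq_one d (Pr.injective i.U ?_), by rw [hc, zpow_one]⟩
    rw [map_mul, hc, hd, map_one, mul_mul_mul_comm, ← map_mul, ← LaurentPolynomial.T_add,
      zpow_one, zpow_neg_one, mul_inv_cancel₀ hg]
    simp
  choose c hc hcT using hsec
  let φ : Frame L P.proj :=
    { sec := c
      isUnit := hc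
      compat := fun {i j} hij => Pr.injective i.U (by
        rw [Pr.restrict (LocalGen.le_U hij), hcT, map_mul, hcT, Pr.base, LocalGen.germ_ratio,
          ← mul_assoc, ← map_mul, inv_mul_cancel_right₀ i.gen.1]) }
  obtain ⟨θ, hθ0, hθ⟩ := φ.exists_coeff hL.invertible
  have h1 : ∀ i, P.IsWeight 1 i.U (c i) := fun i => (Pr.weight i.U 1 _).2 ⟨_, hcT i⟩
  refine ⟨θ, fun i => ⟨c i, hc i, h1 i, hθ i⟩, ?_⟩
  -- One generator suffices, since the resulting condition on θ does not involve it.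
  obtain ⟨U, hxU, g, hg⟩ := RatSubsheaf.isInvertible_iff.1 hL.invertible (genericPoint C.X)
  obtain ⟨i⟩ : Nonempty (LocalGen L) := ⟨U, ⟨⟨_, hxU⟩⟩, g, hg⟩
  refine (conjComorphism_mul_conjSec_iff hL hθ i).1 (Pr.injective _ ?_)
  have h2 : Pr.toLaurent (C.conj ⁻¹ᵁ i.U) (φ.conjSec hL i) =
      LaurentPolynomial.C (h * C.ratConj i.g)⁻¹ * LaurentPolynomial.T 1 := hcT (i.conj hL)
  have h3 := mul_ne_zero hL.ne_zero (ratConj_ne_zero i.gen.1)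
  rw [map_mul, h2, Pr.conj i.U 1 _ _ (hcT i), map_one, mul_mul_mul_comm, ← map_mul,
    ← LaurentPolynomial.T_add, zpow_one, mul_inv_cancel₀ h3]
  simp

/-- Torsors with the same frames are isomorphic. -/
lemma IsCoeff.isIsomorphic (hL : IsCirclePair C L h) {θ : P.X.functionField}
    (hθ : P.IsCoeff L θ) (hθh : P.ratConj θ * θ = P.ratPull h) {η : Q.X.functionField}
    (hη : Q.IsCoeff L η) (hηh : Q.ratConj η * η = Q.ratPull h) : P.IsIsomorphic Q := by
  have hφ := isUniversal_of_isWeight hL.invertible hθ.isWeight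
  have hψ := isUniversal_of_isWeight hL.invertible hη.isWeight
  have hφa := isWeight_sec_iff.1 hθ.isWeight
  have hψa := isWeight_sec_iff.1 hη.isWeight
  have hφc := (conjComorphism_sec_iff hL).1 fun i =>
    (conjComorphism_mul_conjSec_iff hL hθ.germ_sec i).2 hθh
  have hψc := (conjComorphism_sec_iff hL).1 fun i =>
    (conjComorphism_mul_conjSec_iff hL hη.germ_sec i).2 hηh
  generalize hθ.frame = φ at *
  generalize hη.frame = ψ at *
  -- Each universal frame is the pull-back of the other, which gives mutually inverse morphisms.
  -- They respect action and real structure because the two frames satisfy the same identities.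
  obtain ⟨m, hm, hmψ⟩ := hψ.exists_pull_eq φ
  obtain ⟨n, hn, hnφ⟩ := hφ.exists_pull_eq ψ
  have hmn : m ≫ n = 𝟙 P.X := hφ.hom_ext (by rw [Category.assoc, hn, hm]) (Category.id_comp _) (by
    rw [← Frame.pull_pull φ n hn m hm, hnφ, hmψ, Frame.pull_id])
  have hnm : n ≫ m = 𝟙 Q.X := hψ.hom_ext (by rw [Category.assoc, hm, hn]) (Category.id_comp _) (by
    rw [← Frame.pull_pull ψ m hm n hn, hmψ, hnφ, Frame.pull_id])
  have hstr : m ≫ Q.str = P.str := by rw [← Q.proj_str, reassoc_of% hm, P.proj_str]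
  refine ⟨⟨m, n, hmn, hnm⟩, hm, ?_, hstr, ?_⟩
  · have hQ : (m ≫ Q.conj) ≫ Q.proj = P.proj ≫ C.conj := by
      rw [Category.assoc, Q.proj_real, reassoc_of% hm]
    have hP : (P.conj ≫ m) ≫ Q.proj = P.proj ≫ C.conj := by
      rw [Category.assoc, hm, P.proj_real]
    refine hψ.hom_ext hP hQ ?_
    rw [← Frame.pull_pull ψ m hm P.conj P.proj_real, hmψ, hφc,
      ← Frame.pull_pull ψ Q.conj Q.proj_real m (by rw [reassoc_of% hm]), hψc,
      Frame.pull_conjFrame ψ hL m hm, hmψ]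
  · obtain ⟨k, hk, hk1, hk2⟩ := exists_eq_pullback_map Gm.str P.str Gm.str Q.str (𝟙 Gm) m (𝟙 _)
      (by simp) (by rw [hstr, Category.comp_id])
    rw [Category.comp_id] at hk1
    refine Eq.trans ?_ (congrArg (· ≫ Q.action.act) hk)
    have hsm : pullback.snd Gm.str P.str ≫ P.proj = k ≫ pullback.snd Gm.str Q.str ≫ Q.proj := by
      rw [reassoc_of% hk2, hm]
    refine hψ.hom_ext (π := pullback.snd _ _ ≫ P.proj) (by rw [Category.assoc, hm, P.act_proj])
      (by rw [Category.assoc, Q.act_proj, hsm]) ?_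
    rw [← Frame.pull_pull ψ m hm P.action.act P.act_proj, hmψ, hφa,
      ← Frame.pull_pull ψ Q.action.act Q.act_proj k hsm.symm, hψa, Frame.pull_smul, hk1,
      Frame.pull_pull, ← hmψ, Frame.pull_pull]
    congr 1
    exact Frame.pull_congr ψ hk2.symm _ _

/-- The frame obtained by transport along an isomorphism. -/
lemma IsIsomorphic.exists_isCoeff (hL : IsCirclePair C L h) (hPQ : P.IsIsomorphic Q)
    {η : Q.X.functionField} (hη : Q.IsCoeff L η) (hηh : Q.ratConj η * η = Q.ratPull h) :
    ∃ θ : P.X.functionField, P.IsCoeff L θ ∧ P.ratConj θ * θ = P.ratPull h := by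
  obtain ⟨e, hm, hc, hstr, ha⟩ := hPQ
  have hψa := isWeight_sec_iff.1 hη.isWeight
  have hψc := (conjComorphism_sec_iff hL).1 fun i =>
    (conjComorphism_mul_conjSec_iff hL hη.germ_sec i).2 hηh
  generalize hη.frame = ψ at *
  obtain ⟨k, hk, hk1, hk2⟩ := exists_eq_pullback_map Gm.str P.str Gm.str Q.str (𝟙 Gm) e.hom (𝟙 _)
    (by simp) (by rw [hstr, Category.comp_id])
  rw [Category.comp_id] at hk1
  have ha' := ha.trans (congrArg (· ≫ Q.action.act) hk).symm
  clear hk ha hstr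
  generalize e.hom = m at *
  have h1 : ∀ i, P.IsWeight 1 i.U ((ψ.pull m hm).sec i) := by
    rw [isWeight_sec_iff]
    have hsm : k ≫ pullback.snd Gm.str Q.str ≫ Q.proj = pullback.snd Gm.str P.str ≫ P.proj := by
      rw [reassoc_of% hk2, hm]
    rw [Frame.pull_pull, Frame.pull_congr ψ ha' _ (by rw [Category.assoc, Q.act_proj, hsm]),
      ← Frame.pull_pull ψ Q.action.act Q.act_proj k hsm, hψa, Frame.pull_smul, hk1,
      Frame.pull_pull, Frame.pull_pull]
    congr 1
    exact Frame.pull_congr ψ hk2 _ _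
  have h2 : ∀ i, P.conjComorphism i.U ((ψ.pull m hm).sec i) * (ψ.pull m hm).conjSec hL i = 1 := by
    rw [conjComorphism_sec_iff]
    have hQ : m ≫ Q.proj ≫ C.conj = P.proj ≫ C.conj := by rw [reassoc_of% hm]
    rw [Frame.pull_pull, Frame.pull_congr ψ hc _ (by rw [Category.assoc, Q.proj_real, hQ]),
      ← Frame.pull_pull ψ Q.conj Q.proj_real m hQ, hψc, Frame.pull_conjFrame ψ hL m hm]
  obtain ⟨θ, hθ0, hθ⟩ := (ψ.pull m hm).exists_coeff hL.invertible
  obtain ⟨U, hxU, g, hg⟩ := RatSubsheaf.isInvertible_iff.1 hL.invertible (genericPoint C.X)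
  exact ⟨θ, fun i => ⟨_, (ψ.pull m hm).isUnit i, h1 i, hθ i⟩,
    (conjComorphism_mul_conjSec_iff hL hθ ⟨U, ⟨⟨_, hxU⟩⟩, g, hg⟩).1 (h2 _)⟩

/-- The condition means M = f⁻¹L: a generator g of M gives the generator f g of L, and θ·(f g) = (θ
f)·g. -/
lemma IsCoeff.twist {M : RatSubsheaf C.X} {f : C.X.functionField} (hf : f ≠ 0)
    (hL : L.IsInvertible) (hLM : L.dual.tensor M = RatSubsheaf.principal f⁻¹)
    {θ : P.X.functionField} (hθ : P.IsCoeff L θ) : P.IsCoeff M (θ * P.ratPull f) := by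
  intro i
  obtain ⟨c, hc, hc1, hck⟩ := hθ ⟨i.U, i.nonempty, f * i.g, i.gen.of_dual_tensor_eq hf hL hLM⟩
  exact ⟨c, hc, hc1, by rw [hck, map_mul, mul_assoc]⟩

/-- Both functions become units of weight one after multiplication by generators, so their quotient
is a rational function f on the base. Locally θ g and θ f g' are then units of weight one, so f g'
generates L wherever g' generates M. -/
lemma IsCoeff.exists_eq_twist {M : RatSubsheaf C.X} (hL : L.IsInvertible) (hM : M.IsInvertible)
    {θ η : P.X.functionField} (hθ : P.IsCoeff L θ) (hη : P.IsCoeff M η) :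
    ∃ f : C.X.functionField, f ≠ 0 ∧ L.dual.tensor M = RatSubsheaf.principal f⁻¹ ∧
      η = θ * P.ratPull f := by
  have hE : ∀ {k : C.X.functionField}, k ≠ 0 → P.ratPull k ≠ 0 := fun hk =>
    (map_ne_zero_iff _ P.ratPull.injective).2 hk
  obtain ⟨U, hxU, g, hg⟩ := RatSubsheaf.isInvertible_iff.1 hL (genericPoint C.X)
  obtain ⟨V, hxV, g', hg'⟩ := RatSubsheaf.isInvertible_iff.1 hM (genericPoint C.X)
  have hU : Nonempty U := ⟨⟨_, hxU⟩⟩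
  have hV : Nonempty V := ⟨⟨_, hxV⟩⟩
  obtain ⟨c, hc, hc1, hck⟩ := hθ ⟨U, hU, g, hg⟩
  obtain ⟨d, hd, hd1, hdk⟩ := hη ⟨V, hV, g', hg'⟩
  obtain ⟨a, -, ha⟩ := exists_germ_eq_ratPull_mul hc1 hd1 hc
  have hc0 := germ_ne_zero_of_isUnit hc
  have hd0 := germ_ne_zero_of_isUnit hd
  have hθ0 : θ ≠ 0 := by
    rintro rfl
    exact hc0 (hck.trans (zero_mul _))
  have ha0 : a ≠ 0 := by
    rintro rfl
    rw [map_zero, zero_mul] at ha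
    exact hd0 ha
  -- The value of f, obtained by solving η g' = a θ g for η/θ.
  have hf : a * g * g'⁻¹ ≠ 0 := mul_ne_zero (mul_ne_zero ha0 hg.1) (inv_ne_zero hg'.1)
  have hηθ : η = θ * P.ratPull (a * g * g'⁻¹) := by
    have h1 := hE hg'.1
    have h2 := hdk.symm.trans (ha.trans (congrArg _ hck))
    simp only [map_mul, map_inv₀]
    field_simp
    linear_combination h2
  refine ⟨_, hf, ?_, hηθ⟩
  generalize a * g * g'⁻¹ = f at *
  refine RatSubsheaf.ext_of_isGen fun x => ?_
  obtain ⟨U, hxU, g, hg⟩ := RatSubsheaf.isInvertible_iff.1 hL x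
  obtain ⟨V, hxV, g', hg'⟩ := RatSubsheaf.isInvertible_iff.1 hM x
  have hW : Nonempty (U ⊓ V : C.X.Opens) := ⟨⟨x, hxU, hxV⟩⟩
  have h1 : P.IsUnitCoeff θ (U ⊓ V) g := hθ ⟨U ⊓ V, hW, g, hg.res inf_le_left⟩
  have h2 : P.IsUnitCoeff θ (U ⊓ V) (f * g') := by
    obtain ⟨c, hc, hc1, hck⟩ := hη ⟨U ⊓ V, hW, g', hg'.res inf_le_right⟩
    exact ⟨c, hc, hc1, hck.trans (by rw [hηθ, map_mul, mul_assoc])⟩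
  have h3 : L.IsGen (U ⊓ V) (f * g') := (hg.res inf_le_left).mul_unit h2.ne_zero
    (h2.mul_inv_mem hθ0 h1) (h1.mul_inv_mem hθ0 h2)
  refine ⟨U ⊓ V, ⟨hxU, hxV⟩, f⁻¹, ?_, RatSubsheaf.isGen_principal (inv_ne_zero hf) _⟩
  have h4 := h3.dual.tensor (hg'.res (inf_le_right (a := U)))
  rwa [mul_inv, inv_mul_cancel_right₀ hg'.1] at h4

/-- Two pairs determine isomorphic torsors if and only if they are equivalent. -/
theorem isIsomorphic_iff {L₁ L₂ : RatSubsheaf C.X} {h₁ h₂ : C.X.functionField}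
    (hL₁ : IsCirclePair C L₁ h₁) (hL₂ : IsCirclePair C L₂ h₂) {P₁ P₂ : CircleTorsor C}
    (hP₁ : P₁.IsDeterminedBy L₁ h₁) (hP₂ : P₂.IsDeterminedBy L₂ h₂) :
    P₁.IsIsomorphic P₂ ↔ ∃ f : C.X.functionField, f ≠ 0 ∧
      L₁.dual.tensor L₂ = RatSubsheaf.principal f⁻¹ ∧ h₂ = (f * C.ratConj f) * h₁ := by
  obtain ⟨Pr₁⟩ := hP₁
  obtain ⟨Pr₂⟩ := hP₂
  obtain ⟨θ₁, hθ₁, hθh₁⟩ := Pr₁.exists_isCoeff hL₁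
  obtain ⟨θ₂, hθ₂, hθh₂⟩ := Pr₂.exists_isCoeff hL₂
  have key : ∀ f, P₁.ratConj (θ₁ * P₁.ratPull f) * (θ₁ * P₁.ratPull f) =
      P₁.ratPull ((f * C.ratConj f) * h₁) := fun f => by
    rw [map_mul P₁.ratConj, ratConj_ratPull, map_mul, map_mul, ← hθh₁]
    ring
  constructor
  · intro h
    -- Transporting the frame of P₂ by the isomorphism puts frames for both pairs on P₁, where they
    -- can be compared.
    obtain ⟨θ, hθ, hθh⟩ := h.exists_isCoeff hL₂ hθ₂ hθh₂
    obtain ⟨f, hf, hf', rfl⟩ := hθ₁.exists_eq_twist hL₁.invertible hL₂.invertible hθ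
    exact ⟨f, hf, hf', P₁.ratPull.injective (hθh.symm.trans (key f))⟩
  · rintro ⟨f, hf, hf', hh⟩
    -- The function θ₁f defines on P₁ a frame for the second pair, as θ₂ does on P₂.
    exact (hθ₁.twist hf hL₁.invertible hf').isIsomorphic hL₂ (by rw [key, hh]) hθ₂ hθh₂

end CircleTorsor

end CircleTorsors

end

theorem lemma1p6 (C : CircleTorsors.RealVariety) :
    -- every torsor is given by a pair
    (∀ P : CircleTorsors.CircleTorsor C,
      ∃ (L : CircleTorsors.RatSubsheaf C.X) (h : C.X.functionField),
        CircleTorsors.IsCirclePair C L h ∧ P.IsDeterminedBy L h) ∧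
    -- every pair determines a torsor
    (∀ (L : CircleTorsors.RatSubsheaf C.X) (h : C.X.functionField),
      CircleTorsors.IsCirclePair C L h →
        ∃ P : CircleTorsors.CircleTorsor C, P.IsDeterminedBy L h) ∧
    -- two pairs determine isomorphic torsors if and only if they are equivalent
    (∀ (L₁ L₂ : CircleTorsors.RatSubsheaf C.X) (h₁ h₂ : C.X.functionField),
      CircleTorsors.IsCirclePair C L₁ h₁ → CircleTorsors.IsCirclePair C L₂ h₂ →
      ∀ P₁ P₂ : CircleTorsors.CircleTorsor C,
        P₁.IsDeterminedBy L₁ h₁ → P₂.IsDeterminedBy L₂ h₂ →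
        (P₁.IsIsomorphic P₂ ↔
          ∃ f : C.X.functionField, f ≠ 0 ∧
            L₁.dual.tensor L₂ = CircleTorsors.RatSubsheaf.principal f⁻¹ ∧
            h₂ = (f * C.ratConj f) * h₁)) := by
  exact ⟨fun P => P.exists_isDeterminedBy,
    fun _ _ hL => CircleTorsors.exists_torsor_of_isCirclePair hL,
    fun _ _ _ _ hL₁ hL₂ _ _ hP₁ hP₂ => CircleTorsors.CircleTorsor.isIsomorphic_iff hL₁ hL₂ hP₁ hP₂⟩
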